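/- Let ${\bf k}$ be a field and $A=\bigoplus_{n\in\mathbb Z}A_n$ a $\mathbb Z$-graded associative unital ${\bf k}$-algebra with two graded subalgebras $N$ and $B$ such that: $N_n=0$ for $n<0$, $N_0={\bf k}$, and $\dim N_n<\infty$ for all $n$; $B_n=0$ for $n>0$; and the multiplication maps $B\otimes_{\bf k} N\to A$ and $N\otimes_{\bf k} B\to A$ are bijective. Let $({\rm mod}\text{-}A)_0$ be the category of $\mathbb Z$-graded right $A$-modules whose grading is bounded from above, with degree-preserving $A$-linear maps; $({\rm mod}\text{-}N)_0$ is defined in the same way, with $N$ graded by $N_n=N\cap A_n$. For a graded subalgebra $C\subset A$ let ${\rm Bar}^\bullet(A,C,A)$ be the normalized relative bar complex: for $n\ge 0$, ${\rm Bar}^{-n}(A,C,A)$ is the quotient of the tensor product $A\otimes_C\cdots\otimes_C A$ of $n+2$ copies of $A$ by the span of all $a_0\otimes\cdots\otimes a_{n+1}$ with $a_s\in C$ for some $1\le s\le n$, and $$d(a_0\otimes\cdots\otimes a_{n+1})=\sum_{s=0}^{n}(-1)^s\,a_0\otimes\cdots\otimes a_sa_{s+1}\otimes\cdots\otimes a_{n+1}.$$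 It is a complex of graded $A$-$A$-bimodules. For a right $A$-module $M\in({\rm mod}\text{-}A)_0$ let ${\rm hom}_A({\rm Bar}^{-p}(A,B,A),M)$ be the direct sum over $d\in\mathbb Z$ of the spaces of right $A$-module maps of degree $d$, with right $A$-action $(f\cdot a)(x)=f(ax)$; these modules form a complex in degrees $p\ge0$ with differential $f\mapsto(-1)^{p+1}f\circ d$. Let $${\rm Bar}^{\frac{\infty}{2}+\bullet}(A,N,M)={\rm hom}^\bullet_A({\rm Bar}^\bullet(A,B,A),M)\otimes_A{\rm Bar}^\bullet(A,N,A)$$ be the total tensor product complex: its term of degree $m$ is $\bigoplus_{p-n=m}{\rm hom}_A({\rm Bar}^{-p}(A,B,A),M)\otimes_A{\rm Bar}^{-n}(A,N,A)$, and its differential is $d(f\otimes y)=df\otimes y+(-1)^pf\otimes dy$. Then $S^\bullet={\rm Bar}^{\frac{\infty}{2}+\bullet}(A,N,M)$ is a semijective resolution of $M$. That is: (a) all terms of $S^\bullet$ lie in $({\rm mod}\text{-}A)_0$; (b) $S^\bullet$ is K-injective as a complex of $N$-modules: every morphism $X^\bullet\to S^\bullet$ of complexes over $({\rm mod}\text{-}N)_0$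 with $X^\bullet$ acyclic is homotopic to zero; (c) $S^\bullet$ is K-projective relative to $N$: every morphism $S^\bullet\to V^\bullet$ of complexes over $({\rm mod}\text{-}A)_0$, where $V^\bullet$ is homotopic to zero as a complex of $N$-modules, is homotopic to zero; (d) $S^\bullet$ is isomorphic, in the derived category of $({\rm mod}\text{-}A)_0$, to the complex with $M$ in degree $0$ and zero elsewhere. In particular $H^0(S^\bullet)\cong M$ as graded right $A$-modules and $H^n(S^\bullet)=0$ for $n\ne0$. -/

import Mathlib

open CategoryTheory DirectSum
open scoped TensorProduct

universe u

namespace SemiInf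

section GradedLinearAlgebra

variable {k : Type u} [Field k] {V W : Type u} [AddCommGroup V] [Module k V]
  [AddCommGroup W] [Module k W]

theorem isInternal_of_proj (𝒱 : ℤ → Submodule k V) (p : ℤ → V →ₗ[k] V)
    (h₁ : ∀ i, ∀ x ∈ 𝒱 i, p i x = x) (h₂ : ∀ i j, i ≠ j → ∀ x ∈ 𝒱 j, p i x = 0)
    (h : ⨆ i, 𝒱 i = ⊤) : IsInternal 𝒱 := by
  rw [isInternal_submodule_iff_iSupIndep_and_iSup_eq_top]
  refine ⟨fun i => ?_, h⟩
  rw [Submodule.disjoint_def]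
  intro x hx hx'
  have : (⨆ j, ⨆ (_ : j ≠ i), 𝒱 j) ≤ LinearMap.ker (p i) :=
    iSup₂_le fun j hj y hy => h₂ i j hj.symm y hy
  rw [← h₁ i x hx]
  exact this hx'

/-- The decomposition into homogeneous components. -/
noncomputable def dec {𝒱 : ℤ → Submodule k V} (h : IsInternal 𝒱) : V ≃ₗ[k] ⨁ i, 𝒱 i :=
  (LinearEquiv.ofBijective (DirectSum.coeLinearMap 𝒱) h).symm

theorem dec_of_mem {𝒱 : ℤ → Submodule k V} (h : IsInternal 𝒱) {i : ℤ} {x : V} (hx : x ∈ 𝒱 i) :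
    dec h x = DirectSum.lof k ℤ (fun i => 𝒱 i) i ⟨x, hx⟩ := by
  refine (LinearEquiv.symm_apply_eq _).2 ?_
  exact (DirectSum.coeLinearMap_lof 𝒱 i ⟨x, hx⟩).symm

/-- The projection onto the component of degree `i`. -/
noncomputable def proj {𝒱 : ℤ → Submodule k V} (h : IsInternal 𝒱) (i : ℤ) : V →ₗ[k] V :=
  (𝒱 i).subtype ∘ₗ DirectSum.component k ℤ (fun i => 𝒱 i) i ∘ₗ (dec h).toLinearMap

theorem proj_mem {𝒱 : ℤ → Submodule k V} (h : IsInternal 𝒱) (i : ℤ) (x : V) :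
    proj h i x ∈ 𝒱 i := by
  simp [proj]

theorem proj_same {𝒱 : ℤ → Submodule k V} (h : IsInternal 𝒱) (i : ℤ) (x : V) (hx : x ∈ 𝒱 i) :
    proj h i x = x := by
  simp [proj, dec_of_mem h hx, DirectSum.component.lof_self]

theorem proj_ne {𝒱 : ℤ → Submodule k V} (h : IsInternal 𝒱) (i j : ℤ) (hij : i ≠ j) (x : V)
    (hx : x ∈ 𝒱 j) : proj h i x = 0 := by
  simp [proj, dec_of_mem h hx, DirectSum.component.of, hij.symm]

theorem isInternal_quotient {𝒱 : ℤ → Submodule k V} (h : IsInternal 𝒱) (R : Submodule k V)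
    (hR : R ≤ ⨆ i, R ⊓ 𝒱 i) : IsInternal (fun i => (𝒱 i).map R.mkQ) := by
  have key : ∀ i, R ≤ R.comap (proj h i) := by
    intro i
    refine hR.trans (iSup_le fun j x hx => ?_)
    by_cases hij : i = j
    · subst hij
      simpa [proj_same h i x hx.2] using hx.1
    · simp [proj_ne h i j hij x hx.2]
  refine isInternal_of_proj _ (fun i => R.mapQ R (proj h i) (key i)) ?_ ?_ ?_
  · rintro i _ ⟨x, hx, rfl⟩
    simp [proj_same h i x hx]
  · rintro i j hij _ ⟨x, hx, rfl⟩
    simp [proj_ne h i j hij x hx]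
  · rw [← Submodule.map_iSup, h.submodule_iSup_eq_top, Submodule.map_top, Submodule.range_mkQ]

theorem top_le_of_homog {𝒱 : ℤ → Submodule k V} (h : IsInternal 𝒱) (S : Submodule k V)
    (hS : ∀ i, 𝒱 i ≤ S) (x : V) : x ∈ S := by
  have : (⨆ i, 𝒱 i) ≤ S := iSup_le hS
  rw [h.submodule_iSup_eq_top] at this
  exact this trivial

end GradedLinearAlgebra

variable {k A : Type u} [Field k] [Ring A] [Algebra k A]

/-- A `ℤ`-graded right module over the `ℤ`-graded `k`-algebra `A = ⨁ 𝒜 i`.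
The element `act a x` is `x · a`. -/
structure GrModR (𝒜 : ℤ → Submodule k A) where
  carrier : Type u
  [addCommGroup : AddCommGroup carrier]
  [module : Module k carrier]
  /-- the right action of `A` -/
  act : A →ₗ[k] carrier →ₗ[k] carrier
  act_one : ∀ x, act 1 x = x
  act_mul : ∀ a b x, act (a * b) x = act b (act a x)
  /-- the homogeneous component of a given degree -/
  deg : ℤ → Submodule k carrier
  isInternal : IsInternal deg
  act_mem : ∀ i j, ∀ x ∈ deg i, ∀ a ∈ 𝒜 j, act a x ∈ deg (i + j)

/-- A `ℤ`-graded `A`-`A`-bimodule on which `k` acts centrally.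
The elements `lact a x`, `ract a x` are `a · x`, `x · a`. -/
structure GrBimod (𝒜 : ℤ → Submodule k A) where
  carrier : Type u
  [addCommGroup : AddCommGroup carrier]
  [module : Module k carrier]
  /-- the left action of `A` -/
  lact : A →ₗ[k] carrier →ₗ[k] carrier
  lact_one : ∀ x, lact 1 x = x
  lact_mul : ∀ a b x, lact (a * b) x = lact a (lact b x)
  /-- the right action of `A` -/
  ract : A →ₗ[k] carrier →ₗ[k] carrier
  ract_one : ∀ x, ract 1 x = x
  ract_mul : ∀ a b x, ract (a * b) x = ract b (ract a x)
  lact_ract : ∀ a b x, lact a (ract b x) = ract b (lact a x)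
  /-- the homogeneous component of a given degree -/
  deg : ℤ → Submodule k carrier
  isInternal : IsInternal deg
  lact_mem : ∀ i j, ∀ x ∈ deg i, ∀ a ∈ 𝒜 j, lact a x ∈ deg (j + i)
  ract_mem : ∀ i j, ∀ x ∈ deg i, ∀ a ∈ 𝒜 j, ract a x ∈ deg (i + j)

attribute [instance] GrModR.addCommGroup GrModR.module GrBimod.addCommGroup GrBimod.module

namespace GrModR

variable {𝒜 : ℤ → Submodule k A}

/-- The grading of `M` is bounded from above. -/
def BoundedAbove (M : GrModR 𝒜) : Prop := ∃ K : ℤ, ∀ i, K < i → M.deg i = ⊥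

/-- Morphisms: `A`-linear maps which preserve the gradings. -/
@[ext]
structure Hom (M M' : GrModR 𝒜) where
  lin : M.carrier →ₗ[k] M'.carrier
  map_act : ∀ a x, lin (M.act a x) = M'.act a (lin x)
  map_deg : ∀ i, ∀ x ∈ M.deg i, lin x ∈ M'.deg i

instance : Category (GrModR 𝒜) where
  Hom := Hom
  id M := ⟨LinearMap.id, fun _ _ => rfl, fun _ _ h => h⟩
  comp f g := ⟨g.lin ∘ₗ f.lin, fun a x => by simp [f.map_act, g.map_act],
    fun i x hx => g.map_deg i _ (f.map_deg i x hx)⟩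

@[ext]
theorem hom_ext {M M' : GrModR 𝒜} {f g : M ⟶ M'} (h : f.lin = g.lin) : f = g := Hom.ext h

@[simp]
theorem id_lin (M : GrModR 𝒜) : Hom.lin (𝟙 M) = LinearMap.id := rfl

@[simp]
theorem comp_lin {M M' M'' : GrModR 𝒜} (f : M ⟶ M') (g : M' ⟶ M'') :
    (f ≫ g).lin = g.lin ∘ₗ f.lin := rfl

variable {M M' : GrModR 𝒜}

instance : Zero (M ⟶ M') := ⟨⟨0, by simp, by simp⟩⟩

instance : Add (M ⟶ M') := ⟨fun f g => ⟨f.lin + g.lin, by simp [f.map_act, g.map_act],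
  fun i x hx => add_mem (f.map_deg i x hx) (g.map_deg i x hx)⟩⟩

instance : Neg (M ⟶ M') := ⟨fun f => ⟨-f.lin, by simp [f.map_act],
  fun i x hx => neg_mem (f.map_deg i x hx)⟩⟩

instance : Sub (M ⟶ M') := ⟨fun f g => ⟨f.lin - g.lin, by simp [f.map_act, g.map_act],
  fun i x hx => sub_mem (f.map_deg i x hx) (g.map_deg i x hx)⟩⟩

instance : SMul ℕ (M ⟶ M') := ⟨fun n f => ⟨n • f.lin, by simp [f.map_act],
  fun i x hx => nsmul_mem (f.map_deg i x hx) n⟩⟩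

instance : SMul ℤ (M ⟶ M') := ⟨fun n f => ⟨n • f.lin, by simp [f.map_act],
  fun i x hx => zsmul_mem (f.map_deg i x hx) n⟩⟩

instance : AddCommGroup (M ⟶ M') :=
  Function.Injective.addCommGroup (fun f : M ⟶ M' => f.lin) (fun _ _ h => hom_ext h)
    rfl (fun _ _ => rfl) (fun _ => rfl) (fun _ _ => rfl) (fun _ _ => rfl) (fun _ _ => rfl)

@[simp]
theorem zero_lin : Hom.lin (0 : M ⟶ M') = 0 := rfl

@[simp]
theorem add_lin (f g : M ⟶ M') : Hom.lin (f + g) = f.lin + g.lin := rfl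

@[simp]
theorem zsmul_lin (n : ℤ) (f : M ⟶ M') : Hom.lin (n • f) = n • f.lin := rfl

instance : Preadditive (GrModR 𝒜) where
  add_comp _ _ _ f f' g := by ext x; simp
  comp_add _ _ _ f g g' := by ext x; simp

instance : Limits.HasZeroObject (GrModR 𝒜) where
  zero := ⟨{ carrier := PUnit
             act := 0
             act_one := fun _ => rfl
             act_mul := fun _ _ _ => rfl
             deg := fun _ => ⊥
             isInternal := isInternal_of_proj _ 0 (fun _ _ _ => rfl) (fun _ _ _ _ _ => rfl)
               (Subsingleton.elim _ _)
             act_mem := fun _ _ _ _ _ _ => rfl },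
    { unique_to := fun X => ⟨⟨⟨0⟩, fun f => by ext; exact map_zero f.lin⟩⟩
      unique_from := fun X => ⟨⟨⟨0⟩, fun f => by ext x⟩⟩ }⟩

/-- The restriction of a graded right `A`-module to a subalgebra `N`, which carries the grading
`N ∩ 𝒜 i`. -/
def restrict (N : Subalgebra k A) :
    GrModR 𝒜 ⥤ GrModR (fun i => (𝒜 i).comap N.val.toLinearMap) where
  obj M :=
    { carrier := M.carrier
      act := M.act ∘ₗ N.val.toLinearMap
      act_one := M.act_one
      act_mul := fun a b x => M.act_mul a b x
      deg := M.deg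
      isInternal := M.isInternal
      act_mem := fun i j x hx a ha => M.act_mem i j x hx a ha }
  map f := ⟨f.lin, fun a x => f.map_act a x, f.map_deg⟩

instance (N : Subalgebra k A) : (restrict (𝒜 := 𝒜) N).Additive where

end GrModR

/-- Morphisms of graded bimodules: bimodule maps which preserve the gradings. -/
structure GrBimod.Hom {𝒜 : ℤ → Submodule k A} (Y Y' : GrBimod 𝒜) where
  lin : Y.carrier →ₗ[k] Y'.carrier
  map_lact : ∀ a x, lin (Y.lact a x) = Y'.lact a (lin x)
  map_ract : ∀ a x, lin (Y.ract a x) = Y'.ract a (lin x)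
  map_deg : ∀ i, ∀ x ∈ Y.deg i, lin x ∈ Y'.deg i

section HomModule

variable {𝒜 : ℤ → Submodule k A}

/-- The right `A`-module maps `f : Y → M` with `f (Yᵢ) ⊆ Mᵢ₊ₙ` for all `i`. -/
def homDeg (Y : GrBimod 𝒜) (M : GrModR 𝒜) (n : ℤ) : Submodule k (Y.carrier →ₗ[k] M.carrier) where
  carrier := {f | (∀ a y, f (Y.ract a y) = M.act a (f y)) ∧
    ∀ i, ∀ y ∈ Y.deg i, f y ∈ M.deg (i + n)}
  add_mem' hf hg := ⟨fun a y => by simp [hf.1, hg.1],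
    fun i y hy => add_mem (hf.2 i y hy) (hg.2 i y hy)⟩
  zero_mem' := by simp
  smul_mem' c f hf := ⟨fun a y => by simp [hf.1],
    fun i y hy => Submodule.smul_mem _ c (hf.2 i y hy)⟩

/-- The space `hom_A(Y, M)` spanned by the homogeneous right `A`-module maps of all degrees. -/
def homSpace (Y : GrBimod 𝒜) (M : GrModR 𝒜) : Submodule k (Y.carrier →ₗ[k] M.carrier) :=
  ⨆ n, homDeg Y M n

theorem homDeg_le (Y : GrBimod 𝒜) (M : GrModR 𝒜) (n : ℤ) : homDeg Y M n ≤ homSpace Y M :=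
  le_iSup (homDeg Y M) n

theorem homDeg_indep (Y : GrBimod 𝒜) (M : GrModR 𝒜) : iSupIndep (homDeg Y M) := by
  intro n
  rw [Submodule.disjoint_def]
  intro f hf hf'
  ext y
  refine top_le_of_homog Y.isInternal (LinearMap.ker f) (fun i y hy => ?_) y
  have hle : (⨆ j, ⨆ (_ : j ≠ n), homDeg Y M j) ≤
      LinearMap.ker (proj M.isInternal (i + n) ∘ₗ LinearMap.applyₗ y) :=
    iSup₂_le fun j hj g hg => proj_ne _ _ _ (by omega) _ (hg.2 i y hy)
  have h0 := hle hf'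
  change proj M.isInternal (i + n) (f y) = 0 at h0
  rwa [proj_same _ _ _ (hf.2 i y hy)] at h0

theorem homSpace_isInternal (Y : GrBimod 𝒜) (M : GrModR 𝒜) :
    IsInternal fun n => (homDeg Y M n).comap (homSpace Y M).subtype := by
  rw [isInternal_submodule_iff_iSupIndep_and_iSup_eq_top]
  have hmap : ∀ n, ((homDeg Y M n).comap (homSpace Y M).subtype).map (homSpace Y M).subtype =
      homDeg Y M n := fun n => by
    rw [Submodule.map_comap_subtype, inf_eq_right]
    exact homDeg_le Y M n
  constructor
  · intro n
    rw [Submodule.disjoint_def]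
    intro f hf hf'
    have h1 := Submodule.disjoint_def.1 (homDeg_indep Y M n) f.1 hf ?_
    · exact Subtype.ext h1
    · have := Submodule.mem_map_of_mem (f := (homSpace Y M).subtype) hf'
      simp only [Submodule.map_iSup, hmap] at this
      exact this
  · apply Submodule.map_injective_of_injective (homSpace Y M).injective_subtype
    simp only [Submodule.map_iSup, hmap, Submodule.map_subtype_top]
    rfl

theorem lcomp_mem (Y : GrBimod 𝒜) (M : GrModR 𝒜) (i j : ℤ) (a : A) (ha : a ∈ 𝒜 j)
    (f : Y.carrier →ₗ[k] M.carrier) (hf : f ∈ homDeg Y M i) :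
    f ∘ₗ Y.lact a ∈ homDeg Y M (i + j) := by
  refine ⟨fun b y => ?_, fun l y hy => ?_⟩
  · simp [Y.lact_ract, hf.1]
  · have := hf.2 _ _ (Y.lact_mem l j y hy a ha)
    rwa [show j + l + i = l + (i + j) by ring] at this

theorem precomp_mem {Y Y' : GrBimod 𝒜} (g : GrBimod.Hom Y' Y) (M : GrModR 𝒜) (i : ℤ)
    (f : Y.carrier →ₗ[k] M.carrier) (hf : f ∈ homDeg Y M i) : f ∘ₗ g.lin ∈ homDeg Y' M i :=
  ⟨fun a y => by simp [g.map_ract, hf.1], fun l y hy => hf.2 l _ (g.map_deg l y hy)⟩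

theorem precomp_mem_homSpace {Y Y' : GrBimod 𝒜} (g : GrBimod.Hom Y' Y) (M : GrModR 𝒜)
    (f : Y.carrier →ₗ[k] M.carrier) (hf : f ∈ homSpace Y M) : f ∘ₗ g.lin ∈ homSpace Y' M := by
  have h1 : homSpace Y M ≤ (homSpace Y' M).comap (LinearMap.lcomp k M.carrier g.lin) :=
    iSup_le fun i f hf => homDeg_le Y' M _ (precomp_mem g M i f hf)
  exact h1 hf

variable [GradedAlgebra 𝒜]

theorem lcomp_mem_homSpace (Y : GrBimod 𝒜) (M : GrModR 𝒜) (a : A)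
    (f : Y.carrier →ₗ[k] M.carrier) (hf : f ∈ homSpace Y M) :
    f ∘ₗ Y.lact a ∈ homSpace Y M := by
  have h1 : homSpace Y M ≤ (homSpace Y M).comap
      (LinearMap.lcomp k M.carrier (Y.lact a)) := by
    refine iSup_le fun i g hg => ?_
    refine top_le_of_homog (Decomposition.isInternal 𝒜)
      ((homSpace Y M).comap ((LinearMap.llcomp k Y.carrier Y.carrier M.carrier g) ∘ₗ Y.lact))
      (fun j b hb => ?_) a
    exact homDeg_le Y M _ (lcomp_mem Y M i j b hb g hg)
  exact h1 hf

/-- The graded right `A`-module `hom_A(Y, M)`, with `(f · a)(y) = f (a · y)`. -/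
def homMod (Y : GrBimod 𝒜) (M : GrModR 𝒜) : GrModR 𝒜 where
  carrier := homSpace Y M
  act := LinearMap.mk₂ k (fun a f => ⟨f.1 ∘ₗ Y.lact a, lcomp_mem_homSpace Y M a f.1 f.2⟩)
    (fun _ _ _ => by ext; simp) (fun _ _ _ => by ext; simp) (fun _ _ _ => by ext; simp)
    (fun _ _ _ => by ext; simp)
  act_one f := by ext y; simp [Y.lact_one]
  act_mul a b f := by ext y; simp [Y.lact_mul]
  deg n := (homDeg Y M n).comap (homSpace Y M).subtype
  isInternal := homSpace_isInternal Y M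
  act_mem i j f hf a ha := lcomp_mem Y M i j a ha f.1 hf

/-- Composition with `g : Y' → Y`, as a morphism `hom_A(Y, M) ⟶ hom_A(Y', M)`. -/
def homMap {Y Y' : GrBimod 𝒜} (g : GrBimod.Hom Y' Y) (M : GrModR 𝒜) :
    homMod Y M ⟶ homMod Y' M where
  lin := (LinearMap.lcomp k M.carrier g.lin).restrict (precomp_mem_homSpace g M)
  map_act a f := by
    apply Subtype.ext
    ext y
    change f.1 (Y.lact a (g.lin y)) = f.1 (g.lin (Y'.lact a y))
    rw [g.map_lact]
  map_deg i f hf := precomp_mem g M i f.1 hf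

end HomModule

section Tensor

variable {𝒜 : ℤ → Submodule k A}

/-- The relations `x · a ⊗ y = x ⊗ a · y`. -/
def tensorRel (X : GrModR 𝒜) (Y : GrBimod 𝒜) : Submodule k (X.carrier ⊗[k] Y.carrier) :=
  Submodule.span k {t | ∃ x a y, t = X.act a x ⊗ₜ[k] y - x ⊗ₜ[k] Y.lact a y}

/-- The homogeneous components of the tensor product over the ground field. -/
def tensorDeg (X : GrModR 𝒜) (Y : GrBimod 𝒜) (n : ℤ) : Submodule k (X.carrier ⊗[k] Y.carrier) :=
  Submodule.span k {t | ∃ i j, i + j = n ∧ ∃ x ∈ X.deg i, ∃ y ∈ Y.deg j, t = x ⊗ₜ[k] y}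

theorem tmul_mem_tensorDeg {X : GrModR 𝒜} {Y : GrBimod 𝒜} {i j : ℤ} {x : X.carrier}
    {y : Y.carrier} (hx : x ∈ X.deg i) (hy : y ∈ Y.deg j) :
    x ⊗ₜ[k] y ∈ tensorDeg X Y (i + j) :=
  Submodule.subset_span ⟨i, j, rfl, x, hx, y, hy, rfl⟩

/-- The projection of the tensor product over the ground field to its degree `n` component. -/
noncomputable def tensorProj (X : GrModR 𝒜) (Y : GrBimod 𝒜) (n : ℤ) :
    X.carrier ⊗[k] Y.carrier →ₗ[k] X.carrier ⊗[k] Y.carrier :=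
  (DirectSum.toModule k (ℤ × ℤ) _ fun p : ℤ × ℤ =>
    if p.1 + p.2 = n then TensorProduct.map (X.deg p.1).subtype (Y.deg p.2).subtype else 0) ∘ₗ
    (TensorProduct.directSum k k (fun i => X.deg i) (fun i => Y.deg i)).toLinearMap ∘ₗ
    TensorProduct.map (dec X.isInternal).toLinearMap (dec Y.isInternal).toLinearMap

theorem tensorProj_tmul (X : GrModR 𝒜) (Y : GrBimod 𝒜) (n i j : ℤ) (x : X.carrier)
    (y : Y.carrier) (hx : x ∈ X.deg i) (hy : y ∈ Y.deg j) :
    tensorProj X Y n (x ⊗ₜ y) = if i + j = n then x ⊗ₜ y else 0 := by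
  simp only [tensorProj, LinearMap.comp_apply, TensorProduct.map_tmul, LinearEquiv.coe_coe,
    dec_of_mem _ hx, dec_of_mem _ hy, TensorProduct.directSum_lof_tmul_lof,
    DirectSum.toModule_lof]
  split_ifs <;> simp

theorem tensor_mem_of_homog (X : GrModR 𝒜) (Y : GrBimod 𝒜)
    (S : Submodule k (X.carrier ⊗[k] Y.carrier))
    (hS : ∀ i j, ∀ x ∈ X.deg i, ∀ y ∈ Y.deg j, x ⊗ₜ y ∈ S) : S = ⊤ := by
  rw [eq_top_iff, ← TensorProduct.span_tmul_eq_top, Submodule.span_le]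
  rintro _ ⟨x, y, rfl⟩
  refine top_le_of_homog X.isInternal (S.comap ((TensorProduct.mk k X.carrier Y.carrier).flip y)) (fun i x hx => ?_) x
  exact top_le_of_homog Y.isInternal (S.comap (TensorProduct.mk k X.carrier Y.carrier x))
    (fun j y hy => hS i j x hx y hy) y

theorem tensorDeg_isInternal (X : GrModR 𝒜) (Y : GrBimod 𝒜) : IsInternal (tensorDeg X Y) := by
  refine isInternal_of_proj _ (tensorProj X Y) (fun n => ?_) (fun n m hnm => ?_) ?_
  · have : tensorDeg X Y n ≤ LinearMap.ker (tensorProj X Y n - LinearMap.id) := by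
      refine Submodule.span_le.2 ?_
      rintro _ ⟨i, j, hij, x, hx, y, hy, rfl⟩
      simp [tensorProj_tmul X Y n i j x y hx hy, hij]
    intro t ht
    simpa [sub_eq_zero] using this ht
  · have : tensorDeg X Y m ≤ LinearMap.ker (tensorProj X Y n) := by
      refine Submodule.span_le.2 ?_
      rintro _ ⟨i, j, hij, x, hx, y, hy, rfl⟩
      simp [tensorProj_tmul X Y n i j x y hx hy, hij, hnm.symm]
    intro t ht
    exact this ht
  · exact tensor_mem_of_homog X Y _ fun i j x hx y hy =>
      Submodule.mem_iSup_of_mem (i + j) (tmul_mem_tensorDeg hx hy)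

theorem tensorRel_homog [GradedAlgebra 𝒜] (X : GrModR 𝒜) (Y : GrBimod 𝒜) :
    tensorRel X Y ≤ ⨆ n, tensorRel X Y ⊓ tensorDeg X Y n := by
  refine Submodule.span_le.2 ?_
  rintro _ ⟨x, a, y, rfl⟩
  set S := ⨆ n, tensorRel X Y ⊓ tensorDeg X Y n with hS
  -- the relation as a linear function of each of its three arguments
  have h3 : ∀ i j l, ∀ x ∈ X.deg i, ∀ a ∈ 𝒜 j, ∀ y ∈ Y.deg l,
      X.act a x ⊗ₜ[k] y - x ⊗ₜ[k] Y.lact a y ∈ S := by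
    intro i j l x hx a ha y hy
    refine Submodule.mem_iSup_of_mem (i + j + l) ⟨Submodule.subset_span ⟨x, a, y, rfl⟩, ?_⟩
    refine sub_mem (tmul_mem_tensorDeg (X.act_mem i j x hx a ha) hy) ?_
    rw [add_assoc]
    exact tmul_mem_tensorDeg hx (Y.lact_mem l j y hy a ha)
  have h2 : ∀ i j, ∀ x ∈ X.deg i, ∀ a ∈ 𝒜 j, ∀ y,
      X.act a x ⊗ₜ[k] y - x ⊗ₜ[k] Y.lact a y ∈ S := by
    intro i j x hx a ha y
    exact top_le_of_homog Y.isInternal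
      (S.comap (TensorProduct.mk k X.carrier Y.carrier (X.act a x) - TensorProduct.mk k X.carrier Y.carrier x ∘ₗ Y.lact a))
      (fun l y hy => h3 i j l x hx a ha y hy) y
  have h1 : ∀ i, ∀ x ∈ X.deg i, ∀ a y,
      X.act a x ⊗ₜ[k] y - x ⊗ₜ[k] Y.lact a y ∈ S := by
    intro i x hx a y
    exact top_le_of_homog (Decomposition.isInternal 𝒜)
      (S.comap ((TensorProduct.mk k X.carrier Y.carrier).flip y ∘ₗ X.act.flip x -
        TensorProduct.mk k X.carrier Y.carrier x ∘ₗ Y.lact.flip y))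
      (fun j a ha => h2 i j x hx a ha y) a
  exact top_le_of_homog X.isInternal
    (S.comap ((TensorProduct.mk k X.carrier Y.carrier).flip y ∘ₗ X.act a -
      (TensorProduct.mk k X.carrier Y.carrier).flip (Y.lact a y)))
    (fun i x hx => h1 i x hx a y) x

theorem tensorRel_le_ract (X : GrModR 𝒜) (Y : GrBimod 𝒜) (b : A) :
    tensorRel X Y ≤ (tensorRel X Y).comap ((Y.ract b).lTensor X.carrier) := by
  refine Submodule.span_le.2 ?_
  rintro _ ⟨x, a, y, rfl⟩
  refine Submodule.subset_span ⟨x, a, Y.ract b y, ?_⟩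
  simp [Y.lact_ract]

theorem tensorRel_le_map {X X' : GrModR 𝒜} {Y Y' : GrBimod 𝒜} (f : X ⟶ X')
    (g : GrBimod.Hom Y Y') :
    tensorRel X Y ≤ (tensorRel X' Y').comap (TensorProduct.map f.lin g.lin) := by
  refine Submodule.span_le.2 ?_
  rintro _ ⟨x, a, y, rfl⟩
  refine Submodule.subset_span ⟨f.lin x, a, g.lin y, ?_⟩
  simp [f.map_act, g.map_lact]

variable [GradedAlgebra 𝒜]

/-- The graded right `A`-module `X ⊗_A Y`. -/
noncomputable def tensorMod (X : GrModR 𝒜) (Y : GrBimod 𝒜) : GrModR 𝒜 where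
  carrier := (X.carrier ⊗[k] Y.carrier) ⧸ tensorRel X Y
  act :=
    { toFun := fun b => (tensorRel X Y).mapQ (tensorRel X Y) ((Y.ract b).lTensor X.carrier)
        (tensorRel_le_ract X Y b)
      map_add' := fun a b => by ext; simp
      map_smul' := fun c b => by ext; simp }
  act_one t := by
    obtain ⟨t, rfl⟩ := Submodule.mkQ_surjective _ t
    have : Y.ract 1 = LinearMap.id := LinearMap.ext Y.ract_one
    simp [this]
  act_mul a b t := by
    obtain ⟨t, rfl⟩ := Submodule.mkQ_surjective _ t
    have : Y.ract (a * b) = Y.ract b ∘ₗ Y.ract a := LinearMap.ext (Y.ract_mul a b)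
    simp [this, LinearMap.lTensor_comp]
  deg n := (tensorDeg X Y n).map (tensorRel X Y).mkQ
  isInternal := isInternal_quotient (tensorDeg_isInternal X Y) _ (tensorRel_homog X Y)
  act_mem i j := by
    rintro _ ⟨t, ht, rfl⟩ a ha
    have : tensorDeg X Y i ≤ (tensorDeg X Y (i + j)).comap ((Y.ract a).lTensor X.carrier) := by
      refine Submodule.span_le.2 ?_
      rintro _ ⟨l, m, rfl, x, hx, y, hy, rfl⟩
      rw [add_assoc]
      exact tmul_mem_tensorDeg hx (Y.ract_mem m j y hy a ha)
    exact ⟨_, this ht, rfl⟩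

/-- The map `f ⊗ g`. -/
noncomputable def tensorMap {X X' : GrModR 𝒜} {Y Y' : GrBimod 𝒜} (f : X ⟶ X')
    (g : GrBimod.Hom Y Y') : tensorMod X Y ⟶ tensorMod X' Y' where
  lin := (tensorRel X Y).mapQ (tensorRel X' Y') (TensorProduct.map f.lin g.lin)
    (tensorRel_le_map f g)
  map_act a t := by
    obtain ⟨t, rfl⟩ := Submodule.mkQ_surjective _ t
    have : TensorProduct.map f.lin g.lin ∘ₗ (Y.ract a).lTensor X.carrier =
        (Y'.ract a).lTensor X'.carrier ∘ₗ TensorProduct.map f.lin g.lin := by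
      ext x y
      simp [g.map_ract]
    exact congrArg (tensorRel X' Y').mkQ (LinearMap.congr_fun this t)
  map_deg n := by
    rintro _ ⟨t, ht, rfl⟩
    have : tensorDeg X Y n ≤ (tensorDeg X' Y' n).comap (TensorProduct.map f.lin g.lin) := by
      refine Submodule.span_le.2 ?_
      rintro _ ⟨i, j, rfl, x, hx, y, hy, rfl⟩
      exact tmul_mem_tensorDeg (f.map_deg i x hx) (g.map_deg j y hy)
    exact ⟨_, this ht, rfl⟩

/-- The class of `x ⊗ y` in `X ⊗_A Y`. -/
noncomputable def tmk (X : GrModR 𝒜) (Y : GrBimod 𝒜) :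
    X.carrier →ₗ[k] Y.carrier →ₗ[k] (tensorMod X Y).carrier :=
  (TensorProduct.mk k X.carrier Y.carrier).compr₂ (tensorRel X Y).mkQ

theorem tensor_hom_ext {X Z : GrModR 𝒜} {Y : GrBimod 𝒜} {f g : tensorMod X Y ⟶ Z}
    (h : ∀ x y, f.lin (tmk X Y x y) = g.lin (tmk X Y x y)) : f = g :=
  GrModR.hom_ext (Submodule.linearMap_qext _ (TensorProduct.ext' h))

end Tensor

section Sum

variable {𝒜 : ℤ → Submodule k A} {ι : Type} [DecidableEq ι] (F : ι → GrModR 𝒜)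

/-- The componentwise right action on a direct sum. -/
noncomputable def sumAct : A →ₗ[k] (⨁ i, (F i).carrier) →ₗ[k] ⨁ i, (F i).carrier where
  toFun a := DirectSum.lmap fun i => (F i).act a
  map_add' a b := by ext; simp
  map_smul' c b := by ext; simp

theorem sumAct_lof (a : A) (i : ι) (x : (F i).carrier) :
    sumAct F a (DirectSum.lof k ι (fun i => (F i).carrier) i x) =
      DirectSum.lof k ι (fun i => (F i).carrier) i ((F i).act a x) := by
  simp [sumAct]

/-- The homogeneous components of a direct sum. -/
def sumDeg (n : ℤ) : Submodule k (⨁ i, (F i).carrier) where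
  carrier := {x | ∀ i, x i ∈ (F i).deg n}
  add_mem' hx hy i := add_mem (hx i) (hy i)
  zero_mem' i := zero_mem _
  smul_mem' c x hx i := Submodule.smul_mem _ c (hx i)

theorem lof_mem_sumDeg (n : ℤ) (i : ι) (x : (F i).carrier) (hx : x ∈ (F i).deg n) :
    DirectSum.lof k ι (fun i => (F i).carrier) i x ∈ sumDeg F n := by
  intro j
  by_cases hij : i = j
  · subst hij
    rwa [DirectSum.lof_apply]
  · rw [DirectSum.lof_eq_of, DirectSum.of_eq_of_ne _ _ _ (Ne.symm hij)]
    exact zero_mem _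

theorem sumDeg_isInternal : IsInternal (sumDeg F) := by
  refine isInternal_of_proj _ (fun n => DirectSum.lmap fun i => proj (F i).isInternal n)
    (fun n x hx => ?_) (fun n m hnm x hx => ?_) ?_
  · exact DFinsupp.ext fun i => proj_same _ n _ (hx i)
  · exact DFinsupp.ext fun i => proj_ne _ n m hnm _ (hx i)
  · rw [eq_top_iff]
    intro x _
    induction x using DirectSum.induction_on with
    | zero => exact zero_mem _
    | add x y hx hy => exact add_mem (hx trivial) (hy trivial)
    | of i x =>
      exact top_le_of_homog (F i).isInternal
        ((⨆ n, sumDeg F n).comap (DirectSum.lof k ι (fun i => (F i).carrier) i))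
        (fun n y hy => Submodule.mem_iSup_of_mem n (lof_mem_sumDeg F n i y hy)) x

/-- The direct sum of a family of graded right `A`-modules. -/
noncomputable def sumMod : GrModR 𝒜 where
  carrier := ⨁ i, (F i).carrier
  act := sumAct F
  act_one x := DFinsupp.ext fun i => (F i).act_one (x i)
  act_mul a b x := DFinsupp.ext fun i => (F i).act_mul a b (x i)
  deg := sumDeg F
  isInternal := sumDeg_isInternal F
  act_mem n m x hx a ha i := (F i).act_mem n m _ (hx i) a ha

/-- The inclusion of a summand. -/
noncomputable def sumIncl (i : ι) : F i ⟶ sumMod F where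
  lin := DirectSum.lof k ι (fun i => (F i).carrier) i
  map_act a x := (sumAct_lof F a i x).symm
  map_deg n x hx := lof_mem_sumDeg F n i x hx

variable {F}

/-- The morphism from a direct sum given by its components. -/
noncomputable def sumDesc {M : GrModR 𝒜} (f : ∀ i, F i ⟶ M) : sumMod F ⟶ M where
  lin := DirectSum.toModule k ι M.carrier fun i => (f i).lin
  map_act a x := by
    have : DirectSum.toModule k ι M.carrier (fun i => (f i).lin) ∘ₗ sumAct F a =
        M.act a ∘ₗ DirectSum.toModule k ι M.carrier (fun i => (f i).lin) := by
      refine DirectSum.linearMap_ext k fun i => LinearMap.ext fun y => ?_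
      simp only [LinearMap.comp_apply, sumAct_lof, DirectSum.toModule_lof, (f i).map_act]
    exact LinearMap.congr_fun this x
  map_deg n x hx := by
    classical
    have key : ∀ z : ⨁ i, (F i).carrier, (∀ i, z i ∈ (F i).deg n) →
        DirectSum.toModule k ι M.carrier (fun i => (f i).lin) z ∈ M.deg n := by
      intro z hz
      rw [← DirectSum.sum_support_of z, map_sum]
      refine sum_mem fun i _ => ?_
      have h := DirectSum.toModule_lof k (φ := fun i => (f i).lin) i (z i)
      rw [DirectSum.lof_eq_of] at h
      rw [h]
      exact (f i).map_deg n _ (hz i)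
    exact key x hx

@[simp]
theorem sumIncl_sumDesc {M : GrModR 𝒜} (f : ∀ i, F i ⟶ M) (i : ι) :
    sumIncl F i ≫ sumDesc f = f i := by
  refine GrModR.hom_ext (LinearMap.ext fun x => ?_)
  exact DirectSum.toModule_lof k (φ := fun i => (f i).lin) i x

theorem sum_hom_ext {M : GrModR 𝒜} {f g : sumMod F ⟶ M}
    (h : ∀ i, sumIncl F i ≫ f = sumIncl F i ≫ g) : f = g :=
  GrModR.hom_ext (DirectSum.linearMap_ext k fun i => congrArg GrModR.Hom.lin (h i))

end Sum

section Bar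

/-- The `n`-th tensor power of `A` over the ground field `k`. -/
abbrev TPow (k A : Type u) [Field k] [Ring A] [Algebra k A] (n : ℕ) : Type u :=
  PiTensorProduct k fun _ : Fin n => A

variable (𝒜 : ℤ → Submodule k A) (C : Subalgebra k A)

/-- A linear endomorphism of `A` applied to the tensor factor with index `i`. -/
noncomputable def slot {n : ℕ} (i : Fin n) :
    (A →ₗ[k] A) →ₗ[k] TPow k A n →ₗ[k] TPow k A n where
  toFun g := PiTensorProduct.map (Function.update (fun _ => LinearMap.id) i g)
  map_add' g h := PiTensorProduct.map_update_add _ _ _ _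
  map_smul' c g := PiTensorProduct.map_update_smul _ _ _ _

@[simp]
theorem slot_tprod {n : ℕ} (i : Fin n) (g : A →ₗ[k] A) (a : Fin n → A) :
    slot i g (PiTensorProduct.tprod k a) =
      PiTensorProduct.tprod k (Function.update a i (g (a i))) := by
  simp only [slot, LinearMap.coe_mk, AddHom.coe_mk, PiTensorProduct.map_tprod]
  congr 1
  ext j
  by_cases h : j = i
  · subst h; simp
  · simp [h]

/-- The relations by which `A ⊗_C A ⊗_C ⋯ ⊗_C A` (`n + 2` factors), modulo the tensors with an
inner factor in `C`, is obtained from the tensor power of `A` over `k`. -/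
def barRel (n : ℕ) : Submodule k (TPow k A (n + 2)) :=
  Submodule.span k
    ({t | ∃ (a : Fin (n + 2) → A) (s : Fin (n + 1)) (c : A), c ∈ C ∧
        t = PiTensorProduct.tprod k (Function.update a s.castSucc (a s.castSucc * c)) -
          PiTensorProduct.tprod k (Function.update a s.succ (c * a s.succ))} ∪
     {t | ∃ (a : Fin (n + 2) → A) (s : Fin (n + 2)), s ≠ 0 ∧ s ≠ Fin.last (n + 1) ∧ a s ∈ C ∧
        t = PiTensorProduct.tprod k a})

variable {C} in
theorem bal_mem {n : ℕ} (a : Fin (n + 2) → A) (s : Fin (n + 1)) {c : A} (hc : c ∈ C) :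
    PiTensorProduct.tprod k (Function.update a s.castSucc (a s.castSucc * c)) -
      PiTensorProduct.tprod k (Function.update a s.succ (c * a s.succ)) ∈ barRel C n :=
  Submodule.subset_span (Or.inl ⟨a, s, c, hc, rfl⟩)

variable {C} in
theorem degen_mem {n : ℕ} (a : Fin (n + 2) → A) (s : Fin (n + 2)) (h0 : s ≠ 0)
    (hl : s ≠ Fin.last (n + 1)) (hs : a s ∈ C) : PiTensorProduct.tprod k a ∈ barRel C n :=
  Submodule.subset_span (Or.inr ⟨a, s, h0, hl, hs, rfl⟩)

/-- The homogeneous components of the tensor powers. -/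
def tpowDeg (n : ℕ) (d : ℤ) : Submodule k (TPow k A n) :=
  Submodule.span k {t | ∃ (a : Fin n → A) (e : Fin n → ℤ), (∀ i, a i ∈ 𝒜 (e i)) ∧
    ∑ i, e i = d ∧ t = PiTensorProduct.tprod k a}

variable {𝒜} in
theorem tprod_mem_tpowDeg {n : ℕ} {a : Fin n → A} {e : Fin n → ℤ} (h : ∀ i, a i ∈ 𝒜 (e i)) :
    PiTensorProduct.tprod k a ∈ tpowDeg 𝒜 n (∑ i, e i) :=
  Submodule.subset_span ⟨a, e, h, rfl, rfl⟩

variable {𝒜} in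
/-- Multiplying one factor of a homogeneous tensor by a homogeneous element. -/
theorem update_homog {n : ℕ} {a : Fin n → A} {e : Fin n → ℤ} (h : ∀ i, a i ∈ 𝒜 (e i))
    (i : Fin n) (b : A) (j : ℤ) (hb : b ∈ 𝒜 (e i + j)) :
    PiTensorProduct.tprod k (Function.update a i b) ∈ tpowDeg 𝒜 n ((∑ i, e i) + j) := by
  have h1 : ∀ l, Function.update a i b l ∈ 𝒜 ((e + Pi.single i j : Fin n → ℤ) l) := by
    intro l
    by_cases hl : l = i
    · subst hl; simpa using hb
    · simpa [hl] using h l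
  have h2 := tprod_mem_tpowDeg h1
  simpa [Finset.sum_add_distrib] using h2

section Graded

variable [GradedAlgebra 𝒜]

/-- To check that the values of a multilinear map lie in a submodule, it is enough to consider
homogeneous arguments. -/
theorem multilinear_mem {n : ℕ} {V : Type u} [AddCommGroup V] [Module k V]
    (f : MultilinearMap k (fun _ : Fin n => A) V) (S : Submodule k V) (P : Fin n → Submodule k A)
    (hP : ∀ i, SetLike.IsHomogeneous 𝒜 (P i))
    (h : ∀ (a : Fin n → A) (e : Fin n → ℤ), (∀ i, a i ∈ P i) → (∀ i, a i ∈ 𝒜 (e i)) → f a ∈ S)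
    (a : Fin n → A) (ha : ∀ i, a i ∈ P i) : f a ∈ S := by
  classical
  have key : f a = f fun i => ∑ j ∈ (decompose 𝒜 (a i)).support, (decompose 𝒜 (a i) j : A) := by
    congr 1
    ext i
    exact (DirectSum.sum_support_decompose 𝒜 (a i)).symm
  rw [key, f.map_sum_finset]
  exact sum_mem fun e _ => h _ e (fun i => hP i _ (ha i)) fun i => SetLike.coe_mem _

/-- The decomposition of the elements of `A` into homogeneous components. -/
noncomputable def decA : A →ₗ[k] Π₀ j, 𝒜 j := (decomposeLinearEquiv 𝒜).toLinearMap

theorem decA_of_mem {a : A} {j : ℤ} (h : a ∈ 𝒜 j) :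
    decA 𝒜 a = DFinsupp.single j (⟨a, h⟩ : 𝒜 j) :=
  decompose_of_mem 𝒜 h

/-- The projection of a tensor power to its degree `d` component. -/
noncomputable def tpowProj (n : ℕ) (d : ℤ) : TPow k A n →ₗ[k] TPow k A n :=
  (DFinsupp.lsum k fun p : Fin n → ℤ =>
    if ∑ i, p i = d then PiTensorProduct.map fun i => (𝒜 (p i)).subtype else 0) ∘ₗ
  (PiTensorProduct.ofDFinsuppEquiv (R := k) (ι := Fin n) (κ := fun _ => ℤ)
    (M := fun _ j => 𝒜 j)).toLinearMap ∘ₗ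
  PiTensorProduct.map fun _ : Fin n => decA 𝒜

theorem tpowProj_tprod (n : ℕ) (d : ℤ) (a : Fin n → A) (e : Fin n → ℤ) (h : ∀ i, a i ∈ 𝒜 (e i)) :
    tpowProj 𝒜 n d (PiTensorProduct.tprod k a) =
      if ∑ i, e i = d then PiTensorProduct.tprod k a else 0 := by
  have h1 : (fun i => decA 𝒜 (a i)) = fun i => DFinsupp.single (e i) (⟨a i, h i⟩ : 𝒜 (e i)) :=
    funext fun i => decA_of_mem 𝒜 (h i)
  simp only [tpowProj, LinearMap.comp_apply, PiTensorProduct.map_tprod, LinearEquiv.coe_coe, h1,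
    PiTensorProduct.ofDFinsuppEquiv_tprod_single, DFinsupp.lsum_single]
  split_ifs <;> simp [PiTensorProduct.map_tprod]

theorem isHomogeneous_top : SetLike.IsHomogeneous 𝒜 (⊤ : Submodule k A) := fun _ _ _ => trivial

theorem tpowDeg_isInternal (n : ℕ) : IsInternal (tpowDeg 𝒜 n) := by
  refine isInternal_of_proj _ (tpowProj 𝒜 n) (fun d => ?_) (fun d d' hd => ?_) ?_
  · have : tpowDeg 𝒜 n d ≤ LinearMap.ker (tpowProj 𝒜 n d - LinearMap.id) := by
      refine Submodule.span_le.2 ?_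
      rintro _ ⟨a, e, h, he, rfl⟩
      simp [tpowProj_tprod 𝒜 n d a e h, he]
    intro t ht
    simpa [sub_eq_zero] using this ht
  · have : tpowDeg 𝒜 n d' ≤ LinearMap.ker (tpowProj 𝒜 n d) := by
      refine Submodule.span_le.2 ?_
      rintro _ ⟨a, e, h, he, rfl⟩
      simp [tpowProj_tprod 𝒜 n d a e h, he, hd.symm]
    intro t ht
    exact this ht
  · rw [eq_top_iff, ← PiTensorProduct.span_tprod_eq_top, Submodule.span_le]
    rintro _ ⟨a, rfl⟩
    refine multilinear_mem 𝒜 (PiTensorProduct.tprod k) _ (fun _ => ⊤)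
      (fun _ => isHomogeneous_top 𝒜) (fun a e _ h => ?_) a (fun _ => trivial)
    exact Submodule.mem_iSup_of_mem _ (tprod_mem_tpowDeg h)

variable {C} in
theorem barRel_homog (hC : SetLike.IsHomogeneous 𝒜 C) (n : ℕ) :
    barRel C n ≤ ⨆ d, barRel C n ⊓ tpowDeg 𝒜 (n + 2) d := by
  refine Submodule.span_le.2 ?_
  rintro t (⟨a, s, c, hc, rfl⟩ | ⟨a, s, h0, hl, hs, rfl⟩)
  · set S := ⨆ d, barRel C n ⊓ tpowDeg 𝒜 (n + 2) d with hS
    -- the relation is multilinear in `a` and linear in `c`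
    let Φ : A →ₗ[k] TPow k A (n + 2) →ₗ[k] TPow k A (n + 2) :=
      slot s.castSucc ∘ₗ (LinearMap.mul k A).flip - slot s.succ ∘ₗ LinearMap.mul k A
    have hΦ : ∀ c a, Φ c (PiTensorProduct.tprod k a) =
        PiTensorProduct.tprod k (Function.update a s.castSucc (a s.castSucc * c)) -
          PiTensorProduct.tprod k (Function.update a s.succ (c * a s.succ)) := by
      intro c a
      simp [Φ]
    have hhom : ∀ j, ∀ c ∈ C, c ∈ 𝒜 j → Φ c (PiTensorProduct.tprod k a) ∈ S := by
      intro j c hc hj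
      refine multilinear_mem 𝒜 ((Φ c).compMultilinearMap (PiTensorProduct.tprod k)) S (fun _ => ⊤)
        (fun _ => isHomogeneous_top 𝒜) (fun a e _ h => ?_) a (fun _ => trivial)
      change Φ c (PiTensorProduct.tprod k a) ∈ S
      rw [hΦ]
      refine Submodule.mem_iSup_of_mem ((∑ i, e i) + j) ⟨bal_mem a s hc, sub_mem ?_ ?_⟩
      · exact update_homog h _ _ j (SetLike.mul_mem_graded (h _) hj)
      · exact update_homog h _ _ j (add_comm j (e s.succ) ▸ SetLike.mul_mem_graded hj (h _))
    change _ ∈ S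
    rw [← hΦ]
    classical
    rw [← DirectSum.sum_support_decompose 𝒜 c, map_sum, LinearMap.sum_apply]
    exact sum_mem fun j _ => hhom j _ (hC j hc) (SetLike.coe_mem _)
  · refine multilinear_mem 𝒜 (PiTensorProduct.tprod k) _
      (fun i => if i = s then Subalgebra.toSubmodule C else ⊤) (fun i => ?_) (fun a e ha h => ?_) a
      (fun i => ?_)
    · split_ifs
      · exact hC
      · exact isHomogeneous_top 𝒜
    · refine Submodule.mem_iSup_of_mem (∑ i, e i)
        ⟨degen_mem a s h0 hl ?_, tprod_mem_tpowDeg h⟩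
      simpa using ha s
    · split_ifs with hi
      · rw [hi]; exact hs
      · trivial

end Graded

theorem barRel_lact (n : ℕ) (b : A) :
    barRel C n ≤ (barRel C n).comap (slot 0 (LinearMap.mulLeft k b)) := by
  refine Submodule.span_le.2 ?_
  rintro t (⟨a, s, c, hc, rfl⟩ | ⟨a, s, h0, hl, hs, rfl⟩)
  · change slot 0 _ _ ∈ barRel C n
    rw [map_sub, slot_tprod, slot_tprod]
    convert bal_mem (Function.update a 0 (b * a 0)) s hc using 3
    all_goals
      ext j
      simp only [Function.update_apply, LinearMap.mulLeft_apply]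
      grind [Fin.succ_ne_zero]
  · change slot 0 _ _ ∈ barRel C n
    rw [slot_tprod]
    exact degen_mem _ s h0 hl (by simpa [h0] using hs)

theorem barRel_ract (n : ℕ) (b : A) :
    barRel C n ≤ (barRel C n).comap (slot (Fin.last (n + 1)) (LinearMap.mulRight k b)) := by
  refine Submodule.span_le.2 ?_
  rintro t (⟨a, s, c, hc, rfl⟩ | ⟨a, s, h0, hl, hs, rfl⟩)
  · change slot _ _ _ ∈ barRel C n
    rw [map_sub, slot_tprod, slot_tprod]
    have hne : s.castSucc ≠ Fin.last (n + 1) := (Fin.castSucc_lt_last s).ne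
    convert bal_mem (Function.update a (Fin.last (n + 1)) (a (Fin.last (n + 1)) * b)) s hc using 3
    all_goals
      ext j
      simp only [Function.update_apply, LinearMap.mulRight_apply]
      grind
  · change slot _ _ _ ∈ barRel C n
    rw [slot_tprod]
    exact degen_mem _ s h0 hl (by simpa [hl] using hs)


theorem exists_nat_fun {R : Type*} [Zero R] {n : ℕ} (a : Fin n → R) :
    ∃ α : ℕ → R, a = fun i : Fin n => α i.val :=
  ⟨fun i => if h : i < n then a ⟨i, h⟩ else 0, by ext i; simp⟩

/-- Replacing one argument before multiplying two neighbours replaces one argument afterwards. -/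
theorem contractNth_update {n : ℕ} (s : Fin n) (m : Fin (n + 1) → A) (i : Fin (n + 1)) :
    ∃ (j : Fin n) (φ : A →ₗ[k] A), ∀ x,
      Fin.contractNth s.castSucc (· * ·) (Function.update m i x) =
        Function.update (Fin.contractNth s.castSucc (· * ·) m) j (φ x) := by
  rcases lt_trichotomy i.val s.val with h | h | h
  · refine ⟨⟨i, by omega⟩, LinearMap.id, fun x => ?_⟩
    ext l
    simp only [Fin.contractNth, Function.update_apply, LinearMap.id_apply, Fin.ext_iff,
      Fin.val_castSucc, Fin.val_succ]
    grind
  · refine ⟨s, LinearMap.mulRight k (m s.succ), fun x => ?_⟩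
    ext l
    simp only [Fin.contractNth, Function.update_apply, LinearMap.mulRight_apply, Fin.ext_iff,
      Fin.val_castSucc, Fin.val_succ]
    grind
  · rcases eq_or_lt_of_le (Nat.succ_le_of_lt h) with h' | h'
    · refine ⟨s, LinearMap.mulLeft k (m s.castSucc), fun x => ?_⟩
      ext l
      simp only [Fin.contractNth, Function.update_apply, LinearMap.mulLeft_apply, Fin.ext_iff,
        Fin.val_castSucc, Fin.val_succ]
      grind
    · refine ⟨⟨i - 1, by omega⟩, LinearMap.id, fun x => ?_⟩
      ext l
      simp only [Fin.contractNth, Function.update_apply, LinearMap.id_apply, Fin.ext_iff,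
        Fin.val_castSucc, Fin.val_succ]
      grind

/-- The map `a₀ ⊗ ⋯ ⊗ aₙ ↦ a₀ ⊗ ⋯ ⊗ aₛ aₛ₊₁ ⊗ ⋯ ⊗ aₙ`. -/
noncomputable def contract {n : ℕ} (s : Fin n) : TPow k A (n + 1) →ₗ[k] TPow k A n :=
  PiTensorProduct.lift
    { toFun := fun a => PiTensorProduct.tprod k (Fin.contractNth s.castSucc (· * ·) a)
      map_update_add' := @fun inst m i x y => by
        obtain rfl : inst = instDecidableEqFin _ := Subsingleton.elim _ _
        obtain ⟨j, φ, h⟩ := contractNth_update (k := k) s m i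
        rw [h, h, h, map_add, MultilinearMap.map_update_add]
      map_update_smul' := @fun inst m i c x => by
        obtain rfl : inst = instDecidableEqFin _ := Subsingleton.elim _ _
        obtain ⟨j, φ, h⟩ := contractNth_update (k := k) s m i
        rw [h, h, map_smul, MultilinearMap.map_update_smul] }

theorem contract_tprod {n : ℕ} (s : Fin n) (a : Fin (n + 1) → A) :
    contract s (PiTensorProduct.tprod k a) =
      PiTensorProduct.tprod k (Fin.contractNth s.castSucc (· * ·) a) := by
  simp [contract]

/-- The differential
`a₀ ⊗ ⋯ ⊗ aₙ ↦ ∑ₛ (-1)ˢ a₀ ⊗ ⋯ ⊗ aₛ aₛ₊₁ ⊗ ⋯ ⊗ aₙ` of the bar construction. -/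
noncomputable def tD (n : ℕ) : TPow k A (n + 1) →ₗ[k] TPow k A n :=
  ∑ s : Fin n, (-1 : k) ^ (s : ℕ) • contract s

theorem tD_tprod (n : ℕ) (a : Fin (n + 1) → A) :
    tD n (PiTensorProduct.tprod k a) = ∑ s : Fin n, (-1 : k) ^ (s : ℕ) •
      PiTensorProduct.tprod k (Fin.contractNth s.castSucc (· * ·) a) := by
  simp [tD, contract_tprod]

/-- The map `x ↦ 1 ⊗ x`. -/
noncomputable def tCons (n : ℕ) : TPow k A n →ₗ[k] TPow k A (n + 1) :=
  PiTensorProduct.lift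
    { toFun := fun a => PiTensorProduct.tprod k (Fin.cons 1 a : Fin (n + 1) → A)
      map_update_add' := @fun inst m i x y => by
        obtain rfl : inst = instDecidableEqFin _ := Subsingleton.elim _ _
        simp only [Fin.cons_update, MultilinearMap.map_update_add]
      map_update_smul' := @fun inst m i c x => by
        obtain rfl : inst = instDecidableEqFin _ := Subsingleton.elim _ _
        simp only [Fin.cons_update, MultilinearMap.map_update_smul] }

theorem tCons_tprod (n : ℕ) (a : Fin n → A) :
    tCons n (PiTensorProduct.tprod k a) =
      PiTensorProduct.tprod k (Fin.cons 1 a : Fin (n + 1) → A) := by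
  simp [tCons]

theorem tD_tCons (n : ℕ) (x : TPow k A (n + 1)) :
    tD (n + 1) (tCons (n + 1) x) = x - tCons n (tD n x) := by
  have : tD (n + 1) ∘ₗ tCons (n + 1) = (LinearMap.id - tCons n ∘ₗ tD n :
      TPow k A (n + 1) →ₗ[k] TPow k A (n + 1)) := by
    refine PiTensorProduct.ext (MultilinearMap.ext fun a => ?_)
    simp only [LinearMap.compMultilinearMap_apply, LinearMap.comp_apply, tCons_tprod, tD_tprod,
      LinearMap.sub_apply, LinearMap.id_apply, Fin.sum_univ_succ, map_sum, map_smul]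
    rw [sub_eq_add_neg, ← Finset.sum_neg_distrib]
    congr 1
    · simp only [Fin.val_zero, pow_zero, one_smul]
      congr 1
      ext l
      refine Fin.cases ?_ (fun l => ?_) l <;> simp [Fin.contractNth]
    · refine Finset.sum_congr rfl fun s _ => ?_
      rw [Fin.val_succ, pow_succ, mul_neg_one, neg_smul]
      congr 3
      ext l
      refine Fin.cases ?_ (fun l => ?_) l <;> simp [Fin.contractNth]
  exact LinearMap.congr_fun this x

theorem tD_lact (n : ℕ) (b : A) (x : TPow k A (n + 2)) :
    tD (n + 1) (slot 0 (LinearMap.mulLeft k b) x) =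
      slot 0 (LinearMap.mulLeft k b) (tD (n + 1) x) := by
  have : tD (n + 1) ∘ₗ slot 0 (LinearMap.mulLeft k b) =
      slot 0 (LinearMap.mulLeft k b) ∘ₗ tD (k := k) (A := A) (n + 1) := by
    refine PiTensorProduct.ext (MultilinearMap.ext fun a => ?_)
    simp only [LinearMap.compMultilinearMap_apply, LinearMap.comp_apply, tD_tprod, slot_tprod,
      map_sum, map_smul, LinearMap.mulLeft_apply]
    obtain ⟨α, rfl⟩ := exists_nat_fun a
    refine Finset.sum_congr rfl fun s _ => ?_
    congr 2
    ext l
    simp only [Fin.contractNth, Function.update_apply, Fin.ext_iff, Fin.val_castSucc, Fin.val_succ,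
      Fin.val_zero]
    grind
  exact LinearMap.congr_fun this x

theorem tD_ract (n : ℕ) (b : A) (x : TPow k A (n + 2)) :
    tD (n + 1) (slot (Fin.last _) (LinearMap.mulRight k b) x) =
      slot (Fin.last _) (LinearMap.mulRight k b) (tD (n + 1) x) := by
  have : tD (n + 1) ∘ₗ slot (Fin.last _) (LinearMap.mulRight k b) =
      slot (Fin.last _) (LinearMap.mulRight k b) ∘ₗ tD (k := k) (A := A) (n + 1) := by
    refine PiTensorProduct.ext (MultilinearMap.ext fun a => ?_)
    simp only [LinearMap.compMultilinearMap_apply, LinearMap.comp_apply, tD_tprod, slot_tprod,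
      map_sum, map_smul, LinearMap.mulRight_apply]
    obtain ⟨α, rfl⟩ := exists_nat_fun a
    refine Finset.sum_congr rfl fun s _ => ?_
    congr 2
    ext l
    simp only [Fin.contractNth, Function.update_apply, Fin.ext_iff, Fin.val_castSucc, Fin.val_succ,
      Fin.val_last]
    grind [mul_assoc]
  exact LinearMap.congr_fun this x

theorem span_lact_tCons (n : ℕ) (S : Submodule k (TPow k A (n + 1)))
    (h : ∀ b x, slot 0 (LinearMap.mulLeft k b) (tCons n x) ∈ S) (y : TPow k A (n + 1)) :
    y ∈ S := by
  have : S = ⊤ := by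
    rw [eq_top_iff, ← PiTensorProduct.span_tprod_eq_top, Submodule.span_le]
    rintro _ ⟨a, rfl⟩
    have h1 := h (a 0) (PiTensorProduct.tprod k (Fin.tail a))
    rw [tCons_tprod, slot_tprod] at h1
    have h2 : Function.update (Fin.cons 1 (Fin.tail a) : Fin (n + 1) → A) 0
        (LinearMap.mulLeft k (a 0) ((Fin.cons 1 (Fin.tail a) : Fin (n + 1) → A) 0)) = a := by
      ext l
      refine Fin.cases ?_ (fun l => ?_) l <;> simp [Fin.tail]
    rwa [h2] at h1
  rw [this]
  trivial

theorem tD_tD (n : ℕ) (y : TPow k A (n + 3)) : tD (n + 1) (tD (n + 2) y) = 0 := by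
  induction n with
  | zero =>
    refine span_lact_tCons _ (LinearMap.ker (tD 1 ∘ₗ tD 2)) (fun b x => ?_) y
    have h0 : ∀ z : TPow k A 1, tD 0 z = 0 := fun z => by simp [tD]
    simp [tD_lact, tD_tCons, h0]
  | succ n ih =>
    refine span_lact_tCons _ (LinearMap.ker (tD (n + 2) ∘ₗ tD (n + 3))) (fun b x => ?_) y
    simp [tD_lact, tD_tCons, ih]

theorem tD_barRel (n : ℕ) : barRel C (n + 1) ≤ (barRel C n).comap (tD (n + 2)) := by
  refine Submodule.span_le.2 ?_
  rintro t (⟨a, t, c, hc, rfl⟩ | ⟨a, t, h0, hl, ht, rfl⟩)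
  · change tD (n + 2) _ ∈ barRel C n
    obtain ⟨α, rfl⟩ := exists_nat_fun a
    rw [map_sub, tD_tprod, tD_tprod, ← Finset.sum_sub_distrib]
    refine sum_mem fun s _ => ?_
    rw [← smul_sub]
    refine Submodule.smul_mem _ _ ?_
    rcases lt_trichotomy s.val t.val with h | h | h
    · convert bal_mem (C := C) (k := k) (Fin.contractNth s.castSucc (· * ·) fun i : Fin (n + 3) => α i.val)
        (⟨t - 1, by omega⟩ : Fin (n + 1)) hc using 3
      · ext l
        simp only [Fin.contractNth, Function.update_apply, Fin.ext_iff, Fin.val_castSucc,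
          Fin.val_succ]
        grind
      · ext l
        simp only [Fin.contractNth, Function.update_apply, Fin.ext_iff, Fin.val_castSucc,
          Fin.val_succ]
        grind
    · convert zero_mem (barRel C n)
      rw [sub_eq_zero]
      congr 1
      ext l
      simp only [Fin.contractNth, Function.update_apply, Fin.ext_iff, Fin.val_castSucc,
          Fin.val_succ]
      grind
    · convert bal_mem (C := C) (k := k) (Fin.contractNth s.castSucc (· * ·) fun i : Fin (n + 3) => α i.val)
        (⟨t, by omega⟩ : Fin (n + 1)) hc using 3
      · ext l
        simp only [Fin.contractNth, Function.update_apply, Fin.ext_iff, Fin.val_castSucc,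
          Fin.val_succ]
        grind
      · ext l
        simp only [Fin.contractNth, Function.update_apply, Fin.ext_iff, Fin.val_castSucc,
          Fin.val_succ]
        grind
  · change tD (n + 2) _ ∈ barRel C n
    obtain ⟨α, rfl⟩ := exists_nat_fun a
    have ht0 : 0 < t.val := Nat.pos_of_ne_zero fun h => h0 (Fin.ext h)
    have htl : t.val < n + 2 := lt_of_le_of_ne (Nat.le_of_lt_succ t.2) fun h => hl (Fin.ext h)
    let s₁ : Fin (n + 2) := ⟨t - 1, by omega⟩
    let s₂ : Fin (n + 2) := ⟨t, htl⟩
    have hne : s₁ ≠ s₂ := fun h => by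
      have := congrArg Fin.val h
      simp only [s₁, s₂] at this
      omega
    rw [tD_tprod, ← Submodule.Quotient.mk_eq_zero, ← Submodule.mkQ_apply, map_sum,
      Fintype.sum_eq_add s₁ s₂ hne]
    · rw [← map_add, Submodule.mkQ_apply, Submodule.Quotient.mk_eq_zero]
      have hp : ((-1 : k) ^ (s₂ : ℕ)) = -(-1 : k) ^ (s₁ : ℕ) := by
        have : (s₂ : ℕ) = (s₁ : ℕ) + 1 := by simp only [s₁, s₂]; omega
        rw [this, pow_succ, mul_neg_one]
      rw [hp, neg_smul, ← sub_eq_add_neg, ← smul_sub]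
      refine Submodule.smul_mem _ _ ?_
      convert bal_mem (C := C) (k := k) (fun l : Fin (n + 2) => if l.val < t.val then α l.val else α (l.val + 1))
        (⟨t - 1, by omega⟩ : Fin (n + 1)) ht using 3
      · ext l
        simp only [Fin.contractNth, Function.update_apply, Fin.ext_iff, Fin.val_castSucc,
          Fin.val_succ, s₁]
        grind
      · ext l
        simp only [Fin.contractNth, Function.update_apply, Fin.ext_iff, Fin.val_castSucc,
          Fin.val_succ, s₂]
        grind
    · rintro s ⟨hs₁, hs₂⟩
      rw [Submodule.mkQ_apply, Submodule.Quotient.mk_eq_zero]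
      refine Submodule.smul_mem _ _ ?_
      have hs₁' : s.val ≠ t - 1 := fun h => hs₁ (Fin.ext h)
      have hs₂' : s.val ≠ t := fun h => hs₂ (Fin.ext h)
      rcases lt_or_gt_of_ne hs₂' with h | h
      · refine degen_mem _ ⟨t - 1, by omega⟩ ?_ ?_ ?_
        · simp only [ne_eq, Fin.ext_iff, Fin.val_zero]; omega
        · simp only [ne_eq, Fin.ext_iff, Fin.val_last]; omega
        · convert ht using 1
          simp only [Fin.contractNth, Fin.val_castSucc, Fin.val_succ]
          grind
      · refine degen_mem _ ⟨t, by omega⟩ ?_ ?_ ?_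
        · simp only [ne_eq, Fin.ext_iff, Fin.val_zero]; omega
        · simp only [ne_eq, Fin.ext_iff, Fin.val_last]; omega
        · convert ht using 1
          simp only [Fin.contractNth, Fin.val_castSucc, Fin.val_succ]
          grind

theorem sum_contractNth {n : ℕ} (s : Fin n) (e : Fin (n + 1) → ℤ) :
    ∑ l, Fin.contractNth s.castSucc (· + ·) e l = ∑ l, e l := by
  obtain ⟨α, rfl⟩ := exists_nat_fun e
  rw [Fin.sum_univ_succAbove _ s.succ]
  have : ∀ l, Fin.contractNth s.castSucc (· + ·) (fun i : Fin (n + 1) => α i.val) l =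
      (if l = s then α (s.val + 1) else 0) + α (s.succ.succAbove l).val := by
    intro l
    simp only [Fin.contractNth, Fin.ext_iff, Fin.val_castSucc, Fin.succAbove, Fin.lt_def,
      Fin.val_succ, apply_ite Fin.val]
    grind
  simp [this, Finset.sum_add_distrib]

theorem tD_deg [GradedAlgebra 𝒜] (n : ℕ) (d : ℤ) :
    tpowDeg 𝒜 (n + 1) d ≤ (tpowDeg 𝒜 n d).comap (tD n) := by
  refine Submodule.span_le.2 ?_
  rintro _ ⟨a, e, h, rfl, rfl⟩
  change tD n _ ∈ tpowDeg 𝒜 n _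
  rw [tD_tprod]
  refine sum_mem fun s _ => Submodule.smul_mem _ _ ?_
  rw [← sum_contractNth s e]
  refine tprod_mem_tpowDeg fun l => ?_
  simp only [Fin.contractNth]
  split_ifs
  · exact h _
  · exact SetLike.mul_mem_graded (h _) (h _)
  · exact h _

/-- The left action of `A` on the first factor. -/
noncomputable def barLact (n : ℕ) :
    A →ₗ[k] (TPow k A (n + 2) ⧸ barRel C n) →ₗ[k] TPow k A (n + 2) ⧸ barRel C n where
  toFun b := (barRel C n).mapQ (barRel C n) (slot 0 (LinearMap.mulLeft k b)) (barRel_lact C n b)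
  map_add' a b := by
    refine Submodule.linearMap_qext _ (PiTensorProduct.ext (MultilinearMap.ext fun x => ?_))
    simp [add_mul, MultilinearMap.map_update_add]
  map_smul' c b := by
    refine Submodule.linearMap_qext _ (PiTensorProduct.ext (MultilinearMap.ext fun x => ?_))
    simp [MultilinearMap.map_update_smul]

/-- The right action of `A` on the last factor. -/
noncomputable def barRact (n : ℕ) :
    A →ₗ[k] (TPow k A (n + 2) ⧸ barRel C n) →ₗ[k] TPow k A (n + 2) ⧸ barRel C n where
  toFun b := (barRel C n).mapQ (barRel C n) (slot (Fin.last (n + 1)) (LinearMap.mulRight k b))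
    (barRel_ract C n b)
  map_add' a b := by
    refine Submodule.linearMap_qext _ (PiTensorProduct.ext (MultilinearMap.ext fun x => ?_))
    simp [mul_add, MultilinearMap.map_update_add]
  map_smul' c b := by
    refine Submodule.linearMap_qext _ (PiTensorProduct.ext (MultilinearMap.ext fun x => ?_))
    simp [MultilinearMap.map_update_smul]

theorem barLact_one (n : ℕ) : barLact C n 1 = (LinearMap.id :
    (TPow k A (n + 2) ⧸ barRel C n) →ₗ[k] TPow k A (n + 2) ⧸ barRel C n) := by
  refine Submodule.linearMap_qext _ (PiTensorProduct.ext (MultilinearMap.ext fun x => ?_))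
  simp [barLact]

theorem barLact_mul (n : ℕ) (a b : A) :
    barLact (k := k) C n (a * b) = barLact C n a ∘ₗ barLact C n b := by
  refine Submodule.linearMap_qext _ (PiTensorProduct.ext (MultilinearMap.ext fun x => ?_))
  simp [barLact]

theorem barRact_one (n : ℕ) : barRact C n 1 = (LinearMap.id :
    (TPow k A (n + 2) ⧸ barRel C n) →ₗ[k] TPow k A (n + 2) ⧸ barRel C n) := by
  refine Submodule.linearMap_qext _ (PiTensorProduct.ext (MultilinearMap.ext fun x => ?_))
  simp [barRact]

theorem barRact_mul (n : ℕ) (a b : A) :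
    barRact (k := k) C n (a * b) = barRact C n b ∘ₗ barRact C n a := by
  refine Submodule.linearMap_qext _ (PiTensorProduct.ext (MultilinearMap.ext fun x => ?_))
  simp [barRact, mul_assoc]

theorem barLact_barRact (n : ℕ) (a b : A) :
    barLact (k := k) C n a ∘ₗ barRact C n b = barRact C n b ∘ₗ barLact C n a := by
  refine Submodule.linearMap_qext _ (PiTensorProduct.ext (MultilinearMap.ext fun x => ?_))
  have h : (0 : Fin (n + 2)) ≠ Fin.last (n + 1) := by simp [Fin.ext_iff]
  simp [barLact, barRact, h, h.symm, Function.update_comm h]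

variable {𝒜 C} in
/-- The term of degree `-n` of the normalized bar complex `Bar(A, C, A)`, where `C` is a
homogeneous subalgebra of `A`, as a graded bimodule: the quotient of `A ⊗_C A ⊗_C ⋯ ⊗_C A`
(`n + 2` factors) by the span of the tensors with an inner factor in `C`. -/
noncomputable def bar [GradedAlgebra 𝒜] (hC : SetLike.IsHomogeneous 𝒜 C) (n : ℕ) : GrBimod 𝒜 where
  carrier := TPow k A (n + 2) ⧸ barRel C n
  lact := barLact C n
  lact_one := LinearMap.congr_fun (barLact_one C n)
  lact_mul a b := LinearMap.congr_fun (barLact_mul C n a b)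
  ract := barRact C n
  ract_one := LinearMap.congr_fun (barRact_one C n)
  ract_mul a b := LinearMap.congr_fun (barRact_mul C n a b)
  lact_ract a b := LinearMap.congr_fun (barLact_barRact C n a b)
  deg d := (tpowDeg 𝒜 (n + 2) d).map (barRel C n).mkQ
  isInternal := isInternal_quotient (tpowDeg_isInternal 𝒜 (n + 2)) _ (barRel_homog 𝒜 hC n)
  lact_mem i j := by
    rintro _ ⟨t, ht, rfl⟩ b hb
    have : tpowDeg 𝒜 (n + 2) i ≤
        (tpowDeg 𝒜 (n + 2) (j + i)).comap (slot 0 (LinearMap.mulLeft k b)) := by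
      refine Submodule.span_le.2 ?_
      rintro _ ⟨a, e, h, rfl, rfl⟩
      change slot 0 _ _ ∈ tpowDeg 𝒜 (n + 2) _
      rw [slot_tprod, add_comm j]
      exact update_homog h _ _ j (add_comm j (e 0) ▸ SetLike.mul_mem_graded hb (h _))
    exact ⟨_, this ht, rfl⟩
  ract_mem i j := by
    rintro _ ⟨t, ht, rfl⟩ b hb
    have : tpowDeg 𝒜 (n + 2) i ≤
        (tpowDeg 𝒜 (n + 2) (i + j)).comap (slot (Fin.last (n + 1)) (LinearMap.mulRight k b)) := by
      refine Submodule.span_le.2 ?_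
      rintro _ ⟨a, e, h, rfl, rfl⟩
      change slot _ _ _ ∈ tpowDeg 𝒜 (n + 2) _
      rw [slot_tprod]
      exact update_homog h _ _ j (SetLike.mul_mem_graded (h _) hb)
    exact ⟨_, this ht, rfl⟩

variable {𝒜 C} in
/-- The differential of the normalized bar complex. -/
noncomputable def barD [GradedAlgebra 𝒜] (hC : SetLike.IsHomogeneous 𝒜 C) (n : ℕ) :
    GrBimod.Hom (bar hC (n + 1)) (bar hC n) where
  lin := (barRel C (n + 1)).mapQ (barRel C n) (tD (n + 2)) (tD_barRel C n)
  map_lact b x := by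
    obtain ⟨x, rfl⟩ := Submodule.mkQ_surjective _ x
    exact congrArg (barRel C n).mkQ (tD_lact (n + 1) b x)
  map_ract b x := by
    obtain ⟨x, rfl⟩ := Submodule.mkQ_surjective _ x
    exact congrArg (barRel C n).mkQ (tD_ract (n + 1) b x)
  map_deg d := by
    rintro _ ⟨t, ht, rfl⟩
    exact ⟨_, tD_deg 𝒜 (n + 2) d ht, rfl⟩

variable {𝒜 C} in
theorem barD_barD [GradedAlgebra 𝒜] (hC : SetLike.IsHomogeneous 𝒜 C) (n : ℕ) :
    (barD hC n).lin ∘ₗ (barD hC (n + 1)).lin = 0 := by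
  refine LinearMap.ext fun x => ?_
  obtain ⟨x, rfl⟩ := Submodule.mkQ_surjective _ x
  exact (congrArg (barRel C n).mkQ (tD_tD (n + 1) x)).trans (map_zero _)

end Bar

section Complex

variable {𝒜 : ℤ → Submodule k A} [GradedAlgebra 𝒜]

/-- The identity of a graded bimodule. -/
def GrBimod.Hom.id (Y : GrBimod 𝒜) : GrBimod.Hom Y Y :=
  ⟨LinearMap.id, fun _ _ => rfl, fun _ _ => rfl, fun _ _ h => h⟩

variable {N B : Subalgebra k A} (hN : SetLike.IsHomogeneous 𝒜 N) (hB : SetLike.IsHomogeneous 𝒜 B)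
  (M : GrModR 𝒜)

/-- The term `hom_A(Bar⁻ᵖ(A, B, A), M) ⊗_A Bar⁻ⁿ(A, N, A)`. -/
noncomputable abbrev term (p n : ℕ) : GrModR 𝒜 := tensorMod (homMod (bar hB p) M) (bar hN n)

/-- The differential of `hom_A(Bar(A, B, A), M)`: as `M` sits in degree `0`, the differential
`f ↦ d_M ∘ f - (-1)ᵖ f ∘ d` is `f ↦ (-1)ᵖ⁺¹ f ∘ d` for `f` of degree `p`. -/
noncomputable def homD (p : ℕ) : homMod (bar hB p) M ⟶ homMod (bar hB (p + 1)) M :=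
  (-1 : ℤ) ^ (p + 1) • homMap (barD hB p) M

/-- The differential `f ⊗ y ↦ d f ⊗ y`. -/
noncomputable def termD₁ (p n : ℕ) : term hN hB M p n ⟶ term hN hB M (p + 1) n :=
  tensorMap (homD hB M p) (GrBimod.Hom.id _)

/-- The differential `f ⊗ y ↦ (-1)ᵖ f ⊗ d y` for `f` of degree `p`. -/
noncomputable def termD₂ (p n : ℕ) : term hN hB M p (n + 1) ⟶ term hN hB M p n :=
  (-1 : ℤ) ^ p • tensorMap (𝟙 _) (barD hN n)

/-- The pairs `(p, n)` with `p - n = m`. -/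
abbrev TotIdx (m : ℤ) : Type := {q : ℕ × ℕ // (q.1 : ℤ) - q.2 = m}

/-- The term of degree `m` of the total complex: the direct sum of the modules
`hom_A(Bar⁻ᵖ(A, B, A), M) ⊗_A Bar⁻ⁿ(A, N, A)` with `p - n = m`. -/
noncomputable abbrev totX (m : ℤ) : GrModR 𝒜 :=
  sumMod fun q : TotIdx m => term hN hB M q.1.1 q.1.2

/-- The part of the differential which lowers the bar degree `n` of the second factor. -/
noncomputable def totD₂ (m : ℤ) : ∀ (p n : ℕ), (p : ℤ) - n = m →
    (term hN hB M p n ⟶ totX hN hB M (m + 1))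
  | _, 0, _ => 0
  | p, n + 1, h => termD₂ hN hB M p n ≫
      sumIncl (fun q : TotIdx (m + 1) => term hN hB M q.1.1 q.1.2)
        ⟨(p, n), by push_cast at h ⊢; omega⟩

/-- The part of the differential which raises the degree `p` of the first factor. -/
noncomputable def totD₁ (m : ℤ) (p n : ℕ) (h : (p : ℤ) - n = m) :
    term hN hB M p n ⟶ totX hN hB M (m + 1) :=
  termD₁ hN hB M p n ≫ sumIncl (fun q : TotIdx (m + 1) => term hN hB M q.1.1 q.1.2)
    ⟨(p + 1, n), by push_cast; omega⟩

/-- The differential of the total complex. -/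
noncomputable def totD (m : ℤ) : totX hN hB M m ⟶ totX hN hB M (m + 1) :=
  sumDesc fun q : TotIdx m =>
    totD₁ hN hB M m q.1.1 q.1.2 q.2 + totD₂ hN hB M m q.1.1 q.1.2 q.2

theorem homD_homD (p : ℕ) : homD hB M p ≫ homD hB M (p + 1) = 0 := by
  have h : homMap (barD hB p) M ≫ homMap (barD hB (p + 1)) M = 0 := by
    refine GrModR.hom_ext (LinearMap.ext fun f => Subtype.ext (LinearMap.ext fun y => ?_))
    have h0 := LinearMap.congr_fun (barD_barD hB p) y
    exact (congrArg f.1 h0).trans (map_zero f.1)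
  simp [homD, h]

theorem termD₁_termD₁ (p n : ℕ) : termD₁ hN hB M p n ≫ termD₁ hN hB M (p + 1) n = 0 := by
  refine tensor_hom_ext fun f y => ?_
  have h : (homD hB M (p + 1)).lin ((homD hB M p).lin f) = 0 :=
    LinearMap.congr_fun (congrArg GrModR.Hom.lin (homD_homD hB M p)) f
  change tmk _ _ ((homD hB M (p + 1)).lin ((homD hB M p).lin f)) y = 0
  rw [h, map_zero, LinearMap.zero_apply]

theorem termD₂_termD₂ (p n : ℕ) : termD₂ hN hB M p (n + 1) ≫ termD₂ hN hB M p n = 0 := by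
  have h : tensorMap (𝟙 (homMod (bar hB p) M)) (barD hN (n + 1)) ≫
      tensorMap (𝟙 (homMod (bar hB p) M)) (barD hN n) = 0 := by
    refine tensor_hom_ext fun f y => ?_
    have h : (barD hN n).lin ((barD hN (n + 1)).lin y) = 0 :=
      LinearMap.congr_fun (barD_barD hN n) y
    change tmk _ _ f ((barD hN n).lin ((barD hN (n + 1)).lin y)) = 0
    rw [h, map_zero]
  simp only [termD₂, Preadditive.zsmul_comp, Preadditive.comp_zsmul]
  rw [h, smul_zero, smul_zero]

theorem termD₁_termD₂ (p n : ℕ) : termD₁ hN hB M p (n + 1) ≫ termD₂ hN hB M (p + 1) n +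
    termD₂ hN hB M p n ≫ termD₁ hN hB M p n = 0 := by
  have h : tensorMap (homD hB M p) (GrBimod.Hom.id (bar hN (n + 1))) ≫
        tensorMap (𝟙 (homMod (bar hB (p + 1)) M)) (barD hN n) =
      tensorMap (𝟙 (homMod (bar hB p) M)) (barD hN n) ≫
        tensorMap (homD hB M p) (GrBimod.Hom.id (bar hN n)) :=
    tensor_hom_ext fun f y => rfl
  simp only [termD₁, termD₂, Preadditive.zsmul_comp, Preadditive.comp_zsmul]
  rw [h, ← add_smul, pow_succ, mul_neg_one, neg_add_cancel, zero_smul]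

theorem totD_totD (m : ℤ) : totD hN hB M m ≫ totD hN hB M (m + 1) = 0 := by
  refine sum_hom_ext ?_
  rintro ⟨⟨p, n⟩, h⟩
  have e₁ : ∀ (m : ℤ) (p n : ℕ) (h : (p : ℤ) - n = m),
      sumIncl (fun q : TotIdx m => term hN hB M q.1.1 q.1.2) ⟨(p, n), h⟩ ≫ totD hN hB M m =
        totD₁ hN hB M m p n h + totD₂ hN hB M m p n h := fun m p n h => sumIncl_sumDesc _ _
  rw [Limits.comp_zero, ← Category.assoc, e₁, Preadditive.add_comp, totD₁, Category.assoc, e₁,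
    Preadditive.comp_add]
  rcases n with _ | _ | n
  · simp only [totD₁, totD₂, Limits.comp_zero, Limits.zero_comp, add_zero]
    rw [← Category.assoc, termD₁_termD₁, Limits.zero_comp]
  · simp only [totD₂, Category.assoc, e₁]
    simp only [totD₁, totD₂, Preadditive.comp_add, Limits.comp_zero, add_zero]
    simp only [← Category.assoc]
    rw [termD₁_termD₁, Limits.zero_comp]
    refine (congrArg₂ (· + ·) (zero_add _) rfl).trans ?_
    rw [← Preadditive.add_comp, termD₁_termD₂, Limits.zero_comp]
  · simp only [totD₂, Category.assoc, e₁]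
    simp only [totD₁, totD₂, Preadditive.comp_add]
    simp only [← Category.assoc]
    rw [termD₁_termD₁, termD₂_termD₂, Limits.zero_comp, Limits.zero_comp, zero_add, add_zero,
      ← Preadditive.add_comp, termD₁_termD₂, Limits.zero_comp]

/-- The complex `hom_A(Bar(A, B, A), M) ⊗_A Bar(A, N, A)` of graded right `A`-modules. -/
noncomputable def semiBar : CochainComplex (GrModR 𝒜) ℤ :=
  CochainComplex.of (totX hN hB M) (totD hN hB M) (totD_totD hN hB M)

end Complex

section Semijective

variable {𝒜 : ℤ → Submodule k A}

/-- All terms of the complex have gradings bounded from above. -/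
def TermsBoundedAbove (X : CochainComplex (GrModR 𝒜) ℤ) : Prop := ∀ n, (X.X n).BoundedAbove

/-- `x ∈ Xⁿ` is a cocycle. -/
def IsCocycle (X : CochainComplex (GrModR 𝒜) ℤ) (n : ℤ) (x : (X.X n).carrier) : Prop :=
  (X.d n (n + 1)).lin x = 0

/-- `x ∈ Xⁿ` is a coboundary. -/
def IsCobound (X : CochainComplex (GrModR 𝒜) ℤ) (n : ℤ) (x : (X.X n).carrier) : Prop :=
  ∃ y, (X.d (n - 1) n).lin y = x

/-- `Hⁿ(X) = 0`. -/
def CohomologyVanishes (X : CochainComplex (GrModR 𝒜) ℤ) (n : ℤ) : Prop :=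
  ∀ x, IsCocycle X n x → IsCobound X n x

/-- A morphism of complexes which induces isomorphisms on the cohomology. -/
def IsQuasiIso {X Y : CochainComplex (GrModR 𝒜) ℤ} (f : X ⟶ Y) : Prop :=
  ∀ n, (∀ x, IsCocycle X n x → IsCobound Y n ((f.f n).lin x) → IsCobound X n x) ∧
    ∀ y, IsCocycle Y n y → ∃ x, IsCocycle X n x ∧ IsCobound Y n (y - (f.f n).lin x)

/-- A complex of right `A`-modules, regarded as a complex of right `N`-modules. -/
noncomputable def restrictComplex (N : Subalgebra k A) (X : CochainComplex (GrModR 𝒜) ℤ) :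
    CochainComplex (GrModR fun i => (𝒜 i).comap N.val.toLinearMap) ℤ :=
  ((GrModR.restrict N).mapHomologicalComplex (ComplexShape.up ℤ)).obj X

/-- `S` is K-injective: every morphism from an acyclic complex (with gradings bounded from above)
to `S` is homotopic to zero. -/
def IsKInj (S : CochainComplex (GrModR 𝒜) ℤ) : Prop :=
  ∀ X : CochainComplex (GrModR 𝒜) ℤ, TermsBoundedAbove X → (∀ n, CohomologyVanishes X n) →
    ∀ f : X ⟶ S, Nonempty (Homotopy f 0)

/-- `S` is K-projective relative to `N`: every morphism from `S` to a complex (with gradings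
bounded from above) which is contractible as a complex of `N`-modules is homotopic to zero. -/
def IsRelKProj (N : Subalgebra k A) (S : CochainComplex (GrModR 𝒜) ℤ) : Prop :=
  ∀ V : CochainComplex (GrModR 𝒜) ℤ, TermsBoundedAbove V →
    Nonempty (Homotopy (𝟙 (restrictComplex N V)) 0) → ∀ f : S ⟶ V, Nonempty (Homotopy f 0)

/-- Semijective complexes of graded right `A`-modules with gradings bounded from above. -/
structure IsSemijective (N : Subalgebra k A) (S : CochainComplex (GrModR 𝒜) ℤ) : Prop where
  terms_boundedAbove : TermsBoundedAbove S
  kInj : IsKInj (restrictComplex N S)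
  relKProj : IsRelKProj N S

/-- `X` and `Y` are isomorphic in the derived category of graded right `A`-modules with gradings
bounded from above: there are quasi-isomorphisms `X → K ← Y`. -/
def IsDerivedIso (X Y : CochainComplex (GrModR 𝒜) ℤ) : Prop :=
  ∃ (K : CochainComplex (GrModR 𝒜) ℤ) (f : X ⟶ K) (g : Y ⟶ K),
    TermsBoundedAbove K ∧ IsQuasiIso f ∧ IsQuasiIso g

/-- `S` is a semijective resolution of the module `M`: it is a semijective complex which is
isomorphic in the derived category to the complex with `M` in degree `0`. -/
structure IsSemijectiveResolution (N : Subalgebra k A) (S : CochainComplex (GrModR 𝒜) ℤ)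
    (M : GrModR 𝒜) : Prop where
  semijective : IsSemijective N S
  derivedIso : IsDerivedIso S ((HomologicalComplex.single (GrModR 𝒜) (ComplexShape.up ℤ) 0).obj M)

/-- `Hⁿ(X) ≅ M` as graded right `A`-modules: there is an `A`-linear degree preserving map from the
cocycles onto `M` whose kernel consists of the coboundaries. -/
def CohomologyIso (X : CochainComplex (GrModR 𝒜) ℤ) (n : ℤ) (M : GrModR 𝒜) : Prop :=
  ∃ φ : LinearMap.ker (X.d n (n + 1)).lin →ₗ[k] M.carrier,
    Function.Surjective φ ∧ (∀ x, φ x = 0 ↔ IsCobound X n x.1) ∧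
    (∀ a x y, y.1 = (X.X n).act a x.1 → φ y = M.act a (φ x)) ∧
    ∀ i x, x.1 ∈ (X.X n).deg i → φ x ∈ M.deg i

/-- The assumptions on the graded algebra `A` and its graded subalgebras `N` and `B`: `N` lives in
degrees `≥ 0` with `N₀ = k` and finite-dimensional components, `B` lives in degrees `≤ 0`, and the
multiplication maps `B ⊗ N → A` and `N ⊗ B → A` are bijective. -/
structure TriangularDecomposition (𝒜 : ℤ → Submodule k A) [GradedAlgebra 𝒜]
    (N B : Subalgebra k A) : Prop where
  homogeneous_N : SetLike.IsHomogeneous 𝒜 N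
  homogeneous_B : SetLike.IsHomogeneous 𝒜 B
  N_nonneg : ∀ n < 0, Subalgebra.toSubmodule N ⊓ 𝒜 n = ⊥
  N_zero : Subalgebra.toSubmodule N ⊓ 𝒜 0 = 1
  N_finite : ∀ n, Module.Finite k ↥(Subalgebra.toSubmodule N ⊓ 𝒜 n)
  B_nonpos : ∀ n > 0, Subalgebra.toSubmodule B ⊓ 𝒜 n = ⊥
  bijective_BN : Function.Bijective
    (Submodule.mulMap (Subalgebra.toSubmodule B) (Subalgebra.toSubmodule N))
  bijective_NB : Function.Bijective
    (Submodule.mulMap (Subalgebra.toSubmodule N) (Subalgebra.toSubmodule B))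

end Semijective

end SemiInf

/-! Let J be the complex hom_A(Bar(A,B,A),M), called `coBar`, so that S = J ⊗_A Bar(A,N,A) is
`semiBar`. The proof compares three complexes by A-linear maps S → J ← M: the first is x ⊗ a ⊗ b ↦
x·ab in bar degree zero and zero elsewhere, the second is m ↦ (a ⊗ b ↦ m·ab).

The map S → J is a homotopy equivalence over N, with inverse x ↦ x ⊗ 1 ⊗ 1: appending a factor 1 to
a tensor of Bar(A,N,A) is linear for the right action of N, though not of A, and contracts the bar
complex onto its augmentation (`snocF_homotopy`). The map M → J is a quasi-isomorphism because
prepending a factor 1 contracts the augmented complex Bar(A,B,A) by right A-linear maps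
(`coaug_evalOne`, `exists_homD_eq`). Hence S and M are isomorphic in the derived category, which
also gives the cohomology of S.

K-injectivity over N is proved for J and carried to S by the homotopy equivalence. Since A = N ⊗ B,
the action map N ⊗ Bar(A,B,A) → Bar(A,B,A) has a splitting that is linear over N on the left and
over A on the right (`barSplit`). It turns any graded linear map into a term of J into an N-linear
one, naturally and without changing maps that are already N-linear (`hasCoextension_homMod`). As J
lives in degrees ≥ 0, a null homotopy of a map from an acyclic complex can be built degree by degree
(`isKInj_of_hasCoextension`).

For K-projectivity relative to N, each X ⊗_A Bar⁻ⁿ(A,N,A) is induced from N: an A-linear map out of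
it amounts to an N-linear map on the tensors with last factor 1 (`induce`, `tensor_bar_hom_ext`). An
N-linear contraction of V therefore yields A-linear maps on the terms of S, corrected recursively in
the bar degree n. The recursion is well founded because n is a natural number, and the pieces
assemble because S is the direct sum of its terms (`relHomotopy_comm`).

The gradings stay bounded because N sits in degrees ≥ 0 and B in degrees ≤ 0. Right A-linear maps
out of Bar(A,B,A) are determined on tensors of elements of N followed by 1, and X ⊗_A Bar(A,N,A) is
spanned by X tensored with elements of B. -/

namespace SemiInf

variable {k A : Type u} [Field k] [Ring A] [Algebra k A]

/-! ### Adjoining a factor 1 at either end of a tensor power. -/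

section TensorPower

/-- The map `x ↦ x ⊗ 1`. -/
noncomputable def tSnoc (n : ℕ) : TPow k A n →ₗ[k] TPow k A (n + 1) :=
  PiTensorProduct.lift
    { toFun := fun a => PiTensorProduct.tprod k (Fin.snoc a 1 : Fin (n + 1) → A)
      map_update_add' := @fun inst m i x y => by
        obtain rfl : inst = instDecidableEqFin _ := Subsingleton.elim _ _
        simp only [Fin.snoc_update, MultilinearMap.map_update_add]
      map_update_smul' := @fun inst m i c x => by
        obtain rfl : inst = instDecidableEqFin _ := Subsingleton.elim _ _
        simp only [Fin.snoc_update, MultilinearMap.map_update_smul] }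

theorem tSnoc_tprod (n : ℕ) (a : Fin n → A) :
    tSnoc n (PiTensorProduct.tprod k a) =
      PiTensorProduct.tprod k (Fin.snoc a 1 : Fin (n + 1) → A) := by
  simp [tSnoc]

/-- Every contraction except the last one commutes with appending 1. The last one multiplies the
final factor by 1 and returns x, with the sign of its index n. -/
theorem tD_tSnoc (n : ℕ) (x : TPow k A (n + 1)) :
    tD (n + 1) (tSnoc (n + 1) x) = tSnoc n (tD n x) + (-1 : k) ^ n • x := by
  have : tD (n + 1) ∘ₗ tSnoc (n + 1) = (tSnoc n ∘ₗ tD n + (-1 : k) ^ n • LinearMap.id :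
      TPow k A (n + 1) →ₗ[k] TPow k A (n + 1)) := by
    refine PiTensorProduct.ext (MultilinearMap.ext fun a => ?_)
    simp only [LinearMap.compMultilinearMap_apply, LinearMap.comp_apply, tSnoc_tprod, tD_tprod,
      LinearMap.add_apply, LinearMap.smul_apply, LinearMap.id_apply, Fin.sum_univ_castSucc, map_sum,
      map_smul]
    obtain ⟨α, rfl⟩ := exists_nat_fun a
    congr 1
    · refine Finset.sum_congr rfl fun s _ => ?_
      congr 2
      ext l
      simp only [Fin.contractNth, Fin.snoc, Fin.val_castSucc, Fin.val_succ]
      grind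
    · rw [Fin.val_last]
      congr 2
      ext l
      simp only [Fin.contractNth, Fin.snoc, Fin.val_castSucc, Fin.val_succ, Fin.val_last]
      grind
  exact LinearMap.congr_fun this x

/-- Inner factors stay inner and neighbours stay neighbours when a factor is appended, so each
generating relation goes to a relation of the same kind. -/
theorem tSnoc_barRel (C : Subalgebra k A) (n : ℕ) :
    barRel C n ≤ (barRel C (n + 1)).comap (tSnoc (n + 2)) := by
  refine Submodule.span_le.2 ?_
  rintro t (⟨a, s, c, hc, rfl⟩ | ⟨a, s, h0, hl, hs, rfl⟩)
  · change tSnoc _ _ ∈ barRel C (n + 1)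
    rw [map_sub, tSnoc_tprod, tSnoc_tprod]
    convert bal_mem (k := k) (Fin.snoc a 1 : Fin (n + 3) → A) s.castSucc hc using 3
    · rw [Fin.snoc_update, Fin.snoc_castSucc]
    · rw [Fin.snoc_update, ← Fin.castSucc_succ, Fin.snoc_castSucc]
  · change tSnoc _ _ ∈ barRel C (n + 1)
    rw [tSnoc_tprod]
    refine degen_mem _ s.castSucc (fun h => h0 (Fin.castSucc_injective _ h))
      (Fin.castSucc_lt_last s).ne ?_
    rwa [Fin.snoc_castSucc]

theorem tCons_barRel (C : Subalgebra k A) (n : ℕ) :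
    barRel C n ≤ (barRel C (n + 1)).comap (tCons (n + 2)) := by
  refine Submodule.span_le.2 ?_
  rintro t (⟨a, s, c, hc, rfl⟩ | ⟨a, s, h0, hl, hs, rfl⟩)
  · change tCons _ _ ∈ barRel C (n + 1)
    rw [map_sub, tCons_tprod, tCons_tprod]
    convert bal_mem (k := k) (Fin.cons 1 a : Fin (n + 3) → A) s.succ hc using 3
    · rw [Fin.cons_update, ← Fin.succ_castSucc, Fin.cons_succ]
    · rw [Fin.cons_update, Fin.cons_succ]
  · change tCons _ _ ∈ barRel C (n + 1)
    rw [tCons_tprod]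
    refine degen_mem _ s.succ (Fin.succ_ne_zero s) (by simpa [Fin.ext_iff] using hl) ?_
    rwa [Fin.cons_succ]

variable (𝒜 : ℤ → Submodule k A) [GradedAlgebra 𝒜]

theorem tSnoc_deg (n : ℕ) (d : ℤ) : tpowDeg 𝒜 n d ≤ (tpowDeg 𝒜 (n + 1) d).comap (tSnoc n) := by
  refine Submodule.span_le.2 ?_
  rintro _ ⟨a, e, h, rfl, rfl⟩
  change tSnoc n _ ∈ tpowDeg 𝒜 (n + 1) _
  rw [tSnoc_tprod]
  have := tprod_mem_tpowDeg (𝒜 := 𝒜) (a := (Fin.snoc a 1 : Fin (n + 1) → A))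
    (e := Fin.snoc e 0) fun i => by
      refine Fin.lastCases ?_ (fun i => ?_) i
      · simpa using SetLike.one_mem_graded 𝒜
      · simpa using h i
  simpa [Fin.sum_univ_castSucc] using this

theorem tCons_deg (n : ℕ) (d : ℤ) : tpowDeg 𝒜 n d ≤ (tpowDeg 𝒜 (n + 1) d).comap (tCons n) := by
  refine Submodule.span_le.2 ?_
  rintro _ ⟨a, e, h, rfl, rfl⟩
  change tCons n _ ∈ tpowDeg 𝒜 (n + 1) _
  rw [tCons_tprod]
  have := tprod_mem_tpowDeg (𝒜 := 𝒜) (a := (Fin.cons 1 a : Fin (n + 1) → A))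
    (e := Fin.cons 0 e) fun i => by
      refine Fin.cases ?_ (fun i => ?_) i
      · simpa using SetLike.one_mem_graded 𝒜
      · simpa using h i
  simpa [Fin.sum_univ_succ] using this

end TensorPower

/-! ### Calculus with elementary tensors in the normalized bar complex. -/

section BarElements

variable {𝒜 : ℤ → Submodule k A} [GradedAlgebra 𝒜] {C : Subalgebra k A}
  (hC : SetLike.IsHomogeneous 𝒜 C) (n : ℕ)

/-- The class of `a₀ ⊗ ⋯ ⊗ aₙ₊₁` in the bar complex. -/
noncomputable def bel : MultilinearMap k (fun _ : Fin (n + 2) => A) (bar hC n).carrier :=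
  (barRel C n).mkQ.compMultilinearMap (PiTensorProduct.tprod k)

variable {n}

theorem lact_bel (b : A) (a : Fin (n + 2) → A) :
    (bar hC n).lact b (bel hC n a) = bel hC n (Function.update a 0 (b * a 0)) :=
  congrArg (barRel C n).mkQ (slot_tprod 0 (LinearMap.mulLeft k b) a)

theorem ract_bel (b : A) (a : Fin (n + 2) → A) : (bar hC n).ract b (bel hC n a) =
    bel hC n (Function.update a (Fin.last (n + 1)) (a (Fin.last (n + 1)) * b)) :=
  congrArg (barRel C n).mkQ (slot_tprod (Fin.last (n + 1)) (LinearMap.mulRight k b) a)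

theorem bel_balanced (a : Fin (n + 2) → A) (s : Fin (n + 1)) {c : A} (hc : c ∈ C) :
    bel hC n (Function.update a s.castSucc (a s.castSucc * c)) =
      bel hC n (Function.update a s.succ (c * a s.succ)) :=
  (Submodule.Quotient.eq (barRel C n)).2 (bal_mem a s hc)

theorem bel_degenerate (a : Fin (n + 2) → A) (s : Fin (n + 2)) (h0 : s ≠ 0)
    (hl : s ≠ Fin.last (n + 1)) (hs : a s ∈ C) : bel hC n a = 0 :=
  (Submodule.Quotient.mk_eq_zero (barRel C n)).2 (degen_mem a s h0 hl hs)

theorem bel_mem_deg {a : Fin (n + 2) → A} {e : Fin (n + 2) → ℤ} (h : ∀ i, a i ∈ 𝒜 (e i)) :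
    bel hC n a ∈ (bar hC n).deg (∑ i, e i) :=
  ⟨_, tprod_mem_tpowDeg h, rfl⟩

variable {hC} in
theorem bar_ext {V : Type*} [AddCommGroup V] [Module k V] {f g : (bar hC n).carrier →ₗ[k] V}
    (h : ∀ a, f (bel hC n a) = g (bel hC n a)) : f = g :=
  Submodule.linearMap_qext _ (PiTensorProduct.ext (MultilinearMap.ext h))

variable {hC} in
theorem mem_of_bel (S : Submodule k (bar hC n).carrier) (h : ∀ a, bel hC n a ∈ S)
    (y : (bar hC n).carrier) : y ∈ S := by
  have : S.mkQ = 0 := bar_ext fun a => (Submodule.Quotient.mk_eq_zero S).2 (h a)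
  exact (Submodule.Quotient.mk_eq_zero S).1 (LinearMap.congr_fun this y)

variable {hC} in
theorem mem_of_bel_deg {d : ℤ} (S : Submodule k (bar hC n).carrier)
    (h : ∀ (a : Fin (n + 2) → A) (e : Fin (n + 2) → ℤ), (∀ i, a i ∈ 𝒜 (e i)) →
      ∑ i, e i = d → bel hC n a ∈ S) {y : (bar hC n).carrier} (hy : y ∈ (bar hC n).deg d) :
    y ∈ S := by
  obtain ⟨t, ht, rfl⟩ := hy
  have : tpowDeg 𝒜 (n + 2) d ≤ S.comap (barRel C n).mkQ := by
    refine Submodule.span_le.2 ?_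
    rintro _ ⟨a, e, h1, h2, rfl⟩
    exact h a e h1 h2
  exact this ht

/-- The linear map on the bar complex given by a multilinear map which respects the relations. -/
noncomputable def barLift {V : Type*} [AddCommGroup V] [Module k V]
    (φ : MultilinearMap k (fun _ : Fin (n + 2) => A) V)
    (h₁ : ∀ (a : Fin (n + 2) → A) (s : Fin (n + 1)), ∀ c ∈ C,
      φ (Function.update a s.castSucc (a s.castSucc * c)) =
        φ (Function.update a s.succ (c * a s.succ)))
    (h₂ : ∀ (a : Fin (n + 2) → A) (s : Fin (n + 2)), s ≠ 0 → s ≠ Fin.last (n + 1) → a s ∈ C →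
      φ a = 0) : (bar hC n).carrier →ₗ[k] V :=
  (barRel C n).liftQ (PiTensorProduct.lift φ) <| by
    refine Submodule.span_le.2 ?_
    rintro t (⟨a, s, c, hc, rfl⟩ | ⟨a, s, h0, hl, hs, rfl⟩)
    · simp [h₁ a s c hc]
    · simp [h₂ a s h0 hl hs]

theorem barLift_bel {V : Type*} [AddCommGroup V] [Module k V]
    (φ : MultilinearMap k (fun _ : Fin (n + 2) => A) V) (h₁ h₂) (a : Fin (n + 2) → A) :
    barLift hC φ h₁ h₂ (bel hC n a) = φ a :=
  PiTensorProduct.lift.tprod a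

variable (n)

/-- The map `a₀ ⊗ ⋯ ⊗ aₙ₊₁ ↦ a₀ ⊗ ⋯ ⊗ aₙ₊₁ ⊗ 1`. -/
noncomputable def barSnoc : (bar hC n).carrier →ₗ[k] (bar hC (n + 1)).carrier :=
  (barRel C n).mapQ (barRel C (n + 1)) (tSnoc (n + 2)) (tSnoc_barRel C n)

/-- The map `a₀ ⊗ ⋯ ⊗ aₙ₊₁ ↦ 1 ⊗ a₀ ⊗ ⋯ ⊗ aₙ₊₁`. -/
noncomputable def barCons : (bar hC n).carrier →ₗ[k] (bar hC (n + 1)).carrier :=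
  (barRel C n).mapQ (barRel C (n + 1)) (tCons (n + 2)) (tCons_barRel C n)

variable {n}

theorem barSnoc_bel (a : Fin (n + 2) → A) :
    barSnoc hC n (bel hC n a) = bel hC (n + 1) (Fin.snoc a 1 : Fin (n + 3) → A) :=
  congrArg (barRel C (n + 1)).mkQ (tSnoc_tprod _ a)

theorem barCons_bel (a : Fin (n + 2) → A) :
    barCons hC n (bel hC n a) = bel hC (n + 1) (Fin.cons 1 a : Fin (n + 3) → A) :=
  congrArg (barRel C (n + 1)).mkQ (tCons_tprod _ a)

theorem barD_zero_bel (a : Fin 3 → A) : (barD hC 0).lin (bel hC 1 a) =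
    bel hC 0 ![a 0 * a 1, a 2] - bel hC 0 ![a 0, a 1 * a 2] := by
  have h : (barD hC 0).lin (bel hC 1 a) =
      bel hC 0 (Fin.contractNth (Fin.castSucc 0) (· * ·) a) -
        bel hC 0 (Fin.contractNth (Fin.castSucc 1) (· * ·) a) := by
    refine (congrArg (barRel C 0).mkQ (tD_tprod 2 a)).trans ?_
    rw [Fin.sum_univ_two, map_add, map_smul, map_smul, Fin.val_zero, Fin.val_one, pow_zero,
      pow_one, one_smul, neg_one_smul, ← sub_eq_add_neg]
    rfl
  rw [h]
  congr 2
  · ext l; fin_cases l <;> simp [Fin.contractNth]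
  · ext l; fin_cases l <;> simp [Fin.contractNth]

/-- At the bottom of the complex the homotopy identity has a defect: the tensor a₀a₁ ⊗ 1, which
factors through the multiplication A ⊗_C A → A. -/
theorem barD_barSnoc_zero (a : Fin 2 → A) : (barD hC 0).lin (barSnoc hC 0 (bel hC 0 a)) =
    bel hC 0 ![a 0 * a 1, 1] - bel hC 0 a := by
  rw [barSnoc_bel, barD_zero_bel]
  congr 2
  ext l; fin_cases l <;> simp [Fin.snoc]

/-- The mirror image of the previous identity. It is used to show that a cocycle of degree 0 in
hom_A(Bar(A,B,A),M) is determined by its value at 1 ⊗ 1. -/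
theorem barD_barCons_zero (a : Fin 2 → A) : (barD hC 0).lin (barCons hC 0 (bel hC 0 a)) =
    bel hC 0 a - bel hC 0 ![1, a 0 * a 1] := by
  rw [barCons_bel, barD_zero_bel]
  congr 2
  ext l; fin_cases l
  · simp
  · exact Fin.cons_succ (α := fun _ => A) 1 a 1

theorem barD_barSnoc (y : (bar hC (n + 1)).carrier) :
    (barD hC (n + 1)).lin (barSnoc hC (n + 1) y) =
      barSnoc hC n ((barD hC n).lin y) + (-1 : k) ^ n • y := by
  obtain ⟨y, rfl⟩ := Submodule.mkQ_surjective _ y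
  refine (congrArg (barRel C (n + 1)).mkQ (tD_tSnoc (n + 2) y)).trans ?_
  rw [pow_add, neg_one_sq, mul_one]
  exact map_add _ _ _

theorem barD_barCons (y : (bar hC (n + 1)).carrier) :
    (barD hC (n + 1)).lin (barCons hC (n + 1) y) = y - barCons hC n ((barD hC n).lin y) := by
  obtain ⟨y, rfl⟩ := Submodule.mkQ_surjective _ y
  refine (congrArg (barRel C (n + 1)).mkQ (tD_tCons (n + 2) y)).trans ?_
  exact map_sub _ _ _

theorem barSnoc_deg (d : ℤ) (y : (bar hC n).carrier) (hy : y ∈ (bar hC n).deg d) :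
    barSnoc hC n y ∈ (bar hC (n + 1)).deg d := by
  obtain ⟨t, ht, rfl⟩ := hy
  exact ⟨_, tSnoc_deg 𝒜 _ d ht, rfl⟩

theorem barCons_deg (d : ℤ) (y : (bar hC n).carrier) (hy : y ∈ (bar hC n).deg d) :
    barCons hC n y ∈ (bar hC (n + 1)).deg d := by
  obtain ⟨t, ht, rfl⟩ := hy
  exact ⟨_, tCons_deg 𝒜 _ d ht, rfl⟩

theorem barSnoc_lact (b : A) (y : (bar hC n).carrier) :
    barSnoc hC n ((bar hC n).lact b y) = (bar hC (n + 1)).lact b (barSnoc hC n y) := by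
  refine LinearMap.congr_fun (f := barSnoc hC n ∘ₗ (bar hC n).lact b)
    (g := (bar hC (n + 1)).lact b ∘ₗ barSnoc hC n) (bar_ext fun a => ?_) y
  simp only [LinearMap.comp_apply, lact_bel, barSnoc_bel]
  rw [Fin.snoc_update]
  rfl

theorem barCons_ract (b : A) (y : (bar hC n).carrier) :
    barCons hC n ((bar hC n).ract b y) = (bar hC (n + 1)).ract b (barCons hC n y) := by
  refine LinearMap.congr_fun (f := barCons hC n ∘ₗ (bar hC n).ract b)
    (g := (bar hC (n + 1)).ract b ∘ₗ barCons hC n) (bar_ext fun a => ?_) y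
  simp only [LinearMap.comp_apply, ract_bel, barCons_bel]
  rw [Fin.cons_update, Fin.succ_last]
  rfl

/-- The map `y ↦ y ⊗ 1` commutes with the right action of the subalgebra. -/
theorem barSnoc_ract (c : A) (hc : c ∈ C) (y : (bar hC n).carrier) :
    barSnoc hC n ((bar hC n).ract c y) = (bar hC (n + 1)).ract c (barSnoc hC n y) := by
  refine LinearMap.congr_fun (f := barSnoc hC n ∘ₗ (bar hC n).ract c)
    (g := (bar hC (n + 1)).ract c ∘ₗ barSnoc hC n) (bar_ext fun a => ?_) y
  simp only [LinearMap.comp_apply, ract_bel, barSnoc_bel]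
  -- The new last tensor sign is balanced over C, so c passes from the former last factor to the
  -- appended 1. This fails for general elements of A.
  have := bel_balanced hC (Fin.snoc a 1 : Fin (n + 3) → A) (Fin.last (n + 1)) hc
  rw [Fin.snoc_update]
  simpa using this

end BarElements

section BarGrading

/-! ### Graded linear maps and their generalized inverses. -/

section GradedMaps

variable {V W : Type u} [AddCommGroup V] [Module k V] [AddCommGroup W] [Module k W]

/-- A linear map of vector spaces has a generalized inverse. -/
theorem exists_generalized_inverse (d : V →ₗ[k] W) : ∃ h : W →ₗ[k] V, ∀ v, d (h (d v)) = d v := by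
  -- Choose a section of d over its range, then extend it arbitrarily to all of W.
  obtain ⟨g, hg⟩ := LinearMap.exists_rightInverse_of_surjective d.rangeRestrict
    d.range_rangeRestrict
  obtain ⟨h, hh⟩ := LinearMap.exists_extend g
  refine ⟨h, fun v => ?_⟩
  have h1 : h (d v) = g (d.rangeRestrict v) := LinearMap.congr_fun hh (d.rangeRestrict v)
  have h2 := LinearMap.congr_fun hg (d.rangeRestrict v)
  rw [h1]
  exact congrArg Subtype.val h2

/-- The linear map given by its restrictions to the homogeneous components. -/
noncomputable def ofComponents {𝒱 : ℤ → Submodule k V} (h𝒱 : IsInternal 𝒱)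
    (f : ∀ i, 𝒱 i →ₗ[k] W) : V →ₗ[k] W :=
  DirectSum.toModule k ℤ W f ∘ₗ (dec h𝒱).toLinearMap

theorem ofComponents_of_mem {𝒱 : ℤ → Submodule k V} (h𝒱 : IsInternal 𝒱) (f : ∀ i, 𝒱 i →ₗ[k] W)
    {i : ℤ} {x : V} (hx : x ∈ 𝒱 i) : ofComponents h𝒱 f x = f i ⟨x, hx⟩ := by
  simp [ofComponents, dec_of_mem h𝒱 hx]

/-- A degree preserving linear map has a degree preserving generalized inverse. -/
theorem exists_graded_generalized_inverse {𝒱 : ℤ → Submodule k V} {𝒲 : ℤ → Submodule k W}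
    (h𝒱 : IsInternal 𝒱) (h𝒲 : IsInternal 𝒲) (d : V →ₗ[k] W) (hd : ∀ i, ∀ x ∈ 𝒱 i, d x ∈ 𝒲 i) :
    ∃ h : W →ₗ[k] V, (∀ i, ∀ x ∈ 𝒲 i, h x ∈ 𝒱 i) ∧ ∀ v, d (h (d v)) = d v := by
  choose h hh using fun i => exists_generalized_inverse (d.restrict (hd i))
  have key : ∀ i, ∀ x (hx : x ∈ 𝒲 i),
      ofComponents h𝒲 (fun i => (𝒱 i).subtype ∘ₗ h i) x = h i ⟨x, hx⟩ :=
    fun i x hx => ofComponents_of_mem h𝒲 _ hx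
  refine ⟨ofComponents h𝒲 fun i => (𝒱 i).subtype ∘ₗ h i, fun i x hx => ?_, fun v => ?_⟩
  · rw [key i x hx]
    exact (h i ⟨x, hx⟩).2
  · refine sub_eq_zero.1 (top_le_of_homog h𝒱 (LinearMap.ker
      (d ∘ₗ ofComponents h𝒲 (fun i => (𝒱 i).subtype ∘ₗ h i) ∘ₗ d - d)) (fun i x hx => ?_) v)
    change d (ofComponents h𝒲 _ (d x)) - d x = 0
    rw [key i _ (hd i x hx), sub_eq_zero]
    exact congrArg Subtype.val (hh i ⟨x, hx⟩)

/-- If a bijective linear map preserves degrees, then so does its inverse. -/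
theorem symm_mem_of_graded {𝒱 : ℤ → Submodule k V} {𝒲 : ℤ → Submodule k W} (e : V ≃ₗ[k] W)
    (h𝒱 : ⨆ i, 𝒱 i = ⊤) (h𝒲 : IsInternal 𝒲) (he : ∀ i, ∀ x ∈ 𝒱 i, e x ∈ 𝒲 i) (i : ℤ) (w : W)
    (hw : w ∈ 𝒲 i) : e.symm w ∈ 𝒱 i := by
  -- The projection to degree i, conjugated by e, is the identity on the component of degree i and
  -- zero on all others, so its values lie in degree i.
  have key : (⨆ j, 𝒱 j) ≤ (𝒱 i).comap (e.symm.toLinearMap ∘ₗ proj h𝒲 i ∘ₗ e.toLinearMap) := by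
    refine iSup_le fun j x hx => ?_
    change e.symm (proj h𝒲 i (e x)) ∈ 𝒱 i
    by_cases hij : i = j
    · subst hij
      rwa [proj_same _ _ _ (he _ _ hx), e.symm_apply_apply]
    · rw [proj_ne _ _ _ hij _ (he _ _ hx), map_zero]
      exact zero_mem _
  have h1 := key (h𝒱 ▸ trivial : e.symm w ∈ ⨆ j, 𝒱 j)
  change e.symm (proj h𝒲 i (e (e.symm w))) ∈ 𝒱 i at h1
  rwa [e.apply_symm_apply, proj_same _ _ _ hw] at h1

end GradedMaps

variable {𝒜 : ℤ → Submodule k A}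

/-- The homogeneous maps spanning `homSpace` are A-linear, and A-linearity survives sums. -/
theorem homSpace_ract {Y : GrBimod 𝒜} {M : GrModR 𝒜} {f : Y.carrier →ₗ[k] M.carrier}
    (hf : f ∈ homSpace Y M) (a : A) (y : Y.carrier) : f (Y.ract a y) = M.act a (f y) := by
  have h : homSpace Y M ≤ LinearMap.ker (LinearMap.lcomp k M.carrier (Y.ract a) -
      LinearMap.llcomp k Y.carrier M.carrier M.carrier (M.act a)) :=
    iSup_le fun n g hg => LinearMap.ext fun y => sub_eq_zero.2 (hg.1 a y)
  exact sub_eq_zero.1 (LinearMap.congr_fun (h hf) y)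

theorem sumMod_deg_eq_bot {ι : Type} [DecidableEq ι] {F : ι → GrModR 𝒜} {K : ℤ}
    (hF : ∀ q i, K < i → (F q).deg i = ⊥) (i : ℤ) (hi : K < i) : (sumMod F).deg i = ⊥ := by
  rw [eq_bot_iff]
  intro x hx
  refine DFinsupp.ext fun q => ?_
  have := hx q
  rw [hF q i hi] at this
  exact this

variable [GradedAlgebra 𝒜]

theorem tmk_act {X : GrModR 𝒜} {Y : GrBimod 𝒜} (a : A) (x : X.carrier) (y : Y.carrier) :
    tmk X Y (X.act a x) y = tmk X Y x (Y.lact a y) :=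
  (Submodule.Quotient.eq (tensorRel X Y)).2 (Submodule.subset_span ⟨x, a, y, rfl⟩)

theorem act_tmk {X : GrModR 𝒜} {Y : GrBimod 𝒜} (a : A) (x : X.carrier) (y : Y.carrier) :
    (tensorMod X Y).act a (tmk X Y x y) = tmk X Y x (Y.ract a y) :=
  rfl

theorem tmk_mem_deg {X : GrModR 𝒜} {Y : GrBimod 𝒜} {i j : ℤ} {x : X.carrier} {y : Y.carrier}
    (hx : x ∈ X.deg i) (hy : y ∈ Y.deg j) : tmk X Y x y ∈ (tensorMod X Y).deg (i + j) :=
  ⟨_, tmul_mem_tensorDeg hx hy, rfl⟩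

theorem tensor_ext {X : GrModR 𝒜} {Y : GrBimod 𝒜} {V : Type*} [AddCommGroup V] [Module k V]
    {f g : (tensorMod X Y).carrier →ₗ[k] V} (h : ∀ x y, f (tmk X Y x y) = g (tmk X Y x y)) :
    f = g :=
  Submodule.linearMap_qext _ (TensorProduct.ext' h)

theorem mem_of_tmk {X : GrModR 𝒜} {Y : GrBimod 𝒜} (S : Submodule k (tensorMod X Y).carrier)
    (h : ∀ x y, tmk X Y x y ∈ S) (t : (tensorMod X Y).carrier) : t ∈ S := by
  have : S.mkQ = 0 := tensor_ext fun x y => (Submodule.Quotient.mk_eq_zero S).2 (h x y)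
  exact (Submodule.Quotient.mk_eq_zero S).1 (LinearMap.congr_fun this t)

theorem mem_of_tmk_deg {X : GrModR 𝒜} {Y : GrBimod 𝒜} {d : ℤ}
    (S : Submodule k (tensorMod X Y).carrier)
    (h : ∀ i j, i + j = d → ∀ x ∈ X.deg i, ∀ y ∈ Y.deg j, tmk X Y x y ∈ S)
    {t : (tensorMod X Y).carrier} (ht : t ∈ (tensorMod X Y).deg d) : t ∈ S := by
  obtain ⟨t, ht, rfl⟩ := ht
  have : tensorDeg X Y d ≤ S.comap (tensorRel X Y).mkQ := by
    refine Submodule.span_le.2 ?_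
    rintro _ ⟨i, j, hij, x, hx, y, hy, rfl⟩
    exact h i j hij x hx y hy
  exact this ht

/-- The linear map `X ⊗_A Y → V` given by a balanced bilinear map. -/
noncomputable def tensorLift {X : GrModR 𝒜} {Y : GrBimod 𝒜} {V : Type*} [AddCommGroup V]
    [Module k V] (f : X.carrier →ₗ[k] Y.carrier →ₗ[k] V)
    (hf : ∀ a x y, f (X.act a x) y = f x (Y.lact a y)) : (tensorMod X Y).carrier →ₗ[k] V :=
  (tensorRel X Y).liftQ (TensorProduct.lift f) <| by
    refine Submodule.span_le.2 ?_
    rintro _ ⟨x, a, y, rfl⟩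
    simp [hf]

theorem tensorLift_tmk {X : GrModR 𝒜} {Y : GrBimod 𝒜} {V : Type*} [AddCommGroup V]
    [Module k V] (f : X.carrier →ₗ[k] Y.carrier →ₗ[k] V) (hf) (x : X.carrier) (y : Y.carrier) :
    tensorLift f hf (tmk X Y x y) = f x y :=
  rfl

/-! ### Bounds on the gradings, from the triangular decomposition. -/

section Bounded

variable {N B : Subalgebra k A} (h : TriangularDecomposition 𝒜 N B)

theorem mem_of_mul_mem (h : TriangularDecomposition 𝒜 N B) (S : Submodule k A) (hS : ∀ n ∈ N, ∀ b ∈ B, n * b ∈ S) (a : A) : a ∈ S := by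
  obtain ⟨t, rfl⟩ := h.bijective_NB.2 a
  induction t with
  | zero => rw [map_zero]; exact zero_mem _
  | add x y hx hy => rw [map_add]; exact add_mem hx hy
  | tmul x y => exact hS _ x.2 _ y.2

/-- The bar complex relative to `B` is spanned by tensors whose factors, except the last one,
lie in `N`. -/
theorem bar_mem_of_left {p : ℕ} (S : Submodule k (bar h.homogeneous_B p).carrier)
    (hS : ∀ a : Fin (p + 2) → A, (∀ j, j ≠ Fin.last (p + 1) → a j ∈ N) →
      bel h.homogeneous_B p a ∈ S) (y : (bar h.homogeneous_B p).carrier) : y ∈ S := by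
  -- The factors at positions ≤ p - i are already in N. In the induction step the factor at position
  -- p - i is written as a sum of products nb, and b is moved across the tensor sign into its right
  -- neighbour. For i = p + 1 nothing is assumed.
  have key : ∀ (i : ℕ) (a : Fin (p + 2) → A), (∀ j : Fin (p + 2), j.val + i < p + 1 → a j ∈ N) →
      bel h.homogeneous_B p a ∈ S := by
    intro i
    induction i with
    | zero =>
      refine fun a ha => hS a fun j hj => ha j ?_
      exact lt_of_le_of_ne (Nat.le_of_lt_succ j.2) fun h => hj (Fin.ext h)
    | succ i ih =>
      intro a ha
      by_cases hi : p < i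
      · exact ih a fun j hj => by omega
      let s : Fin (p + 1) := ⟨p - i, by omega⟩
      have h1 := mem_of_mul_mem h
        (S.comap ((bel h.homogeneous_B p).toLinearMap a s.castSucc)) (fun n hn b hb => ?_)
        (a s.castSucc)
      · simpa using h1
      · change bel h.homogeneous_B p (Function.update a s.castSucc (n * b)) ∈ S
        have h2 := bel_balanced h.homogeneous_B (Function.update a s.castSucc n) s hb
        rw [Function.update_idem, Function.update_self] at h2
        rw [h2]
        refine ih _ fun j hj => ?_
        have hj1 : j ≠ s.succ := fun h => by
          have := congrArg Fin.val h
          simp only [s, Fin.val_succ] at this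
          omega
        rw [Function.update_of_ne hj1]
        by_cases hj2 : j = s.castSucc
        · rw [hj2, Function.update_self]
          exact hn
        · rw [Function.update_of_ne hj2]
          refine ha j ?_
          have : j.val ≠ p - i := fun h => hj2 (Fin.ext h)
          omega
  exact mem_of_bel S (fun a => key (p + 1) a fun j hj => by omega) y

/-- The tensor product of a module with the bar complex relative to `N` is spanned by tensors all
of whose factors from `A` lie in `B`. -/
theorem tensor_mem_of_right {n : ℕ} {X : GrModR 𝒜}
    (S : Submodule k (tensorMod X (bar h.homogeneous_N n)).carrier)
    (hS : ∀ x, ∀ a : Fin (n + 2) → A, (∀ j, a j ∈ B) →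
      tmk X _ x (bel h.homogeneous_N n a) ∈ S)
    (t : (tensorMod X (bar h.homogeneous_N n)).carrier) : t ∈ S := by
  -- Here the sweep goes from right to left: the factors from position i on are in B, and the part
  -- in N of the next factor to be treated is passed to the left. The element x must vary, because
  -- it absorbs the last such part.
  have key : ∀ (i : ℕ) (a : Fin (n + 2) → A), (∀ j : Fin (n + 2), i ≤ j.val → a j ∈ B) →
      ∀ x, tmk X _ x (bel h.homogeneous_N n a) ∈ S := by
    intro i
    induction i with
    | zero => exact fun a ha x => hS x a fun j => ha j j.val.zero_le
    | succ i ih =>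
      intro a ha x
      by_cases hi : n + 2 ≤ i
      · exact ih a (fun j hj => by omega) x
      let s : Fin (n + 2) := ⟨i, by omega⟩
      have h1 := mem_of_mul_mem h
        (S.comap (tmk X (bar h.homogeneous_N n) x ∘ₗ (bel h.homogeneous_N n).toLinearMap a s))
        (fun m hm b hb => ?_) (a s)
      · simpa using h1
      · change tmk X _ x (bel h.homogeneous_N n (Function.update a s (m * b))) ∈ S
        have hB : ∀ j : Fin (n + 2), i ≤ j.val → Function.update a s b j ∈ B := by
          intro j hj
          by_cases hj2 : j = s
          · rw [hj2, Function.update_self]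
            exact hb
          · rw [Function.update_of_ne hj2]
            have : j.val ≠ i := fun h => hj2 (Fin.ext h)
            exact ha j (by omega)
        -- For the leftmost factor, the part in N leaves the bar complex and acts on x. For any
        -- other factor it moves across a tensor sign over N.
        rcases i with _ | i
        · have h2 := lact_bel h.homogeneous_N m (Function.update a s b)
          change _ = bel _ _ (Function.update _ s (m * Function.update a s b s)) at h2
          rw [Function.update_idem, Function.update_self] at h2
          rw [← h2, ← tmk_act]
          exact ih _ hB _
        · let s' : Fin (n + 1) := ⟨i, by omega⟩
          have h2 := bel_balanced h.homogeneous_N (Function.update a s b) s' hm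
          change _ = bel _ _ (Function.update _ s (m * Function.update a s b s)) at h2
          rw [Function.update_idem, Function.update_self] at h2
          rw [← h2]
          refine ih _ (fun j hj => ?_) _
          have hj1 : j ≠ s'.castSucc := fun h => by
            have := congrArg Fin.val h
            simp only [s', Fin.val_castSucc] at this
            omega
          rw [Function.update_of_ne hj1]
          exact hB j hj
  exact mem_of_tmk S (fun x => mem_of_bel (S.comap (tmk X _ x)) fun a =>
    key (n + 2) a (fun j hj => absurd j.2 (by omega)) x) t

/-- By right A-linearity, f is determined on tensors n₀ ⊗ ⋯ ⊗ nₚ ⊗ 1 with factors in N. These have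
degree ≥ 0, so a map of degree i > K sends them to components of M of degree > K, which vanish. -/
theorem homMod_deg_eq_bot {M : GrModR 𝒜} {K : ℤ} (hM : ∀ i, K < i → M.deg i = ⊥) (p : ℕ) (i : ℤ)
    (hi : K < i) : (homMod (bar h.homogeneous_B p) M).deg i = ⊥ := by
  rw [eq_bot_iff]
  intro f hf
  refine Subtype.ext (LinearMap.ext fun y => ?_)
  refine bar_mem_of_left h (LinearMap.ker f.1) (fun a ha => ?_) y
  refine multilinear_mem 𝒜 (bel h.homogeneous_B p) (LinearMap.ker f.1)
    (fun j => if j = Fin.last (p + 1) then ⊤ else Subalgebra.toSubmodule N) (fun j => ?_)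
    (fun a e ha he => ?_) a (fun j => ?_)
  · split_ifs
    · exact isHomogeneous_top 𝒜
    · exact h.homogeneous_N
  -- A zero factor belongs to every homogeneous component, so its assigned degree e j could be
  -- negative; such tensors are zero and are set aside.
  · by_cases h0 : ∃ j, a j = 0
    · obtain ⟨j, hj⟩ := h0
      rw [(bel h.homogeneous_B p).map_coord_zero j hj]
      exact zero_mem _
    push Not at h0
    have hpos : ∀ j, j ≠ Fin.last (p + 1) → 0 ≤ e j := by
      intro j hj
      by_contra hlt
      have h1 : a j ∈ Subalgebra.toSubmodule N ⊓ 𝒜 (e j) := ⟨by simpa [hj] using ha j, he j⟩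
      rw [h.N_nonneg _ (not_le.1 hlt)] at h1
      exact h0 j h1
    have h2 := ract_bel h.homogeneous_B (a (Fin.last (p + 1)))
      (Function.update a (Fin.last (p + 1)) 1)
    rw [Function.update_idem, Function.update_self, one_mul, Function.update_eq_self] at h2
    have h3 : f.1 (bel h.homogeneous_B p (Function.update a (Fin.last (p + 1)) 1)) = 0 := by
      have h4 := hf.2 _ _ (bel_mem_deg h.homogeneous_B (n := p)
        (a := Function.update a (Fin.last (p + 1)) 1) (e := Function.update e (Fin.last (p + 1)) 0)
        fun j => by
          by_cases hj : j = Fin.last (p + 1)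
          · rw [hj, Function.update_self, Function.update_self]
            exact SetLike.one_mem_graded 𝒜
          · rw [Function.update_of_ne hj, Function.update_of_ne hj]
            exact he j)
      have h5 : 0 ≤ ∑ j, Function.update e (Fin.last (p + 1)) 0 j := Finset.sum_nonneg fun j _ => by
        by_cases hj : j = Fin.last (p + 1)
        · rw [hj, Function.update_self]
        · rw [Function.update_of_ne hj]
          exact hpos j hj
      rw [hM _ (by omega)] at h4
      exact h4
    change f.1 _ = 0
    rw [← h2, homSpace_ract f.2, h3, map_zero]
  · split_ifs with hj
    · trivial
    · exact ha j hj

/-- The module is spanned by elements x ⊗ b₀ ⊗ ⋯ ⊗ bₙ₊₁ with all factors in B. The factors in B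
contribute degrees ≤ 0, so these elements cannot have degree above the bound for X unless they
vanish. -/
theorem tensorMod_deg_eq_bot {X : GrModR 𝒜} {K : ℤ} (hX : ∀ i, K < i → X.deg i = ⊥) (n : ℕ)
    (i : ℤ) (hi : K < i) : (tensorMod X (bar h.homogeneous_N n)).deg i = ⊥ := by
  -- The spanning elements need not be homogeneous of degree i, so the vanishing is proved for the
  -- projection to degree i.
  have key : ∀ t, proj (tensorMod X (bar h.homogeneous_N n)).isInternal i t = 0 := by
    refine tensor_mem_of_right h (LinearMap.ker _) fun x a ha => ?_
    refine top_le_of_homog X.isInternal ((LinearMap.ker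
      (proj (tensorMod X (bar h.homogeneous_N n)).isInternal i)).comap
        ((tmk X _).flip (bel h.homogeneous_N n a))) (fun l x hx => ?_) x
    refine multilinear_mem 𝒜 ((tmk X _ x).compMultilinearMap (bel h.homogeneous_N n))
      (LinearMap.ker (proj (tensorMod X (bar h.homogeneous_N n)).isInternal i))
      (fun _ => Subalgebra.toSubmodule B) (fun _ => h.homogeneous_B) (fun a e ha he => ?_) a ha
    have h1 := tmk_mem_deg hx (bel_mem_deg h.homogeneous_N he)
    by_cases hd : i = l + ∑ j, e j
    · have h2 : tmk X (bar h.homogeneous_N n) x (bel h.homogeneous_N n a) = 0 := by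
        by_cases hl : K < l
        · rw [hX l hl] at hx
          rw [(Submodule.mem_bot k).1 hx, map_zero, LinearMap.zero_apply]
        -- If l ≤ K < i = l + ∑ e, then ∑ e > 0, so some factor from B has positive degree and is
        -- zero.
        · obtain ⟨j, -, hj⟩ := Finset.exists_lt_of_sum_lt (s := Finset.univ)
            (f := fun _ : Fin (n + 2) => (0 : ℤ)) (g := e) (by simp; omega)
          have h3 : a j ∈ Subalgebra.toSubmodule B ⊓ 𝒜 (e j) := ⟨ha j, he j⟩
          rw [h.B_nonpos _ hj] at h3
          rw [(bel h.homogeneous_N n).map_coord_zero j h3, map_zero]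
      change proj _ i (tmk X (bar h.homogeneous_N n) x (bel h.homogeneous_N n a)) = 0
      rw [h2, map_zero]
    · exact proj_ne _ i _ hd _ h1
  rw [eq_bot_iff]
  intro t ht
  rw [← proj_same (tensorMod X (bar h.homogeneous_N n)).isInternal i t ht, key]
  exact zero_mem _

end Bounded

end BarGrading

/-! ### Maps linear over a subalgebra, direct sums and null homotopies. -/

section HomModules

variable {𝒜 : ℤ → Submodule k A}

/-- An `N`-linear degree preserving map between `A`-modules. -/
def restrictHom (N : Subalgebra k A) {X Y : GrModR 𝒜} (f : X.carrier →ₗ[k] Y.carrier)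
    (hact : ∀ c ∈ N, ∀ x, f (X.act c x) = Y.act c (f x)) (hdeg : ∀ i, ∀ x ∈ X.deg i, f x ∈ Y.deg i) :
    (GrModR.restrict N).obj X ⟶ (GrModR.restrict N).obj Y :=
  ⟨f, fun c x => hact c c.2 x, hdeg⟩

/-- The linear map underlying an `N`-linear map between `A`-modules. -/
def restrictLin {N : Subalgebra k A} {X Y : GrModR 𝒜}
    (f : (GrModR.restrict N).obj X ⟶ (GrModR.restrict N).obj Y) : X.carrier →ₗ[k] Y.carrier :=
  f.lin

theorem restrictLin_act {N : Subalgebra k A} {X Y : GrModR 𝒜}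
    (f : (GrModR.restrict N).obj X ⟶ (GrModR.restrict N).obj Y) {c : A} (hc : c ∈ N)
    (x : X.carrier) : restrictLin f (X.act c x) = Y.act c (restrictLin f x) :=
  f.map_act ⟨c, hc⟩ x

theorem restrictLin_deg {N : Subalgebra k A} {X Y : GrModR 𝒜}
    (f : (GrModR.restrict N).obj X ⟶ (GrModR.restrict N).obj Y) {i : ℤ} {x : X.carrier}
    (hx : x ∈ X.deg i) : restrictLin f x ∈ Y.deg i :=
  f.map_deg i x hx

theorem restrict_hom_ext {N : Subalgebra k A} {X Y : GrModR 𝒜}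
    {f g : (GrModR.restrict N).obj X ⟶ (GrModR.restrict N).obj Y}
    (h : restrictLin f = restrictLin g) : f = g :=
  GrModR.hom_ext h

/-- The `N`-linear map from a direct sum of `A`-modules given by its components. -/
noncomputable def sumDescRestrict {N : Subalgebra k A} {ι : Type} [DecidableEq ι]
    {F : ι → GrModR 𝒜} {Z : GrModR 𝒜}
    (f : ∀ i, (GrModR.restrict N).obj (F i) ⟶ (GrModR.restrict N).obj Z) :
    (GrModR.restrict N).obj (sumMod F) ⟶ (GrModR.restrict N).obj Z :=
  restrictHom N (X := sumMod F) (DirectSum.toModule k ι Z.carrier fun i => restrictLin (f i))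
    (fun a ha x => by
      have : DirectSum.toModule k ι Z.carrier (fun i => restrictLin (f i)) ∘ₗ sumAct F a =
          Z.act a ∘ₗ DirectSum.toModule k ι Z.carrier (fun i => restrictLin (f i)) := by
        refine DirectSum.linearMap_ext k fun i => LinearMap.ext fun y => ?_
        simp only [LinearMap.comp_apply, sumAct_lof, DirectSum.toModule_lof,
          restrictLin_act (f i) ha]
      exact LinearMap.congr_fun this x)
    (fun n x hx => by
      classical
      have key : ∀ z : ⨁ i, (F i).carrier, (∀ i, z i ∈ (F i).deg n) →
          DirectSum.toModule k ι Z.carrier (fun i => restrictLin (f i)) z ∈ Z.deg n := by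
        intro z hz
        rw [← DirectSum.sum_support_of z, map_sum]
        refine sum_mem fun i _ => ?_
        have h := DirectSum.toModule_lof k (φ := fun i => restrictLin (f i)) i (z i)
        rw [DirectSum.lof_eq_of] at h
        rw [h]
        exact restrictLin_deg (f i) (hz i)
      exact key x hx)

theorem sumDescRestrict_incl {N : Subalgebra k A} {ι : Type} [DecidableEq ι]
    {F : ι → GrModR 𝒜} {Z : GrModR 𝒜}
    (f : ∀ i, (GrModR.restrict N).obj (F i) ⟶ (GrModR.restrict N).obj Z) (i : ι)
    (x : (F i).carrier) :
    restrictLin (sumDescRestrict f) ((sumIncl F i).lin x) = restrictLin (f i) x :=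
  DirectSum.toModule_lof k (φ := fun i => restrictLin (f i)) i x

theorem sumDesc_incl {ι : Type} [DecidableEq ι] {F : ι → GrModR 𝒜} {Z : GrModR 𝒜}
    (f : ∀ i, F i ⟶ Z) (i : ι) (x : (F i).carrier) :
    (sumDesc f).lin ((sumIncl F i).lin x) = (f i).lin x :=
  DirectSum.toModule_lof k (φ := fun i => (f i).lin) i x

theorem sum_ext {ι : Type} [DecidableEq ι] {F : ι → GrModR 𝒜} {V : Type*} [AddCommGroup V]
    [Module k V] {f g : (sumMod F).carrier →ₗ[k] V}
    (h : ∀ i x, f ((sumIncl F i).lin x) = g ((sumIncl F i).lin x)) : f = g :=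
  DirectSum.linearMap_ext k fun i => LinearMap.ext fun x => h i x

/-- A homotopy to zero given by its components. -/
noncomputable def homotopyZeroOf {C : Type*} [Category* C] [Preadditive C]
    {X Y : CochainComplex C ℤ} (f : X ⟶ Y) (s : ∀ i j, j + 1 = i → (X.X i ⟶ Y.X j))
    (hs : ∀ i j l (hij : i + 1 = j) (hjl : j + 1 = l),
      X.d j l ≫ s l j hjl + s j i hij ≫ Y.d i j = f.f j) : Homotopy f 0 :=
  (Homotopy.ofEq (HomologicalComplex.hom_ext _ _ fun j => by
    rw [Homotopy.nullHomotopicMap'_f (show (ComplexShape.up ℤ).Rel (j - 1) j by simp)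
      (show (ComplexShape.up ℤ).Rel j (j + 1) by simp)]
    exact (hs _ _ _ _ _).symm)).trans (Homotopy.nullHomotopy' fun i j h => s i j h)

variable [GradedAlgebra 𝒜]

/-! ### The augmentation of the bar complex, its unit and the map appending 1. -/

section Augmentation

variable {C : Subalgebra k A} (hC : SetLike.IsHomogeneous 𝒜 C)

/-- The multiplication map `A ⊗_C A → A`. -/
noncomputable def barAug : (bar hC 0).carrier →ₗ[k] A :=
  barLift hC (MultilinearMap.mkPiAlgebraFin k 2 A)
    (fun a s c _ => by
      fin_cases s
      simp [mul_assoc])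
    (fun a s h0 hl _ => by
      -- There are only two factors, the first and the last, hence no inner one.
      exfalso
      rcases Fin.exists_fin_two.1 ⟨s, rfl⟩ with h | h
      · exact h0 h
      · exact hl h)

theorem barAug_bel (a : Fin 2 → A) : barAug hC (bel hC 0 a) = a 0 * a 1 := by
  refine (barLift_bel hC _ _ _ a).trans ?_
  simp

theorem barAug_lact (b : A) (y : (bar hC 0).carrier) :
    barAug hC ((bar hC 0).lact b y) = b * barAug hC y := by
  refine LinearMap.congr_fun (f := barAug hC ∘ₗ (bar hC 0).lact b)
    (g := LinearMap.mulLeft k b ∘ₗ barAug hC) (bar_ext fun a => ?_) y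
  simp only [LinearMap.comp_apply, lact_bel, barAug_bel]
  simp [mul_assoc]

theorem barAug_ract (b : A) (y : (bar hC 0).carrier) :
    barAug hC ((bar hC 0).ract b y) = barAug hC y * b := by
  refine LinearMap.congr_fun (f := barAug hC ∘ₗ (bar hC 0).ract b)
    (g := LinearMap.mulRight k b ∘ₗ barAug hC) (bar_ext fun a => ?_) y
  simp only [LinearMap.comp_apply, ract_bel, barAug_bel]
  simp [mul_assoc]

theorem barAug_deg (d : ℤ) (y : (bar hC 0).carrier) (hy : y ∈ (bar hC 0).deg d) :
    barAug hC y ∈ 𝒜 d := by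
  refine mem_of_bel_deg ((𝒜 d).comap (barAug hC)) (fun a e h he => ?_) hy
  change barAug hC _ ∈ 𝒜 d
  rw [barAug_bel, ← he, Fin.sum_univ_two]
  exact SetLike.mul_mem_graded (h 0) (h 1)

theorem barAug_barD (y : (bar hC 1).carrier) : barAug hC ((barD hC 0).lin y) = 0 := by
  refine LinearMap.congr_fun (f := barAug hC ∘ₗ (barD hC 0).lin) (g := 0) (bar_ext fun a => ?_) y
  simp [barD_zero_bel, barAug_bel, mul_assoc]

theorem unit_mem_deg : bel hC 0 ![1, 1] ∈ (bar hC 0).deg 0 := by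
  have h := bel_mem_deg hC (a := ![1, 1]) (e := 0) fun i => by
    fin_cases i <;> exact SetLike.one_mem_graded 𝒜
  simpa using h

/-- The linear map `x ⊗ a ⊗ b ↦ x · ab`. -/
noncomputable def augLin (X : GrModR 𝒜) : (tensorMod X (bar hC 0)).carrier →ₗ[k] X.carrier :=
  tensorLift ((X.act ∘ₗ barAug hC).flip) fun a x y => by
    simp only [LinearMap.flip_apply, LinearMap.comp_apply, barAug_lact, X.act_mul]

theorem augLin_tmk (X : GrModR 𝒜) (x : X.carrier) (y : (bar hC 0).carrier) :
    augLin hC X (tmk X (bar hC 0) x y) = X.act (barAug hC y) x :=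
  rfl

/-- The action map `X ⊗_A Bar⁰(A, C, A) → X`. -/
noncomputable def augMap (X : GrModR 𝒜) : tensorMod X (bar hC 0) ⟶ X where
  lin := augLin hC X
  map_act a t := by
    refine LinearMap.congr_fun (f := augLin hC X ∘ₗ (tensorMod X (bar hC 0)).act a)
      (g := X.act a ∘ₗ augLin hC X) (tensor_ext fun x y => ?_) t
    simp only [LinearMap.comp_apply, act_tmk, augLin_tmk, barAug_ract, X.act_mul]
  map_deg d t ht := by
    refine mem_of_tmk_deg ((X.deg d).comap (augLin hC X)) (fun i j hij x hx y hy => ?_) ht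
    rw [← hij]
    exact X.act_mem i j x hx _ (barAug_deg hC j y hy)

theorem augMap_tmk (X : GrModR 𝒜) (x : X.carrier) (y : (bar hC 0).carrier) :
    (augMap hC X).lin (tmk X (bar hC 0) x y) = X.act (barAug hC y) x :=
  rfl

/-- The `C`-linear map `x ↦ x ⊗ 1 ⊗ 1`. -/
noncomputable def unitMap (X : GrModR 𝒜) : (GrModR.restrict C).obj X ⟶
    (GrModR.restrict C).obj (tensorMod X (bar hC 0)) :=
  restrictHom C ((tmk X (bar hC 0)).flip (bel hC 0 ![1, 1]))
    (fun c hc x => by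
      -- In A ⊗_C A one has c ⊗ 1 = 1 ⊗ c for c in C, which is why the unit is linear over C.
      have h := bel_balanced hC ![1, 1] 0 hc
      simp only [LinearMap.flip_apply]
      rw [tmk_act, act_tmk, lact_bel, ract_bel]
      congr 1
      simpa using h)
    (fun d x hx => by
      have := tmk_mem_deg hx (unit_mem_deg hC)
      rwa [add_zero] at this)

theorem unitMap_apply (X : GrModR 𝒜) (x : X.carrier) :
    restrictLin (unitMap hC X) x = tmk X (bar hC 0) x (bel hC 0 ![1, 1]) :=
  rfl

/-- The linear map `x ⊗ y ↦ x ⊗ (y ⊗ 1)`. -/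
noncomputable def snocLin (X : GrModR 𝒜) (n : ℕ) :
    (tensorMod X (bar hC n)).carrier →ₗ[k] (tensorMod X (bar hC (n + 1))).carrier :=
  tensorLift ((tmk X (bar hC (n + 1))).compl₂ (barSnoc hC n)) fun a x y => by
    simp only [LinearMap.compl₂_apply, tmk_act, barSnoc_lact]

theorem snocLin_tmk (X : GrModR 𝒜) (n : ℕ) (x : X.carrier) (y : (bar hC n).carrier) :
    snocLin hC X n (tmk X (bar hC n) x y) = tmk X (bar hC (n + 1)) x (barSnoc hC n y) :=
  rfl

/-- The `C`-linear map `x ⊗ y ↦ x ⊗ (y ⊗ 1)`. -/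
noncomputable def snocMap (X : GrModR 𝒜) (n : ℕ) :
    (GrModR.restrict C).obj (tensorMod X (bar hC n)) ⟶
      (GrModR.restrict C).obj (tensorMod X (bar hC (n + 1))) :=
  restrictHom C (snocLin hC X n)
    (fun c hc t => by
      refine LinearMap.congr_fun (f := snocLin hC X n ∘ₗ (tensorMod X (bar hC n)).act c)
        (g := (tensorMod X (bar hC (n + 1))).act c ∘ₗ snocLin hC X n)
        (tensor_ext fun x y => ?_) t
      simp only [LinearMap.comp_apply, act_tmk, snocLin_tmk, barSnoc_ract hC c hc])
    (fun d t ht => by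
      refine mem_of_tmk_deg (((tensorMod X (bar hC (n + 1))).deg d).comap (snocLin hC X n))
        (fun i j hij x hx y hy => ?_) ht
      rw [← hij]
      exact tmk_mem_deg hx (barSnoc_deg hC j y hy))

end Augmentation

end HomModules

section Homotopies

variable {𝒜 : ℤ → Submodule k A} [GradedAlgebra 𝒜]

/-! ### The contraction of X ⊗_A Bar(A,C,A) onto X. -/

section Homotopy

variable {C : Subalgebra k A} (hC : SetLike.IsHomogeneous 𝒜 C) (X : GrModR 𝒜)

theorem tensorMap_tmk {X X' : GrModR 𝒜} {Y Y' : GrBimod 𝒜} (f : X ⟶ X') (g : GrBimod.Hom Y Y')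
    (x : X.carrier) (y : Y.carrier) :
    (tensorMap f g).lin (tmk X Y x y) = tmk X' Y' (f.lin x) (g.lin y) :=
  rfl

theorem tensorMap_barD_snoc (n : ℕ) (t : (tensorMod X (bar hC (n + 1))).carrier) :
    (tensorMap (𝟙 X) (barD hC (n + 1))).lin (snocLin hC X (n + 1) t) =
      snocLin hC X n ((tensorMap (𝟙 X) (barD hC n)).lin t) + (-1 : ℤ) ^ n • t := by
  refine LinearMap.congr_fun
    (f := (tensorMap (𝟙 X) (barD hC (n + 1))).lin ∘ₗ snocLin hC X (n + 1))
    (g := snocLin hC X n ∘ₗ (tensorMap (𝟙 X) (barD hC n)).lin + (-1 : ℤ) ^ n • LinearMap.id)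
    (tensor_ext fun x y => ?_) t
  simp only [LinearMap.comp_apply, LinearMap.add_apply, snocLin_tmk, tensorMap_tmk,
    barD_barSnoc, map_add, GrModR.id_lin, LinearMap.id_apply, LinearMap.smul_apply]
  rcases n.even_or_odd with h | h <;> simp [h.neg_one_pow]

/-- The defect of the homotopy at the bottom is x ⊗ ab ⊗ 1. Over A the product ab can be moved into
x, which gives the unit applied to x·ab. -/
theorem tensorMap_barD_snoc_zero (t : (tensorMod X (bar hC 0)).carrier) :
    (tensorMap (𝟙 X) (barD hC 0)).lin (snocLin hC X 0 t) =
      restrictLin (unitMap hC X) ((augMap hC X).lin t) - t := by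
  refine LinearMap.congr_fun
    (f := (tensorMap (𝟙 X) (barD hC 0)).lin ∘ₗ snocLin hC X 0)
    (g := restrictLin (unitMap hC X) ∘ₗ (augMap hC X).lin - LinearMap.id)
    (tensor_ext fun x y => ?_) t
  -- The element ab ⊗ 1 is rewritten as the left action of ab on 1 ⊗ 1, so that it can cross the
  -- tensor sign over A.
  refine LinearMap.congr_fun
    (f := tmk X (bar hC 0) x ∘ₗ (barD hC 0).lin ∘ₗ barSnoc hC 0)
    (g := tmk X (bar hC 0) x ∘ₗ ((bar hC 0).lact.flip (bel hC 0 ![1, 1]) ∘ₗ barAug hC -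
      LinearMap.id)) (bar_ext fun a => ?_) y |>.trans ?_
  · simp only [LinearMap.comp_apply, LinearMap.sub_apply, LinearMap.flip_apply, barD_barSnoc_zero,
      barAug_bel, lact_bel, LinearMap.id_apply]
    congr 3
    ext l; fin_cases l <;> simp
  · simp only [LinearMap.comp_apply, LinearMap.sub_apply, LinearMap.flip_apply, map_sub,
      augMap_tmk, unitMap_apply, tmk_act, LinearMap.id_apply]

theorem augMap_naturality {X X' : GrModR 𝒜} (f : X ⟶ X') (t : (tensorMod X (bar hC 0)).carrier) :
    (augMap hC X').lin ((tensorMap f (GrBimod.Hom.id _)).lin t) = f.lin ((augMap hC X).lin t) := by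
  refine LinearMap.congr_fun
    (f := (augMap hC X').lin ∘ₗ (tensorMap f (GrBimod.Hom.id _)).lin)
    (g := f.lin ∘ₗ (augMap hC X).lin) (tensor_ext fun x y => ?_) t
  exact (f.map_act _ x).symm

theorem augMap_barD (t : (tensorMod X (bar hC 1)).carrier) :
    (augMap hC X).lin ((tensorMap (𝟙 X) (barD hC 0)).lin t) = 0 := by
  refine LinearMap.congr_fun
    (f := (augMap hC X).lin ∘ₗ (tensorMap (𝟙 X) (barD hC 0)).lin) (g := 0)
    (tensor_ext fun x y => ?_) t
  simp only [LinearMap.comp_apply, tensorMap_tmk, augMap_tmk, barAug_barD, map_zero,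
    LinearMap.zero_apply]

theorem augMap_unitMap (x : X.carrier) :
    (augMap hC X).lin (restrictLin (unitMap hC X) x) = x := by
  rw [unitMap_apply, augMap_tmk, barAug_bel]
  simp [X.act_one]

theorem snocLin_naturality {X X' : GrModR 𝒜} (f : X ⟶ X') (n : ℕ)
    (t : (tensorMod X (bar hC n)).carrier) :
    snocLin hC X' n ((tensorMap f (GrBimod.Hom.id _)).lin t) =
      (tensorMap f (GrBimod.Hom.id _)).lin (snocLin hC X n t) := by
  refine LinearMap.congr_fun
    (f := snocLin hC X' n ∘ₗ (tensorMap f (GrBimod.Hom.id _)).lin)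
    (g := (tensorMap f (GrBimod.Hom.id _)).lin ∘ₗ snocLin hC X n)
    (tensor_ext fun x y => rfl) t

end Homotopy

/-! ### The homotopy equivalence over N between S and hom_A(Bar(A,B,A),M). -/

section Comparison

variable {N B : Subalgebra k A} (hN : SetLike.IsHomogeneous 𝒜 N) (hB : SetLike.IsHomogeneous 𝒜 B)
  (M : GrModR 𝒜)

/-- The natural numbers `p` with `p = m`. -/
abbrev NatIdx (m : ℤ) : Type := {p : ℕ // (p : ℤ) = m}

/-- The term of degree `m` of the complex `hom_A(Bar(A, B, A), M)`. -/
noncomputable abbrev coX (m : ℤ) : GrModR 𝒜 :=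
  sumMod fun q : NatIdx m => homMod (bar hB q.1) M

/-- The differential of the complex `hom_A(Bar(A, B, A), M)`. -/
noncomputable def coD (m : ℤ) : coX hB M m ⟶ coX hB M (m + 1) :=
  sumDesc fun q : NatIdx m => homD hB M q.1 ≫
    sumIncl (fun q : NatIdx (m + 1) => homMod (bar hB q.1) M)
      ⟨q.1 + 1, by have := q.2; push_cast; omega⟩

theorem coD_coD (m : ℤ) : coD hB M m ≫ coD hB M (m + 1) = 0 := by
  refine sum_hom_ext ?_
  rintro ⟨p, h⟩
  rw [coD, ← Category.assoc, sumIncl_sumDesc, Category.assoc, coD, sumIncl_sumDesc,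
    ← Category.assoc, homD_homD, Limits.zero_comp, Limits.comp_zero]

/-- The complex `hom_A(Bar(A, B, A), M)` of graded right `A`-modules. -/
noncomputable def coBar : CochainComplex (GrModR 𝒜) ℤ :=
  CochainComplex.of (coX hB M) (coD hB M) (coD_coD hB M)

/-- The inclusion of `hom_A(Bar⁻ᵖ(A, B, A), M)` into `hom_A(Bar(A, B, A), M)`. -/
noncomputable def cel (m : ℤ) (p : ℕ) (h : (p : ℤ) = m) :
    homMod (bar hB p) M ⟶ (coBar hB M).X m :=
  sumIncl (fun q : NatIdx m => homMod (bar hB q.1) M) ⟨p, h⟩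

/-- The inclusion of a summand of the total complex. -/
noncomputable def tel (m : ℤ) (p n : ℕ) (h : (p : ℤ) - n = m) :
    term hN hB M p n ⟶ (semiBar hN hB M).X m :=
  sumIncl (fun q : TotIdx m => term hN hB M q.1.1 q.1.2) ⟨(p, n), h⟩

variable {hN hB M}

theorem coBar_ext {m : ℤ} {V : Type*} [AddCommGroup V] [Module k V]
    {f g : ((coBar hB M).X m).carrier →ₗ[k] V}
    (h : ∀ p hp x, f ((cel hB M m p hp).lin x) = g ((cel hB M m p hp).lin x)) : f = g :=
  sum_ext fun q x => h q.1 q.2 x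

theorem semiBar_ext {m : ℤ} {V : Type*} [AddCommGroup V] [Module k V]
    {f g : ((semiBar hN hB M).X m).carrier →ₗ[k] V}
    (h : ∀ p n hq x, f ((tel hN hB M m p n hq).lin x) = g ((tel hN hB M m p n hq).lin x)) :
    f = g :=
  sum_ext fun q x => h q.1.1 q.1.2 q.2 x

theorem coBar_d_eq (m : ℤ) : (coBar hB M).d m (m + 1) = coD hB M m :=
  CochainComplex.of_d _ _ _

theorem semiBar_d_eq (m : ℤ) : (semiBar hN hB M).d m (m + 1) = totD hN hB M m :=
  CochainComplex.of_d _ _ _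

theorem coBar_d {i j : ℤ} (hij : i + 1 = j) (p : ℕ) (h : (p : ℤ) = i)
    (x : (homMod (bar hB p) M).carrier) :
    ((coBar hB M).d i j).lin ((cel hB M i p h).lin x) =
      (cel hB M j (p + 1) (by push_cast; omega)).lin ((homD hB M p).lin x) := by
  subst hij
  rw [coBar_d_eq]
  exact sumDesc_incl (fun q : NatIdx i => homD hB M q.1 ≫
    sumIncl (fun q : NatIdx (i + 1) => homMod (bar hB q.1) M)
      ⟨q.1 + 1, by have := q.2; push_cast; omega⟩) ⟨p, h⟩ x

theorem semiBar_d {i : ℤ} (p n : ℕ) (h : (p : ℤ) - n = i) (x : (term hN hB M p n).carrier) :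
    ((semiBar hN hB M).d i (i + 1)).lin ((tel hN hB M i p n h).lin x) =
      (totD₁ hN hB M i p n h).lin x + (totD₂ hN hB M i p n h).lin x := by
  rw [semiBar_d_eq]
  exact sumDesc_incl (fun q : TotIdx i =>
    totD₁ hN hB M i q.1.1 q.1.2 q.2 + totD₂ hN hB M i q.1.1 q.1.2 q.2) ⟨(p, n), h⟩ x

theorem semiBar_d_zero {i j : ℤ} (hij : i + 1 = j) (p : ℕ) (h : (p : ℤ) - (0 : ℕ) = i)
    (x : (term hN hB M p 0).carrier) :
    ((semiBar hN hB M).d i j).lin ((tel hN hB M i p 0 h).lin x) =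
      (tel hN hB M j (p + 1) 0 (by push_cast at h ⊢; omega)).lin
        ((termD₁ hN hB M p 0).lin x) := by
  subst hij
  exact (semiBar_d p 0 h x).trans (add_zero _)

theorem semiBar_d_succ {i j : ℤ} (hij : i + 1 = j) (p n : ℕ) (h : (p : ℤ) - (n + 1 : ℕ) = i)
    (x : (term hN hB M p (n + 1)).carrier) :
    ((semiBar hN hB M).d i j).lin ((tel hN hB M i p (n + 1) h).lin x) =
      (tel hN hB M j (p + 1) (n + 1) (by push_cast at h ⊢; omega)).lin
        ((termD₁ hN hB M p (n + 1)).lin x) +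
      (tel hN hB M j p n (by push_cast at h ⊢; omega)).lin ((termD₂ hN hB M p n).lin x) := by
  subst hij
  exact semiBar_d p (n + 1) h x

variable (hN hB M)

/-- The components of the augmentation. -/
noncomputable def augPart (m : ℤ) : ∀ p n : ℕ, (p : ℤ) - n = m →
    (term hN hB M p n ⟶ (coBar hB M).X m)
  | p, 0, h => augMap hN _ ≫ cel hB M m p (by simpa using h)
  | _, _ + 1, _ => 0

/-- The augmentation in degree `m`. -/
noncomputable def augF (m : ℤ) : (semiBar hN hB M).X m ⟶ (coBar hB M).X m :=
  sumDesc fun q : TotIdx m => augPart hN hB M m q.1.1 q.1.2 q.2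

variable {hN hB M}

theorem augF_zero {m : ℤ} (p : ℕ) (h : (p : ℤ) - (0 : ℕ) = m) (x : (term hN hB M p 0).carrier) :
    (augF hN hB M m).lin ((tel hN hB M m p 0 h).lin x) =
      (cel hB M m p (by simpa using h)).lin ((augMap hN _).lin x) :=
  sumDesc_incl (fun q : TotIdx m => augPart hN hB M m q.1.1 q.1.2 q.2) ⟨(p, 0), h⟩ x

theorem augF_succ {m : ℤ} (p n : ℕ) (h : (p : ℤ) - (n + 1 : ℕ) = m)
    (x : (term hN hB M p (n + 1)).carrier) :
    (augF hN hB M m).lin ((tel hN hB M m p (n + 1) h).lin x) = 0 :=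
  sumDesc_incl (fun q : TotIdx m => augPart hN hB M m q.1.1 q.1.2 q.2) ⟨(p, n + 1), h⟩ x

/-- The augmentation sees only the terms with n = 0. There the claim is its naturality in the first
factor. For n = 1 the component landing in n = 0 is killed by associativity of the action, and for n
≥ 2 nothing reaches n = 0. -/
theorem augF_d (i j : ℤ) (hij : i + 1 = j) (x : ((semiBar hN hB M).X i).carrier) :
    ((coBar hB M).d i j).lin ((augF hN hB M i).lin x) =
      (augF hN hB M j).lin (((semiBar hN hB M).d i j).lin x) := by
  refine LinearMap.congr_fun (f := ((coBar hB M).d i j).lin ∘ₗ (augF hN hB M i).lin)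
    (g := (augF hN hB M j).lin ∘ₗ ((semiBar hN hB M).d i j).lin)
    (semiBar_ext fun p n h x => ?_) x
  simp only [LinearMap.comp_apply]
  rcases n with _ | _ | n
  · rw [augF_zero, semiBar_d_zero hij, augF_zero, coBar_d hij]
    congr 1
    exact (augMap_naturality hN _ x).symm
  · rw [augF_succ, semiBar_d_succ hij, map_add, augF_succ, augF_zero, map_zero, zero_add]
    simp only [termD₂, GrModR.zsmul_lin, LinearMap.smul_apply, map_zsmul, augMap_barD, map_zero,
      smul_zero]
  · rw [augF_succ, semiBar_d_succ hij, map_add, augF_succ, augF_succ, map_zero, zero_add]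

variable (hN hB M)

/-- The augmentation `hom_A(Bar(A, B, A), M) ⊗_A Bar(A, N, A) → hom_A(Bar(A, B, A), M)`. -/
noncomputable def aug : semiBar hN hB M ⟶ coBar hB M where
  f := augF hN hB M
  comm' i j hij := GrModR.hom_ext (LinearMap.ext fun x => augF_d i j hij x)

/-- The components of the unit `x ↦ x ⊗ 1 ⊗ 1`. -/
noncomputable def unitPart (m : ℤ) (p : ℕ) (h : (p : ℤ) = m) :
    (GrModR.restrict N).obj (homMod (bar hB p) M) ⟶
      (GrModR.restrict N).obj ((semiBar hN hB M).X m) :=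
  unitMap hN _ ≫ (GrModR.restrict N).map (tel hN hB M m p 0 (by simpa using h))

/-- The unit `x ↦ x ⊗ 1 ⊗ 1` in degree `m`. -/
noncomputable def unitF (m : ℤ) : (GrModR.restrict N).obj ((coBar hB M).X m) ⟶
    (GrModR.restrict N).obj ((semiBar hN hB M).X m) :=
  sumDescRestrict (Z := (semiBar hN hB M).X m) fun q : NatIdx m => unitPart hN hB M m q.1 q.2

/-- The components of the contracting homotopy `x ⊗ y ↦ ± x ⊗ (y ⊗ 1)`. -/
noncomputable def snocPart (i j : ℤ) (hij : j + 1 = i) (p n : ℕ) (h : (p : ℤ) - n = i) :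
    (GrModR.restrict N).obj (term hN hB M p n) ⟶
      (GrModR.restrict N).obj ((semiBar hN hB M).X j) :=
  -- The factor (-1)ᵖ cancels the sign of the differential in the second direction, and (-1)ⁿ⁺¹ the
  -- sign with which the identity appears when 1 is appended. Since the sign changes with p, the
  -- terms from the differential in the first direction cancel.
  ((-1 : ℤ) ^ (p + n + 1) • snocMap hN (homMod (bar hB p) M) n) ≫
    (GrModR.restrict N).map (tel hN hB M j p (n + 1) (by push_cast; omega))

/-- The contracting homotopy `x ⊗ y ↦ ± x ⊗ (y ⊗ 1)`. -/
noncomputable def snocF (i j : ℤ) (hij : j + 1 = i) :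
    (GrModR.restrict N).obj ((semiBar hN hB M).X i) ⟶
      (GrModR.restrict N).obj ((semiBar hN hB M).X j) :=
  sumDescRestrict (Z := (semiBar hN hB M).X j) fun q : TotIdx i =>
    snocPart hN hB M i j hij q.1.1 q.1.2 q.2

variable {hN hB M}

theorem unitF_cel {m : ℤ} (p : ℕ) (h : (p : ℤ) = m) (x : (homMod (bar hB p) M).carrier) :
    restrictLin (unitF hN hB M m) ((cel hB M m p h).lin x) =
      (tel hN hB M m p 0 (by simpa using h)).lin (restrictLin (unitMap hN _) x) :=
  sumDescRestrict_incl (Z := (semiBar hN hB M).X m)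
    (fun q : NatIdx m => unitPart hN hB M m q.1 q.2) ⟨p, h⟩ x

theorem snocPart_apply {i j : ℤ} (hij : j + 1 = i) (p n : ℕ) (h : (p : ℤ) - n = i)
    (x : (term hN hB M p n).carrier) :
    restrictLin (snocPart hN hB M i j hij p n h) x =
      (tel hN hB M j p (n + 1) (by push_cast; omega)).lin
        ((-1 : ℤ) ^ (p + n + 1) • snocLin hN (homMod (bar hB p) M) n x) :=
  rfl

theorem snocF_tel {i j : ℤ} (hij : j + 1 = i) (p n : ℕ) (h : (p : ℤ) - n = i)
    (x : (term hN hB M p n).carrier) :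
    restrictLin (snocF hN hB M i j hij) ((tel hN hB M i p n h).lin x) =
      (-1 : ℤ) ^ (p + n + 1) • (tel hN hB M j p (n + 1) (by push_cast; omega)).lin
        (snocLin hN _ n x) := by
  refine (sumDescRestrict_incl (Z := (semiBar hN hB M).X j) (fun q : TotIdx i =>
    snocPart hN hB M i j hij q.1.1 q.1.2 q.2) ⟨(p, n), h⟩ x).trans ?_
  rw [snocPart_apply, map_zsmul]

theorem augF_unitF (m : ℤ) (x : ((coBar hB M).X m).carrier) :
    (augF hN hB M m).lin (restrictLin (unitF hN hB M m) x) = x := by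
  refine LinearMap.congr_fun (f := (augF hN hB M m).lin ∘ₗ restrictLin (unitF hN hB M m))
    (g := LinearMap.id) (coBar_ext fun p h x => ?_) x
  rw [LinearMap.comp_apply, unitF_cel, augF_zero, augMap_unitMap]
  rfl

theorem termD₁_unitMap (p : ℕ) (x : (homMod (bar hB p) M).carrier) :
    (termD₁ hN hB M p 0).lin (restrictLin (unitMap hN _) x) =
      restrictLin (unitMap hN _) ((homD hB M p).lin x) := by
  rw [unitMap_apply, termD₁, tensorMap_tmk, unitMap_apply]
  rfl

theorem unitF_d (i j : ℤ) (hij : i + 1 = j) (x : ((coBar hB M).X i).carrier) :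
    ((semiBar hN hB M).d i j).lin (restrictLin (unitF hN hB M i) x) =
      restrictLin (unitF hN hB M j) (((coBar hB M).d i j).lin x) := by
  refine LinearMap.congr_fun (f := ((semiBar hN hB M).d i j).lin ∘ₗ restrictLin (unitF hN hB M i))
    (g := restrictLin (unitF hN hB M j) ∘ₗ ((coBar hB M).d i j).lin)
    (coBar_ext fun p h x => ?_) x
  simp only [LinearMap.comp_apply]
  rw [unitF_cel, semiBar_d_zero hij, coBar_d hij, unitF_cel, termD₁_unitMap]

/-- Appending 1 commutes with the differential of the first factor, whose two contributions
therefore cancel by the choice of signs. The differential of the second factor contributes the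
identity for n ≥ 1. For n = 0 it also contributes the defect, which is the unit composed with the
augmentation. -/
theorem snocF_homotopy (i j l : ℤ) (hij : i + 1 = j) (hjl : j + 1 = l)
    (x : ((semiBar hN hB M).X j).carrier) :
    restrictLin (snocF hN hB M l j hjl) (((semiBar hN hB M).d j l).lin x) +
      ((semiBar hN hB M).d i j).lin (restrictLin (snocF hN hB M j i hij) x) =
        x - restrictLin (unitF hN hB M j) ((augF hN hB M j).lin x) := by
  refine LinearMap.congr_fun
    (f := restrictLin (snocF hN hB M l j hjl) ∘ₗ ((semiBar hN hB M).d j l).lin +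
      ((semiBar hN hB M).d i j).lin ∘ₗ restrictLin (snocF hN hB M j i hij))
    (g := LinearMap.id - restrictLin (unitF hN hB M j) ∘ₗ (augF hN hB M j).lin)
    (semiBar_ext fun p n h x => ?_) x
  simp only [LinearMap.comp_apply, LinearMap.add_apply, LinearMap.sub_apply, LinearMap.id_apply]
  have hnat : ∀ n (x : (term hN hB M p n).carrier), (termD₁ hN hB M p (n + 1)).lin
      (snocLin hN _ n x) = snocLin hN _ n ((termD₁ hN hB M p n).lin x) :=
    fun n x => (snocLin_naturality hN (homD hB M p) n x).symm
  rcases n with _ | n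
  · have hD : (termD₂ hN hB M p 0).lin (snocLin hN _ 0 x) = (-1 : ℤ) ^ p •
        (restrictLin (unitMap hN _) ((augMap hN _).lin x) - x) :=
      congrArg ((-1 : ℤ) ^ p • ·) (tensorMap_barD_snoc_zero hN _ x)
    rw [semiBar_d_zero hjl, snocF_tel, snocF_tel, map_zsmul, semiBar_d_succ hij, hD, hnat,
      augF_zero, unitF_cel, map_zsmul, map_sub]
    rcases p.even_or_odd with hp | hp <;> simp [pow_add, hp.neg_one_pow]
  · have hD : (termD₂ hN hB M p (n + 1)).lin (snocLin hN _ (n + 1) x) = (-1 : ℤ) ^ p •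
        (snocLin hN _ n ((tensorMap (𝟙 _) (barD hN n)).lin x) + (-1 : ℤ) ^ n • x) :=
      congrArg ((-1 : ℤ) ^ p • ·) (tensorMap_barD_snoc hN _ n x)
    have hD' : (termD₂ hN hB M p n).lin x = (-1 : ℤ) ^ p •
      (tensorMap (𝟙 _) (barD hN n)).lin x := rfl
    rw [semiBar_d_succ hjl, map_add, snocF_tel, snocF_tel, snocF_tel, map_zsmul,
      semiBar_d_succ hij, hD, hD', hnat, augF_succ, map_zero, sub_zero]
    simp only [map_zsmul, map_add, smul_add, smul_smul]
    rcases p.even_or_odd with hp | hp <;> rcases n.even_or_odd with hn | hn <;>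
      simp [pow_add, hp.neg_one_pow, hn.neg_one_pow] <;> abel

end Comparison

end Homotopies

/-! ### Coextensions and K-injectivity of complexes bounded below. -/

section Injectives

variable {𝒜 : ℤ → Submodule k A}

section Injective

/-- Every degree preserving linear map to `J` can be turned into a morphism of modules, in a way
which is compatible with precomposition and which does not change the morphisms of modules. -/
def HasCoextension (J : GrModR 𝒜) : Prop :=
  ∃ L : ∀ Z : GrModR 𝒜, {g : Z.carrier →ₗ[k] J.carrier // ∀ i, ∀ x ∈ Z.deg i, g x ∈ J.deg i} →
      (Z ⟶ J),
    (∀ Z (f : Z ⟶ J), L Z ⟨f.lin, f.map_deg⟩ = f) ∧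
    ∀ Z Z' (u : Z ⟶ Z') g,
      u ≫ L Z' g = L Z ⟨g.1 ∘ₗ u.lin, fun i x hx => g.2 i _ (u.map_deg i x hx)⟩

theorem HasCoextension.of_retract {J J' : GrModR 𝒜} (hJ : HasCoextension J) (a : J ⟶ J')
    (b : J' ⟶ J) (hab : b ≫ a = 𝟙 J') : HasCoextension J' := by
  obtain ⟨L, h1, h2⟩ := hJ
  refine ⟨fun Z g => L Z ⟨b.lin ∘ₗ g.1, fun i x hx => b.map_deg i _ (g.2 i x hx)⟩ ≫ a,
    fun Z f => ?_, fun Z Z' u g => ?_⟩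
  · change L Z ⟨GrModR.Hom.lin (f ≫ b), _⟩ ≫ a = f
    rw [h1, Category.assoc, hab, Category.comp_id]
  · rw [← Category.assoc, h2]
    rfl

theorem hasCoextension_of_subsingleton {J : GrModR 𝒜} (hJ : Subsingleton J.carrier) :
    HasCoextension J :=
  ⟨fun _ _ => 0, fun _ _ => GrModR.hom_ext (LinearMap.ext fun _ => Subsingleton.elim _ _),
    fun _ _ _ _ => GrModR.hom_ext (LinearMap.ext fun _ => Subsingleton.elim _ _)⟩

/-- The projection of a direct sum to a summand. -/
noncomputable def sumProj {ι : Type} [DecidableEq ι] (F : ι → GrModR 𝒜) (i : ι) :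
    sumMod F ⟶ F i where
  lin := DirectSum.component k ι (fun i => (F i).carrier) i
  map_act _ _ := rfl
  map_deg _ _ hx := hx i

theorem sumIncl_sumProj {ι : Type} [DecidableEq ι] (F : ι → GrModR 𝒜) (i : ι) :
    sumIncl F i ≫ sumProj F i = 𝟙 (F i) :=
  GrModR.hom_ext (LinearMap.ext fun x =>
    DirectSum.component.lof_self k (M := fun i => (F i).carrier) i x)

theorem sumProj_sumIncl {ι : Type} [DecidableEq ι] [Subsingleton ι] (F : ι → GrModR 𝒜) (i : ι) :
    sumProj F i ≫ sumIncl F i = 𝟙 (sumMod F) := by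
  refine sum_hom_ext fun j => ?_
  obtain rfl := Subsingleton.elim i j
  rw [← Category.assoc, sumIncl_sumProj, Category.id_comp, Category.comp_id]

/-- A sum over an index type with at most one element is either zero or isomorphic to its only
summand. -/
theorem hasCoextension_sumMod {N : Subalgebra k A} {ι : Type} [DecidableEq ι] [Subsingleton ι]
    {F : ι → GrModR 𝒜} (hF : ∀ i, HasCoextension ((GrModR.restrict N).obj (F i))) :
    HasCoextension ((GrModR.restrict N).obj (sumMod F)) := by
  by_cases h : Nonempty ι
  · obtain ⟨i⟩ := h
    refine (hF i).of_retract ((GrModR.restrict N).map (sumIncl F i))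
      ((GrModR.restrict N).map (sumProj F i)) ?_
    rw [← Functor.map_comp, sumProj_sumIncl, CategoryTheory.Functor.map_id]
  · exact hasCoextension_of_subsingleton
      ⟨fun x y => DFinsupp.ext (β := fun i => (F i).carrier) fun i => absurd ⟨i⟩ h⟩

/-- A complex in nonnegative degrees whose terms have coextensions is K-injective. -/
theorem isKInj_of_hasCoextension (J : CochainComplex (GrModR 𝒜) ℤ)
    (hJ : ∀ m, HasCoextension (J.X m)) (h0 : ∀ m < 0, Subsingleton (J.X m).carrier) :
    IsKInj J := by
  intro X _ hX f
  choose L hL1 hL2 using hJ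
  -- The map h i j : Xʲ → Xⁱ is a graded linear generalized inverse of the differential Xⁱ → Xʲ; it
  -- need not be linear over the algebra.
  choose h hdeg hh using fun i j => exists_graded_generalized_inverse (X.X i).isInternal
    (X.X j).isInternal (X.d i j).lin (X.d i j).map_deg
  -- The homotopy into Jʲ is the coextension of (f - s d) ∘ h, where s is the homotopy one degree
  -- lower. The natural number is the recursion depth, equal to j + 1 in use, so the homotopy is
  -- zero in negative degrees. Keeping source and target indices independent avoids transport along
  -- equalities of degrees.
  let t : ℕ → ∀ i j, X.X i ⟶ J.X j := fun n => Nat.rec (fun _ _ => 0) (fun _ t i j =>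
    L j (X.X i) ⟨GrModR.Hom.lin (f.f j - t j (j - 1) ≫ J.d (j - 1) j) ∘ₗ h j i, fun l x hx =>
      (f.f j - t j (j - 1) ≫ J.d (j - 1) j).map_deg l _ (hdeg j i l x hx)⟩) n
  let s : ∀ i j, X.X i ⟶ J.X j := fun i j => t (j + 1).toNat i j
  have hs : ∀ i j l : ℤ, i + 1 = j → 0 ≤ j → ∃ h', s l j =
      L j (X.X l) ⟨GrModR.Hom.lin (f.f j - s j i ≫ J.d i j) ∘ₗ h j l, h'⟩ := by
    rintro i j l hij hj
    obtain ⟨n, rfl⟩ := Int.eq_ofNat_of_zero_le hj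
    obtain rfl : i = (n : ℤ) - 1 := by omega
    have e1 : ((n : ℤ) + 1).toNat = n + 1 := by omega
    have e2 : ((n : ℤ) - 1 + 1).toNat = n := by omega
    simp only [s, e1, e2]
    exact ⟨fun m x hx => (f.f n - t n n (n - 1) ≫ J.d (n - 1) n).map_deg m _ (hdeg n l m x hx),
      rfl⟩
  have key : ∀ n : ℕ, ∀ i j l : ℤ, i + 1 = j → j + 1 = l → j < n →
      X.d j l ≫ s l j + s j i ≫ J.d i j = f.f j := by
    intro n
    induction n with
    | zero =>
      intro i j l _ _ hj
      have := h0 j (by simpa using hj)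
      exact GrModR.hom_ext (LinearMap.ext fun _ => Subsingleton.elim _ _)
    | succ n ih =>
      intro i j l hij hjl hjn
      by_cases hj : 0 ≤ j
      · rw [← eq_sub_iff_add_eq]
        -- By the identity one degree lower, f - s d vanishes on coboundaries.
        have hg : X.d i j ≫ (f.f j - s j i ≫ J.d i j) = 0 := by
          have := ih (i - 1) i j (by omega) hij (by push_cast at hjn; omega)
          rw [Preadditive.comp_sub, ← Category.assoc, eq_sub_of_add_eq this, Preadditive.sub_comp,
            Category.assoc, J.d_comp_d, Limits.comp_zero, sub_zero, f.comm, sub_self]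
        obtain ⟨h', e⟩ := hs i j l hij hj
        -- By naturality, composing with the differential turns the coextension of (f - s d) ∘ h
        -- into that of (f - s d) ∘ h ∘ d. If this linear map equals f - s d, which is a morphism,
        -- then coextension leaves it unchanged.
        rw [e, hL2]
        refine Eq.trans ?_ (hL1 j _ _)
        congr 2
        refine LinearMap.ext fun z => sub_eq_zero.1 ?_
        obtain rfl : l = j + 1 := hjl.symm
        obtain rfl : i = j - 1 := by omega
        -- As d h d = d, the element h d z - z is a cocycle. Acyclicity makes it a coboundary, so f
        -- - s d kills it.
        obtain ⟨w, hw⟩ := hX j (h j (j + 1) ((X.d j (j + 1)).lin z) - z) (by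
          change (X.d j (j + 1)).lin _ = 0
          rw [map_sub, hh, sub_self])
        simp only [LinearMap.comp_apply]
        rw [← map_sub, ← hw]
        exact LinearMap.congr_fun (congrArg GrModR.Hom.lin hg) w
      · have := h0 j (not_le.1 hj)
        exact GrModR.hom_ext (LinearMap.ext fun _ => Subsingleton.elim _ _)
  exact ⟨homotopyZeroOf f (fun i j _ => s i j) fun i j l hij hjl =>
    key (j + 1).toNat i j l hij hjl (by omega)⟩

end Injective

end Injectives

section Coextensions

variable {𝒜 : ℤ → Submodule k A} [GradedAlgebra 𝒜] {N B : Subalgebra k A}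

/-! ### The N-linear splitting of Bar(A,B,A) given by A = N ⊗ B. -/

section Splitting

/-- The multiplication `N ⊗ B → A` as a linear equivalence. -/
noncomputable def mulEquiv (h : TriangularDecomposition 𝒜 N B) :
    Subalgebra.toSubmodule N ⊗[k] Subalgebra.toSubmodule B ≃ₗ[k] A :=
  LinearEquiv.ofBijective _ h.bijective_NB

variable (h : TriangularDecomposition 𝒜 N B)

theorem mulEquiv_tmul (n : Subalgebra.toSubmodule N) (b : Subalgebra.toSubmodule B) :
    mulEquiv h (n ⊗ₜ b) = n.1 * b.1 :=
  rfl

/-- Right multiplication by an element of a subalgebra. -/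
noncomputable def mulRightOn (C : Subalgebra k A) {c : A} (hc : c ∈ C) :
    Subalgebra.toSubmodule C →ₗ[k] Subalgebra.toSubmodule C :=
  (LinearMap.mulRight k c).restrict fun _ hx => C.mul_mem hx hc

/-- Left multiplication by an element of a subalgebra. -/
noncomputable def mulLeftOn (C : Subalgebra k A) {c : A} (hc : c ∈ C) :
    Subalgebra.toSubmodule C →ₗ[k] Subalgebra.toSubmodule C :=
  (LinearMap.mulLeft k c).restrict fun _ hx => C.mul_mem hc hx

/-- Multiplication N ⊗ B → A commutes with right multiplication by B, hence so does its inverse.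
This makes `barSplit` compatible with balancing at the first tensor sign. -/
theorem mulEquiv_symm_mul_right (a : A) {c : A} (hc : c ∈ B) :
    (mulEquiv h).symm (a * c) = (mulRightOn B hc).lTensor _ ((mulEquiv h).symm a) := by
  rw [LinearEquiv.symm_apply_eq]
  obtain ⟨t, rfl⟩ := (mulEquiv h).surjective a
  rw [LinearEquiv.symm_apply_apply]
  induction t with
  | zero => simp
  | add x y hx hy => simp only [map_add, add_mul, hx, hy]
  | tmul x y =>
    rw [LinearMap.lTensor_tmul, mulEquiv_tmul, mulEquiv_tmul, mul_assoc]
    rfl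

/-- The counterpart on the left, from which `barSplit` inherits its N-linearity. -/
theorem mulEquiv_symm_mul_left (a : A) {c : A} (hc : c ∈ N) :
    (mulEquiv h).symm (c * a) = (mulLeftOn N hc).rTensor _ ((mulEquiv h).symm a) := by
  rw [LinearEquiv.symm_apply_eq]
  obtain ⟨t, rfl⟩ := (mulEquiv h).surjective a
  rw [LinearEquiv.symm_apply_apply]
  induction t with
  | zero => simp
  | add x y hx hy => simp only [map_add, mul_add, hx, hy]
  | tmul x y =>
    rw [LinearMap.rTensor_tmul, mulEquiv_tmul, mulEquiv_tmul, ← mul_assoc]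
    rfl

/-- To check a property of the elements of a graded subalgebra, it is enough to consider
homogeneous elements. -/
theorem subalgebra_mem_of_homog {C : Subalgebra k A} (hC : SetLike.IsHomogeneous 𝒜 C)
    (S : Submodule k (Subalgebra.toSubmodule C))
    (hS : ∀ i, ∀ c : Subalgebra.toSubmodule C, c.1 ∈ 𝒜 i → c ∈ S)
    (c : Subalgebra.toSubmodule C) : c ∈ S := by
  classical
  have : c = ∑ j ∈ (decompose 𝒜 c.1).support,
      (⟨(decompose 𝒜 c.1 j : A), hC j c.2⟩ : Subalgebra.toSubmodule C) := by
    refine Subtype.ext ?_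
    rw [AddSubmonoidClass.coe_finsetSum]
    exact (DirectSum.sum_support_decompose 𝒜 c.1).symm
  rw [this]
  exact sum_mem fun j _ => hS j _ (SetLike.coe_mem _)

variable (𝒜 N B) in
/-- The homogeneous components of `N ⊗ B`. -/
def mulDeg (d : ℤ) : Submodule k (Subalgebra.toSubmodule N ⊗[k] Subalgebra.toSubmodule B) :=
  Submodule.span k {t | ∃ i j, i + j = d ∧ ∃ n b, n.1 ∈ 𝒜 i ∧ b.1 ∈ 𝒜 j ∧ t = n ⊗ₜ[k] b}

/-- Homogeneity of N and B makes the graded pieces of N ⊗ B span it. Multiplication preserves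
degrees, and so does the inverse of a degree preserving bijection. -/
theorem mulEquiv_symm_mem (d : ℤ) (a : A) (ha : a ∈ 𝒜 d) :
    (mulEquiv h).symm a ∈ mulDeg 𝒜 N B d := by
  refine symm_mem_of_graded (V := Subalgebra.toSubmodule N ⊗[k] Subalgebra.toSubmodule B)
    (mulEquiv h) ?_ (Decomposition.isInternal 𝒜) (fun i x hx => ?_) d a ha
  · rw [eq_top_iff, ← TensorProduct.span_tmul_eq_top, Submodule.span_le]
    rintro _ ⟨n, b, rfl⟩
    refine subalgebra_mem_of_homog h.homogeneous_N
      ((⨆ d, mulDeg 𝒜 N B d).comap ((TensorProduct.mk k _ _).flip b)) (fun i n hn => ?_) n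
    refine subalgebra_mem_of_homog h.homogeneous_B
      ((⨆ d, mulDeg 𝒜 N B d).comap (TensorProduct.mk k _ _ n)) (fun j b hb => ?_) b
    exact Submodule.mem_iSup_of_mem (i + j)
      (Submodule.subset_span ⟨i, j, rfl, n, b, hn, hb, rfl⟩)
  · have : mulDeg 𝒜 N B i ≤ (𝒜 i).comap (mulEquiv h).toLinearMap := by
      refine Submodule.span_le.2 ?_
      rintro _ ⟨i, j, rfl, n, b, hn, hb, rfl⟩
      exact SetLike.mul_mem_graded hn hb
    exact this hx

variable {C : Subalgebra k A} (hC : SetLike.IsHomogeneous 𝒜 C) {p : ℕ}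

/-- The map `c ↦ c ⊗ a₁ ⊗ ⋯ ⊗ aₚ₊₁`. -/
noncomputable def headLin (a : Fin (p + 2) → A) :
    Subalgebra.toSubmodule C →ₗ[k] (bar hC p).carrier :=
  (bel hC p).toLinearMap a 0 ∘ₗ (Subalgebra.toSubmodule C).subtype

theorem headLin_apply (a : Fin (p + 2) → A) (c : Subalgebra.toSubmodule C) :
    headLin hC a c = bel hC p (Function.update a 0 c.1) :=
  rfl

theorem headLin_update_zero (a : Fin (p + 2) → A) (x : A) :
    headLin hC (Function.update a 0 x) = headLin hC a :=
  LinearMap.ext fun c => by simp only [headLin_apply, Function.update_idem]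

theorem headLin_update_add (a : Fin (p + 2) → A) {i : Fin (p + 2)} (hi : i ≠ 0) (x y : A) :
    headLin hC (Function.update a i (x + y)) =
      headLin hC (Function.update a i x) + headLin hC (Function.update a i y) :=
  LinearMap.ext fun c => by
    simp only [headLin_apply, LinearMap.add_apply, Function.update_comm hi,
      MultilinearMap.map_update_add]

theorem headLin_update_smul (a : Fin (p + 2) → A) {i : Fin (p + 2)} (hi : i ≠ 0) (c : k) (x : A) :
    headLin hC (Function.update a i (c • x)) = c • headLin hC (Function.update a i x) :=
  LinearMap.ext fun c => by
    simp only [headLin_apply, LinearMap.smul_apply, Function.update_comm hi,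
      MultilinearMap.map_update_smul]

theorem headLin_mulRightOn (a : Fin (p + 2) → A) {c : A} (hc : c ∈ C) :
    headLin hC a ∘ₗ mulRightOn C hc =
      headLin hC (Function.update a (Fin.succ 0) (c * a (Fin.succ 0))) := by
  refine LinearMap.ext fun b => ?_
  have h1 := bel_balanced hC (Function.update a 0 b.1) 0 hc
  rw [Fin.castSucc_zero, Function.update_idem, Function.update_self,
    Function.update_of_ne (Fin.succ_ne_zero 0)] at h1
  refine h1.trans ?_
  rw [headLin_apply, Function.update_comm (Fin.succ_ne_zero 0)]

theorem headLin_balanced (a : Fin (p + 2) → A) (s : Fin (p + 1)) (hs : s.castSucc ≠ 0) {c : A}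
    (hc : c ∈ C) : headLin hC (Function.update a s.castSucc (a s.castSucc * c)) =
      headLin hC (Function.update a s.succ (c * a s.succ)) := by
  refine LinearMap.ext fun b => ?_
  have h1 := bel_balanced hC (Function.update a 0 b.1) s hc
  rw [Function.update_of_ne hs, Function.update_of_ne (Fin.succ_ne_zero s)] at h1
  rw [headLin_apply, headLin_apply, Function.update_comm hs,
    Function.update_comm (Fin.succ_ne_zero s)]
  exact h1

theorem headLin_degenerate (a : Fin (p + 2) → A) (s : Fin (p + 2)) (h0 : s ≠ 0)
    (hl : s ≠ Fin.last (p + 1)) (hs : a s ∈ C) : headLin hC a = 0 :=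
  LinearMap.ext fun b => bel_degenerate hC _ s h0 hl (by rwa [Function.update_of_ne h0])

theorem headLin_ract (a : Fin (p + 2) → A) (c : A) :
    headLin hC (Function.update a (Fin.last (p + 1)) (a (Fin.last (p + 1)) * c)) =
      (bar hC p).ract c ∘ₗ headLin hC a := by
  have hl : Fin.last (p + 1) ≠ 0 := by simp [Fin.ext_iff]
  refine LinearMap.ext fun b => ?_
  rw [LinearMap.comp_apply, headLin_apply, headLin_apply, ract_bel, Function.update_comm hl,
    Function.update_of_ne hl]

theorem headLin_deg {a : Fin (p + 2) → A} {e : Fin (p + 2) → ℤ} (he : ∀ i, a i ∈ 𝒜 (e i))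
    {m : ℤ} (c : Subalgebra.toSubmodule C) (hc : c.1 ∈ 𝒜 m) :
    headLin hC a c ∈ (bar hC p).deg (∑ i, e i + (m - e 0)) :=
  ⟨_, update_homog he 0 c.1 (m - e 0) (by rwa [add_sub_cancel]), rfl⟩

variable (p) in
/-- The left `N`-linear splitting `a₀ ⊗ ⋯ ⊗ aₚ₊₁ ↦ ∑ nᵢ ⊗ (bᵢ ⊗ a₁ ⊗ ⋯ ⊗ aₚ₊₁)` of the action of `N`,
where `a₀ = ∑ nᵢ bᵢ`. -/
noncomputable def barSplit : (bar h.homogeneous_B p).carrier →ₗ[k]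
    Subalgebra.toSubmodule N ⊗[k] (bar h.homogeneous_B p).carrier :=
  barLift h.homogeneous_B
    { toFun := fun a => (headLin h.homogeneous_B a).lTensor _ ((mulEquiv h).symm (a 0))
      map_update_add' := @fun inst a i x y => by
        obtain rfl : inst = instDecidableEqFin _ := Subsingleton.elim _ _
        by_cases hi : i = 0
        · subst hi
          simp only [headLin_update_zero, Function.update_self, map_add]
        · simp only [headLin_update_add _ _ hi, Function.update_of_ne (Ne.symm hi),
            LinearMap.lTensor_add, LinearMap.add_apply]
      map_update_smul' := @fun inst a i c x => by
        obtain rfl : inst = instDecidableEqFin _ := Subsingleton.elim _ _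
        by_cases hi : i = 0
        · subst hi
          simp only [headLin_update_zero, Function.update_self, map_smul]
        · simp only [headLin_update_smul _ _ hi, Function.update_of_ne (Ne.symm hi),
            LinearMap.lTensor_smul, LinearMap.smul_apply] }
    (fun a s c hc => by
      simp only [MultilinearMap.coe_mk]
      -- At the first tensor sign, a₀c decomposes as ∑ nᵢ ⊗ bᵢc, and c in B then moves on into a₁.
      -- The other tensor signs do not involve a₀.
      by_cases hs : s.castSucc = 0
      · obtain rfl : s = 0 := Fin.castSucc_injective _ hs
        rw [Fin.castSucc_zero, Function.update_self, Function.update_of_ne (Fin.succ_ne_zero 0).symm,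
          headLin_update_zero, mulEquiv_symm_mul_right h _ hc, ← LinearMap.comp_apply,
          ← LinearMap.lTensor_comp, headLin_mulRightOn]
      · rw [headLin_balanced _ _ _ hs hc, Function.update_of_ne (Ne.symm hs),
          Function.update_of_ne (Fin.succ_ne_zero s).symm])
    (fun a s h0 hl hs => by
      simp only [MultilinearMap.coe_mk]
      rw [headLin_degenerate _ a s h0 hl hs, LinearMap.lTensor_zero, LinearMap.zero_apply])

theorem barSplit_bel (a : Fin (p + 2) → A) : barSplit h p (bel h.homogeneous_B p a) =
    (headLin h.homogeneous_B a).lTensor _ ((mulEquiv h).symm (a 0)) :=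
  barLift_bel _ _ _ _ a

theorem barSplit_ract (c : A) (y : (bar h.homogeneous_B p).carrier) :
    barSplit h p ((bar h.homogeneous_B p).ract c y) =
      ((bar h.homogeneous_B p).ract c).lTensor _ (barSplit h p y) := by
  refine LinearMap.congr_fun (f := barSplit h p ∘ₗ (bar h.homogeneous_B p).ract c)
    (g := ((bar h.homogeneous_B p).ract c).lTensor _ ∘ₗ barSplit h p)
    (bar_ext (V := Subalgebra.toSubmodule N ⊗[k] (bar h.homogeneous_B p).carrier) fun a => ?_) y
  have hl : (0 : Fin (p + 2)) ≠ Fin.last (p + 1) := by simp [Fin.ext_iff]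
  simp only [LinearMap.comp_apply, ract_bel, barSplit_bel]
  rw [headLin_ract, LinearMap.lTensor_comp, LinearMap.comp_apply, Function.update_of_ne hl]

theorem barSplit_lact {c : A} (hc : c ∈ N) (y : (bar h.homogeneous_B p).carrier) :
    barSplit h p ((bar h.homogeneous_B p).lact c y) =
      (mulLeftOn N hc).rTensor _ (barSplit h p y) := by
  refine LinearMap.congr_fun (f := barSplit h p ∘ₗ (bar h.homogeneous_B p).lact c)
    (g := (mulLeftOn N hc).rTensor _ ∘ₗ barSplit h p)
    (bar_ext (V := Subalgebra.toSubmodule N ⊗[k] (bar h.homogeneous_B p).carrier) fun a => ?_) y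
  simp only [LinearMap.comp_apply, lact_bel, barSplit_bel]
  rw [headLin_update_zero, Function.update_self, mulEquiv_symm_mul_left h _ hc,
    ← LinearMap.comp_apply, ← LinearMap.comp_apply, LinearMap.lTensor_comp_rTensor,
    LinearMap.rTensor_comp_lTensor]

/-- If a₀ = ∑ nᵢbᵢ, acting by nᵢ on bᵢ ⊗ a₁ ⊗ ⋯ and summing restores a₀ in the first place. Thus
`barSplit` is a section of the action map of N. -/
theorem lift_lact_barSplit (y : (bar h.homogeneous_B p).carrier) :
    TensorProduct.lift ((bar h.homogeneous_B p).lact.domRestrict (Subalgebra.toSubmodule N))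
      (barSplit h p y) = y := by
  refine LinearMap.congr_fun (f := TensorProduct.lift ((bar h.homogeneous_B p).lact.domRestrict
    (Subalgebra.toSubmodule N)) ∘ₗ barSplit h p) (g := LinearMap.id) (bar_ext fun a => ?_) y
  rw [LinearMap.comp_apply, barSplit_bel]
  have : TensorProduct.lift ((bar h.homogeneous_B p).lact.domRestrict (Subalgebra.toSubmodule N)) ∘ₗ
      (headLin h.homogeneous_B a).lTensor _ =
        (bel h.homogeneous_B p).toLinearMap a 0 ∘ₗ (mulEquiv h).toLinearMap := by
    refine TensorProduct.ext' fun n b => ?_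
    simp only [LinearMap.comp_apply, LinearMap.lTensor_tmul, TensorProduct.lift.tmul,
      LinearMap.domRestrict_apply, headLin_apply, lact_bel, Function.update_idem,
      Function.update_self]
    rfl
  refine (LinearMap.congr_fun this _).trans ?_
  simp

/-- The homogeneous components of `N ⊗ Y`. -/
def leftTensorDeg (N : Subalgebra k A) (Y : GrBimod 𝒜) (d : ℤ) :
    Submodule k (Subalgebra.toSubmodule N ⊗[k] Y.carrier) :=
  Submodule.span k {t | ∃ i j, i + j = d ∧ ∃ n y, n.1 ∈ 𝒜 i ∧ y ∈ Y.deg j ∧ t = n ⊗ₜ[k] y}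

theorem barSplit_deg {d : ℤ} {y : (bar h.homogeneous_B p).carrier}
    (hy : y ∈ (bar h.homogeneous_B p).deg d) :
    barSplit h p y ∈ leftTensorDeg N (bar h.homogeneous_B p) d := by
  refine mem_of_bel_deg ((leftTensorDeg N (bar h.homogeneous_B p) d).comap (barSplit h p))
    (fun a e ha he => ?_) hy
  rw [Submodule.mem_comap, barSplit_bel]
  have : mulDeg 𝒜 N B (e 0) ≤ (leftTensorDeg N (bar h.homogeneous_B p) d).comap
      ((headLin h.homogeneous_B a).lTensor _) := by
    refine Submodule.span_le.2 ?_
    rintro _ ⟨i, j, hij, n, b, hn, hb, rfl⟩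
    refine Submodule.subset_span ⟨i, ∑ i, e i + (j - e 0), by omega, n, headLin _ a b, hn,
      headLin_deg _ ha b hb, rfl⟩
  exact this (mulEquiv_symm_mem h _ _ (ha 0))

end Splitting

/-! ### Coextension of graded linear maps to the terms hom_A(Bar(A,B,A),M). -/

section Coextension

variable (h : TriangularDecomposition 𝒜 N B) (p : ℕ) (M : GrModR 𝒜)
  {Z : GrModR fun i => (𝒜 i).comap N.val.toLinearMap}

/-- The linear map `z ↦ (n ⊗ y ↦ g (z · n) (y))`. -/
noncomputable def coextPre (g : Z.carrier →ₗ[k] homSpace (bar h.homogeneous_B p) M) :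
    Z.carrier →ₗ[k] Subalgebra.toSubmodule N ⊗[k] (bar h.homogeneous_B p).carrier →ₗ[k]
      M.carrier :=
  TensorProduct.uncurry (RingHom.id k) (Subalgebra.toSubmodule N)
      (bar h.homogeneous_B p).carrier M.carrier ∘ₗ
    LinearMap.mk₂ k (fun z (n : Subalgebra.toSubmodule N) =>
        ((g (Z.act ⟨n.1, n.2⟩ z)).1 : (bar h.homogeneous_B p).carrier →ₗ[k] M.carrier))
      (fun z z' n => by rw [map_add, map_add]; rfl)
      (fun c z n => by rw [map_smul, map_smul]; rfl)
      (fun z n n' => by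
        have : Z.act ⟨(n + n').1, (n + n').2⟩ z = Z.act ⟨n.1, n.2⟩ z + Z.act ⟨n'.1, n'.2⟩ z :=
          LinearMap.congr_fun (map_add Z.act ⟨n.1, n.2⟩ ⟨n'.1, n'.2⟩) z
        rw [this, map_add]; rfl)
      (fun c z n => by
        have : Z.act ⟨(c • n).1, (c • n).2⟩ z = c • Z.act ⟨n.1, n.2⟩ z :=
          LinearMap.congr_fun (map_smul Z.act c ⟨n.1, n.2⟩) z
        rw [this, map_smul]; rfl)

variable {M} (g : Z.carrier →ₗ[k] homSpace (bar h.homogeneous_B p) M)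

theorem coextPre_tmul (z : Z.carrier) (n : Subalgebra.toSubmodule N)
    (y : (bar h.homogeneous_B p).carrier) :
    coextPre h p M g z (n ⊗ₜ y) = (g (Z.act ⟨n.1, n.2⟩ z)).1 y :=
  rfl

/-- The linear map `z ↦ (y ↦ ∑ g (z · nᵢ) (yᵢ))`, where `∑ nᵢ ⊗ yᵢ` is the splitting of `y`. -/
noncomputable def coextLin :
    Z.carrier →ₗ[k] (bar h.homogeneous_B p).carrier →ₗ[k] M.carrier :=
  LinearMap.lcomp k M.carrier (barSplit h p) ∘ₗ coextPre h p M g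

theorem coextLin_apply (z : Z.carrier) (y : (bar h.homogeneous_B p).carrier) :
    coextLin h p g z y = coextPre h p M g z (barSplit h p y) :=
  rfl

theorem coextLin_ract (z : Z.carrier) (a : A) (y : (bar h.homogeneous_B p).carrier) :
    coextLin h p g z ((bar h.homogeneous_B p).ract a y) = M.act a (coextLin h p g z y) := by
  rw [coextLin_apply, coextLin_apply, barSplit_ract]
  refine LinearMap.congr_fun
    (f := coextPre h p M g z ∘ₗ ((bar h.homogeneous_B p).ract a).lTensor _)
    (g := M.act a ∘ₗ coextPre h p M g z) (TensorProduct.ext' fun n y => ?_) _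
  exact homSpace_ract (g _).2 a y

/-- Since the splitting is left N-linear, replacing y by cy replaces each nᵢ by cnᵢ, and z·(cnᵢ) =
(z·c)·nᵢ. -/
theorem coextLin_act (z : Z.carrier) (c : N) (y : (bar h.homogeneous_B p).carrier) :
    coextLin h p g (Z.act c z) y = coextLin h p g z ((bar h.homogeneous_B p).lact c y) := by
  rw [coextLin_apply, coextLin_apply, barSplit_lact h c.2]
  refine LinearMap.congr_fun (f := coextPre h p M g (Z.act c z))
    (g := coextPre h p M g z ∘ₗ (mulLeftOn N c.2).rTensor _)
    (TensorProduct.ext' fun n y => ?_) _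
  rw [LinearMap.comp_apply, LinearMap.rTensor_tmul, coextPre_tmul, coextPre_tmul, ← Z.act_mul]
  rfl

variable {g} in
theorem coextLin_mem_homDeg
    (hg : ∀ i, ∀ z ∈ Z.deg i, (g z).1 ∈ homDeg (bar h.homogeneous_B p) M i) {i : ℤ}
    {z : Z.carrier} (hz : z ∈ Z.deg i) :
    coextLin h p g z ∈ homDeg (bar h.homogeneous_B p) M i := by
  refine ⟨coextLin_ract h p g z, fun d y hy => ?_⟩
  have : leftTensorDeg N (bar h.homogeneous_B p) d ≤
      (M.deg (d + i)).comap (coextPre h p M g z) := by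
    refine Submodule.span_le.2 ?_
    rintro _ ⟨l, m, rfl, n, y, hn, hy, rfl⟩
    have h1 := (hg _ _ (Z.act_mem i l z hz ⟨n.1, n.2⟩ hn)).2 m y hy
    rwa [show m + (i + l) = l + m + i by ring] at h1
  exact this (barSplit_deg h hy)

variable {g} in
theorem coextLin_mem_homSpace
    (hg : ∀ i, ∀ z ∈ Z.deg i, (g z).1 ∈ homDeg (bar h.homogeneous_B p) M i) (z : Z.carrier) :
    coextLin h p g z ∈ homSpace (bar h.homogeneous_B p) M :=
  top_le_of_homog Z.isInternal ((homSpace _ M).comap (coextLin h p g))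
    (fun i _ hz => homDeg_le _ M i (coextLin_mem_homDeg h p hg hz)) z

/-- The coextension of a degree preserving linear map to `hom_A(Bar⁻ᵖ(A, B, A), M)`. -/
noncomputable def coextHom (g : Z.carrier →ₗ[k] homSpace (bar h.homogeneous_B p) M)
    (hg : ∀ i, ∀ z ∈ Z.deg i, (g z).1 ∈ homDeg (bar h.homogeneous_B p) M i) :
    Z ⟶ (GrModR.restrict N).obj (homMod (bar h.homogeneous_B p) M) where
  lin := (coextLin h p g).codRestrict _ (coextLin_mem_homSpace h p hg)
  map_act c z := Subtype.ext (LinearMap.ext fun y => coextLin_act h p g z c y)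
  map_deg _ _ hz := coextLin_mem_homDeg h p hg hz

/-- If g is already N-linear, then ∑ g(z·nᵢ)(yᵢ) = ∑ g(z)(nᵢyᵢ) = g(z)(y), because the splitting of
y is a section of the action. Compatibility with u : Z → Z' only uses u(z·n) = u(z)·n. -/
theorem hasCoextension_homMod :
    HasCoextension ((GrModR.restrict N).obj (homMod (bar h.homogeneous_B p) M)) := by
  refine ⟨fun Z g => coextHom h p g.1 g.2, fun Z f => ?_, fun Z Z' u g => ?_⟩
  · refine GrModR.hom_ext (LinearMap.ext fun z => Subtype.ext (LinearMap.ext fun y => ?_))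
    let f' : Z.carrier →ₗ[k] homSpace (bar h.homogeneous_B p) M := f.lin
    change coextPre h p M f' z (barSplit h p y) = (f' z).1 y
    conv_rhs => rw [← lift_lact_barSplit h y]
    refine LinearMap.congr_fun (f := coextPre h p M f' z)
      (g := (f' z).1 ∘ₗ TensorProduct.lift
        ((bar h.homogeneous_B p).lact.domRestrict (Subalgebra.toSubmodule N)))
      (TensorProduct.ext' fun n y => ?_) _
    exact LinearMap.congr_fun (congrArg Subtype.val (f.map_act ⟨n.1, n.2⟩ z)) y
  · refine GrModR.hom_ext (LinearMap.ext fun z => Subtype.ext (LinearMap.ext fun y => ?_))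
    let g' : Z'.carrier →ₗ[k] homSpace (bar h.homogeneous_B p) M := g.1
    change coextPre h p M g' (u.lin z) (barSplit h p y) =
      coextPre h p M (g' ∘ₗ u.lin) z (barSplit h p y)
    refine LinearMap.congr_fun (f := coextPre h p M g' (u.lin z))
      (g := coextPre h p M (g' ∘ₗ u.lin) z) (TensorProduct.ext' fun n y => ?_) _
    rw [coextPre_tmul, coextPre_tmul, ← u.map_act]
    rfl

end Coextension

end Coextensions

section KInjectives

variable {𝒜 : ℤ → Submodule k A} [GradedAlgebra 𝒜] {N B : Subalgebra k A}

/-! ### K-injectivity of S over N. -/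

section KInjective

variable (h : TriangularDecomposition 𝒜 N B) (M : GrModR 𝒜)

instance (m : ℤ) : Subsingleton (NatIdx m) :=
  ⟨fun x y => Subtype.ext (by have := x.2; have := y.2; omega)⟩

theorem subsingleton_coBar {hB : SetLike.IsHomogeneous 𝒜 B} {m : ℤ} (hm : m < 0) :
    Subsingleton ((coBar hB M).X m).carrier :=
  ⟨fun _ _ => DFinsupp.ext (β := fun q : NatIdx m => (homMod (bar hB q.1) M).carrier)
    fun q => absurd q.2 (by omega)⟩

theorem isKInj_coBar : IsKInj (restrictComplex N (coBar h.homogeneous_B M)) :=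
  isKInj_of_hasCoextension _
    (fun m => hasCoextension_sumMod (F := fun q : NatIdx m => homMod (bar h.homogeneous_B q.1) M)
      fun q => hasCoextension_homMod h q.1)
    fun _ hm => subsingleton_coBar M hm

variable (hN : SetLike.IsHomogeneous 𝒜 N) (hB : SetLike.IsHomogeneous 𝒜 B)

/-- The augmentation, as a morphism of complexes of `N`-modules. -/
noncomputable def augRestrict :
    restrictComplex N (semiBar hN hB M) ⟶ restrictComplex N (coBar hB M) :=
  ((GrModR.restrict N).mapHomologicalComplex _).map (aug hN hB M)

/-- The `N`-linear section `x ↦ x ⊗ 1 ⊗ 1` of the augmentation. -/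
noncomputable def unit :
    restrictComplex N (coBar hB M) ⟶ restrictComplex N (semiBar hN hB M) where
  f := unitF hN hB M
  comm' i j hij := GrModR.hom_ext (LinearMap.ext fun x => unitF_d i j hij x)

/-- The augmentation and its section are inverse to each other up to homotopy. -/
noncomputable def snocHomotopy : Homotopy (𝟙 _ - augRestrict M hN hB ≫ unit M hN hB) 0 :=
  homotopyZeroOf _ (snocF hN hB M) fun i j l hij hjl =>
    restrict_hom_ext (LinearMap.ext fun x => snocF_homotopy i j l hij hjl x)

/-- K-injectivity passes along a homotopy equivalence: f is the sum of its composite with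
augmentation and unit, null homotopic because it factors through a K-injective complex, and its
composite with the null homotopic map 1 - (unit ∘ augmentation). -/
theorem isKInj_semiBar :
    IsKInj (restrictComplex N (semiBar h.homogeneous_N h.homogeneous_B M)) := by
  intro Z hZ hZ' f
  obtain ⟨s⟩ := isKInj_coBar h M Z hZ hZ' (f ≫ augRestrict M _ _)
  have s₁ := s.compRight (unit M h.homogeneous_N h.homogeneous_B)
  have s₂ := (snocHomotopy M h.homogeneous_N h.homogeneous_B).compLeft f
  refine ⟨(Homotopy.ofEq ?_).trans ((s₁.add s₂).trans (Homotopy.ofEq ?_))⟩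
  · rw [Preadditive.comp_sub, Category.comp_id, Category.assoc, add_sub_cancel]
  · rw [Limits.zero_comp, Limits.comp_zero, add_zero]

end KInjective

/-! ### The modules X ⊗_A Bar(A,C,A) are induced from C. -/

section RelativelyProjective

variable {C : Subalgebra k A} (hC : SetLike.IsHomogeneous 𝒜 C) {n : ℕ} {X V : GrModR 𝒜}

/-- The map `x ⊗ a₀ ⊗ ⋯ ⊗ aₙ₊₁ ↦ φ (x ⊗ a₀ ⊗ ⋯ ⊗ aₙ ⊗ 1) · aₙ₊₁` as a multilinear map. -/
noncomputable def inducePre (φ : (tensorMod X (bar hC n)).carrier →ₗ[k] V.carrier) :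
    MultilinearMap k (fun _ : Fin (n + 2) => A) (X.carrier →ₗ[k] V.carrier) where
  toFun a := V.act (a (Fin.last (n + 1))) ∘ₗ φ ∘ₗ (tmk X (bar hC n)).flip
    (bel hC n (Function.update a (Fin.last (n + 1)) 1))
  map_update_add' := @fun inst a i x y => by
    obtain rfl : inst = instDecidableEqFin _ := Subsingleton.elim _ _
    by_cases hi : i = Fin.last (n + 1)
    · subst hi
      simp only [Function.update_self, Function.update_idem, map_add, LinearMap.add_comp]
    · simp only [Function.update_of_ne (Ne.symm hi), Function.update_comm hi,
        MultilinearMap.map_update_add, map_add, LinearMap.comp_add]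
  map_update_smul' := @fun inst a i c x => by
    obtain rfl : inst = instDecidableEqFin _ := Subsingleton.elim _ _
    by_cases hi : i = Fin.last (n + 1)
    · subst hi
      simp only [Function.update_self, Function.update_idem, map_smul, LinearMap.smul_comp]
    · simp only [Function.update_of_ne (Ne.symm hi), Function.update_comm hi,
        MultilinearMap.map_update_smul, map_smul, LinearMap.comp_smul]

theorem inducePre_apply (φ : (tensorMod X (bar hC n)).carrier →ₗ[k] V.carrier)
    (a : Fin (n + 2) → A) (x : X.carrier) : inducePre hC φ a x = V.act (a (Fin.last (n + 1)))
      (φ (tmk X _ x (bel hC n (Function.update a (Fin.last (n + 1)) 1)))) :=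
  rfl

/-- The `A`-linear map which agrees with the `C`-linear map `φ` on the tensors with last
factor `1`. -/
noncomputable def induceLin (φ : (GrModR.restrict C).obj (tensorMod X (bar hC n)) ⟶
    (GrModR.restrict C).obj V) : (tensorMod X (bar hC n)).carrier →ₗ[k] V.carrier :=
  tensorLift (barLift hC (inducePre hC (restrictLin φ))
    (fun a s c hc => LinearMap.ext fun x => by
      have hs : s.castSucc ≠ Fin.last (n + 1) := (Fin.castSucc_lt_last s).ne
      rw [inducePre_apply, inducePre_apply, Function.update_of_ne hs.symm]
      by_cases hl : s.succ = Fin.last (n + 1)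
      -- At the last tensor sign, c belongs to the factor that acts on V from outside. The
      -- C-linearity of φ brings it inside, where it multiplies the last factor 1 and crosses the
      -- tensor sign.
      · have hne : s.castSucc ≠ s.succ := by simp [Fin.ext_iff]
        have h1 := bel_balanced hC (Function.update a s.succ 1) s hc
        have h2 := ract_bel hC c (Function.update a s.succ 1)
        rw [Function.update_self, Function.update_idem, mul_one, Function.update_of_ne hne] at h1
        rw [← hl, Function.update_self, Function.update_idem, one_mul] at h2
        rw [← hl, Function.update_self, Function.update_idem, V.act_mul,
          ← restrictLin_act φ hc, act_tmk, h2, ← h1, Function.update_comm hne]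
      · rw [Function.update_of_ne (Ne.symm hl), Function.update_comm hs, Function.update_comm hl]
        have h1 := bel_balanced hC (Function.update a (Fin.last (n + 1)) 1) s hc
        rw [Function.update_of_ne hs, Function.update_of_ne hl] at h1
        rw [h1])
    (fun a s h0 hl hs => LinearMap.ext fun x => by
      rw [inducePre_apply, bel_degenerate hC _ s h0 hl (by rwa [Function.update_of_ne hl]),
        map_zero, map_zero, map_zero, LinearMap.zero_apply])).flip
    (fun b x y => by
      refine LinearMap.congr_fun
        (f := (barLift hC (inducePre hC (restrictLin φ)) _ _).flip (X.act b x))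
        (g := (barLift hC (inducePre hC (restrictLin φ)) _ _).flip x ∘ₗ (bar hC n).lact b)
        (bar_ext fun a => ?_) y
      have h0 : (0 : Fin (n + 2)) ≠ Fin.last (n + 1) := by simp [Fin.ext_iff]
      simp only [LinearMap.flip_apply, LinearMap.comp_apply, lact_bel, barLift_bel,
        inducePre_apply]
      rw [Function.update_of_ne h0.symm, tmk_act, lact_bel, Function.update_comm h0,
        Function.update_of_ne h0])

theorem induceLin_tmk (φ : (GrModR.restrict C).obj (tensorMod X (bar hC n)) ⟶
    (GrModR.restrict C).obj V) (x : X.carrier) (a : Fin (n + 2) → A) :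
    induceLin hC φ (tmk X _ x (bel hC n a)) = V.act (a (Fin.last (n + 1)))
      (restrictLin φ (tmk X _ x (bel hC n (Function.update a (Fin.last (n + 1)) 1)))) := by
  refine (tensorLift_tmk _ _ _ _).trans ?_
  rw [LinearMap.flip_apply, barLift_bel, inducePre_apply]

variable {hC} in
theorem tensor_bar_ext {V : Type*} [AddCommGroup V] [Module k V]
    {f g : (tensorMod X (bar hC n)).carrier →ₗ[k] V}
    (h : ∀ x a, f (tmk X _ x (bel hC n a)) = g (tmk X _ x (bel hC n a))) : f = g :=
  tensor_ext fun x y => LinearMap.congr_fun (f := f ∘ₗ tmk X _ x) (g := g ∘ₗ tmk X _ x)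
    (bar_ext fun a => h x a) y

/-- The `A`-linear morphism which agrees with the `C`-linear morphism `φ` on the tensors with last
factor `1`. -/
noncomputable def induce (φ : (GrModR.restrict C).obj (tensorMod X (bar hC n)) ⟶
    (GrModR.restrict C).obj V) : tensorMod X (bar hC n) ⟶ V where
  lin := induceLin hC φ
  map_act b t := by
    refine LinearMap.congr_fun (f := induceLin hC φ ∘ₗ (tensorMod X (bar hC n)).act b)
      (g := V.act b ∘ₗ induceLin hC φ) (tensor_bar_ext fun x a => ?_) t
    simp only [LinearMap.comp_apply, act_tmk, ract_bel, induceLin_tmk]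
    rw [Function.update_self, Function.update_idem, V.act_mul]
  map_deg d t ht := by
    refine mem_of_tmk_deg ((V.deg d).comap (induceLin hC φ)) (fun i j hij x hx y hy => ?_) ht
    refine mem_of_bel_deg (((V.deg d).comap (induceLin hC φ)).comap (tmk X _ x))
      (fun a e ha he => ?_) hy
    change induceLin hC φ _ ∈ V.deg d
    rw [induceLin_tmk]
    -- Replacing the last factor by 1 lowers the degree by e (Fin.last (n + 1)); the action of that
    -- factor on V restores it.
    have h1 : bel hC n (Function.update a (Fin.last (n + 1)) 1) ∈ (bar hC n).deg
        (∑ i, e i + -e (Fin.last (n + 1))) :=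
      ⟨_, update_homog ha _ 1 _ (by rw [add_neg_cancel]; exact SetLike.one_mem_graded 𝒜), rfl⟩
    have h2 := V.act_mem _ _ _ (restrictLin_deg φ (tmk_mem_deg hx h1)) _ (ha (Fin.last (n + 1)))
    rwa [he, show i + (j + -e (Fin.last (n + 1))) + e (Fin.last (n + 1)) = d by omega] at h2

theorem induce_tmk (φ : (GrModR.restrict C).obj (tensorMod X (bar hC n)) ⟶
    (GrModR.restrict C).obj V) (x : X.carrier) (a : Fin (n + 2) → A)
    (ha : a (Fin.last (n + 1)) = 1) :
    (induce hC φ).lin (tmk X _ x (bel hC n a)) = restrictLin φ (tmk X _ x (bel hC n a)) := by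
  refine (induceLin_tmk hC φ x a).trans ?_
  rw [ha, V.act_one, ← ha, Function.update_eq_self]

variable {hC} in
/-- An `A`-linear morphism is determined by its values on the tensors with last factor `1`. -/
theorem tensor_bar_hom_ext {f g : tensorMod X (bar hC n) ⟶ V}
    (h : ∀ x a, a (Fin.last (n + 1)) = 1 →
      f.lin (tmk X _ x (bel hC n a)) = g.lin (tmk X _ x (bel hC n a))) : f = g := by
  refine GrModR.hom_ext (tensor_bar_ext fun x a => ?_)
  have h1 := ract_bel hC (a (Fin.last (n + 1))) (Function.update a (Fin.last (n + 1)) 1)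
  rw [Function.update_self, Function.update_idem, one_mul, Function.update_eq_self] at h1
  rw [← h1, ← act_tmk, f.map_act, g.map_act, h _ _ (Function.update_self _ _ _)]

end RelativelyProjective

end KInjectives

section RelativeKProjectives

variable {𝒜 : ℤ → Submodule k A} [GradedAlgebra 𝒜] {N B : Subalgebra k A}

/-! ### K-projectivity of S relative to N. -/

section RelKProj

variable {hN : SetLike.IsHomogeneous 𝒜 N} {hB : SetLike.IsHomogeneous 𝒜 B} {M : GrModR 𝒜}

theorem tel_d_zero {i j : ℤ} (hij : i + 1 = j) (p : ℕ) (h : (p : ℤ) - (0 : ℕ) = i) :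
    tel hN hB M i p 0 h ≫ (semiBar hN hB M).d i j =
      termD₁ hN hB M p 0 ≫ tel hN hB M j (p + 1) 0 (by push_cast at h ⊢; omega) :=
  GrModR.hom_ext (LinearMap.ext fun x => semiBar_d_zero hij p h x)

theorem tel_d_succ {i j : ℤ} (hij : i + 1 = j) (p n : ℕ) (h : (p : ℤ) - (n + 1 : ℕ) = i) :
    tel hN hB M i p (n + 1) h ≫ (semiBar hN hB M).d i j =
      termD₁ hN hB M p (n + 1) ≫ tel hN hB M j (p + 1) (n + 1) (by push_cast at h ⊢; omega) +
      termD₂ hN hB M p n ≫ tel hN hB M j p n (by push_cast at h ⊢; omega) :=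
  GrModR.hom_ext (LinearMap.ext fun x => semiBar_d_succ hij p n h x)

variable {V : CochainComplex (GrModR 𝒜) ℤ} (f : semiBar hN hB M ⟶ V)
  (c : ∀ i j, (GrModR.restrict N).obj (V.X i) ⟶ (GrModR.restrict N).obj (V.X j))

/-- The components of the `A`-linear null homotopy of `f` obtained from an `N`-linear contraction
`c` of the target. -/
noncomputable def relHomotopy : ∀ (n p : ℕ) (i j : ℤ), (p : ℤ) - n = i →
    (term hN hB M p n ⟶ V.X j)
  | 0, p, i, j, h => induce hN ((GrModR.restrict N).map (tel hN hB M i p 0 h ≫ f.f i) ≫ c i j)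
  | n + 1, p, i, j, h => induce hN ((GrModR.restrict N).map
      (tel hN hB M i p (n + 1) h ≫ f.f i - termD₂ hN hB M p n ≫
        relHomotopy n p (i + 1) i (by push_cast at h; omega)) ≫ c i j)

/-- The difference of `f` and the part of the homotopy constructed before. -/
noncomputable def relDefect : ∀ (n p : ℕ) (i : ℤ), (p : ℤ) - n = i → (term hN hB M p n ⟶ V.X i)
  | 0, p, i, h => tel hN hB M i p 0 h ≫ f.f i
  | n + 1, p, i, h => tel hN hB M i p (n + 1) h ≫ f.f i - termD₂ hN hB M p n ≫
        relHomotopy f c n p (i + 1) i (by push_cast at h; omega)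

theorem relHomotopy_eq (n p : ℕ) (i j : ℤ) (h : (p : ℤ) - n = i) :
    relHomotopy f c n p i j h =
      induce hN ((GrModR.restrict N).map (relDefect f c n p i h) ≫ c i j) := by
  cases n <;> rfl

theorem relHomotopy_tmk (n p : ℕ) (i j : ℤ) (h : (p : ℤ) - n = i)
    (x : (homMod (bar hB p) M).carrier) (a : Fin (n + 2) → A) (ha : a (Fin.last (n + 1)) = 1) :
    (relHomotopy f c n p i j h).lin (tmk _ _ x (bel hN n a)) =
      restrictLin (c i j) ((relDefect f c n p i h).lin (tmk _ _ x (bel hN n a))) := by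
  rw [relHomotopy_eq]
  exact induce_tmk hN _ x a ha

/-- The correction term in the defect begins with the second differential, and the square of that
differential is zero. -/
theorem termD₂_relDefect (n p : ℕ) (i : ℤ) (h : (p : ℤ) - n = i) :
    termD₂ hN hB M p n ≫ relDefect f c n p i h = termD₂ hN hB M p n ≫ tel hN hB M i p n h ≫ f.f i := by
  cases n with
  | zero => rfl
  | succ n =>
    rw [relDefect, Preadditive.comp_sub, ← Category.assoc (termD₂ hN hB M p (n + 1)) (termD₂ _ _ _ _ _),
      termD₂_termD₂, Limits.zero_comp, sub_zero]

variable (N V) in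
/-- The maps `c` form an `N`-linear contraction of the complex `V`. -/
def IsContraction (c : ∀ i j, (GrModR.restrict N).obj (V.X i) ⟶ (GrModR.restrict N).obj (V.X j)) :
    Prop :=
  ∀ i j l, i + 1 = j → j + 1 = l → ∀ v : (V.X j).carrier,
    restrictLin (c l j) ((V.d j l).lin v) + (V.d i j).lin (restrictLin (c j i) v) = v

variable {c}

/-- Both sides are A-linear, so tensors with last factor 1 suffice. The first differential does not
touch the bar factor, so on such tensors every homotopy is c applied to a defect. The hypothesis
`hg` then reduces the claim to the contraction identity at the defect of the tensor. -/
theorem relHomotopy_comm_of (hc : IsContraction N V c) (n p : ℕ) (i j l : ℤ) (hij : i + 1 = j) (hjl : j + 1 = l)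
    (h : (p : ℤ) - n = j) (h' : ((p + 1 : ℕ) : ℤ) - n = l)
    (hg : termD₁ hN hB M p n ≫ relDefect f c n (p + 1) l h' = relDefect f c n p j h ≫ V.d j l) :
    termD₁ hN hB M p n ≫ relHomotopy f c n (p + 1) l j h' + relHomotopy f c n p j i h ≫ V.d i j =
      relDefect f c n p j h := by
  refine tensor_bar_hom_ext fun x a ha => ?_
  have h1 : (relDefect f c n (p + 1) l h').lin ((termD₁ hN hB M p n).lin (tmk _ _ x (bel hN n a))) =
      (V.d j l).lin ((relDefect f c n p j h).lin (tmk _ _ x (bel hN n a))) :=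
    LinearMap.congr_fun (congrArg GrModR.Hom.lin hg) (tmk _ _ x (bel hN n a))
  have h2 := relHomotopy_tmk f c n p j i h x a ha
  have h3 := relHomotopy_tmk f c n (p + 1) l j h' ((homD hB M p).lin x) a ha
  have h4 := hc i j l hij hjl ((relDefect f c n p j h).lin (tmk _ _ x (bel hN n a)))
  rw [← h1] at h4
  refine Eq.trans ?_ h4
  exact congrArg₂ (· + ·) h3 (congrArg (V.d i j).lin h2)

/-- The defect is compatible with the first differential, by induction on n. For n = 0 this is the
chain map property of f. In the step, the homotopy identity for n is precomposed with the second
differential; as the two differentials anticommute, the corrections match. -/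
theorem termD₁_relDefect (hc : IsContraction N V c) (n : ℕ) : ∀ (p : ℕ) (j l : ℤ) (_ : j + 1 = l)
    (h : (p : ℤ) - n = j) (h' : ((p + 1 : ℕ) : ℤ) - n = l),
    termD₁ hN hB M p n ≫ relDefect f c n (p + 1) l h' = relDefect f c n p j h ≫ V.d j l := by
  induction n with
  | zero =>
    intro p j l hjl h h'
    rw [relDefect, relDefect, Category.assoc, f.comm, ← Category.assoc, ← Category.assoc,
      tel_d_zero hjl]
  | succ n ih =>
    intro p j l hjl h h'
    subst hjl
    have h₁ : (p : ℤ) - n = j + 1 := by push_cast at h; omega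
    have h₂ : ((p + 1 : ℕ) : ℤ) - n = j + 1 + 1 := by push_cast at h ⊢; omega
    have h3 := relHomotopy_comm_of f hc n p j (j + 1) (j + 1 + 1) rfl rfl h₁ h₂
      (ih p _ _ rfl h₁ h₂)
    have h4 := congrArg (termD₂ hN hB M p n ≫ ·) h3
    simp only [Preadditive.comp_add, termD₂_relDefect] at h4
    have h5 := termD₁_termD₂ hN hB M p n
    rw [relDefect, relDefect, Preadditive.sub_comp, Preadditive.comp_sub, Category.assoc, f.comm,
      ← Category.assoc (tel hN hB M j p (n + 1) h), tel_d_succ rfl, Preadditive.add_comp,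
      Category.assoc, Category.assoc, Category.assoc, ← h4, ← Category.assoc (termD₁ hN hB M p (n + 1)),
      ← Category.assoc (termD₁ hN hB M p (n + 1)) (termD₂ _ _ _ _ _), eq_neg_of_add_eq_zero_left h5,
      Preadditive.neg_comp, ← Category.assoc (termD₂ hN hB M p n) (termD₁ _ _ _ _ _)]
    abel

theorem relHomotopy_comm (hc : IsContraction N V c) (n p : ℕ) (i j l : ℤ) (hij : i + 1 = j) (hjl : j + 1 = l)
    (h : (p : ℤ) - n = j) (h' : ((p + 1 : ℕ) : ℤ) - n = l) :
    termD₁ hN hB M p n ≫ relHomotopy f c n (p + 1) l j h' + relHomotopy f c n p j i h ≫ V.d i j =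
      relDefect f c n p j h :=
  relHomotopy_comm_of f hc n p i j l hij hjl h h' (termD₁_relDefect f hc n p j l hjl h h')

variable (c) in
/-- The null homotopy of `f` in degree `i`. -/
noncomputable def relHomotopyF (i j : ℤ) : (semiBar hN hB M).X i ⟶ V.X j :=
  sumDesc fun q : TotIdx i => relHomotopy f c q.1.2 q.1.1 i j q.2

theorem tel_relHomotopyF (i j : ℤ) (p n : ℕ) (h : (p : ℤ) - n = i) :
    tel hN hB M i p n h ≫ relHomotopyF f c i j = relHomotopy f c n p i j h :=
  sumIncl_sumDesc (fun q : TotIdx i => relHomotopy f c q.1.2 q.1.1 i j q.2) ⟨(p, n), h⟩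

/-- For n ≥ 1 the second differential of S contributes exactly the correction that was subtracted
from f in the defect, so the identity for the defect becomes the one for f. -/
theorem tel_relHomotopyF_comm (hc : IsContraction N V c) (i j l : ℤ) (hij : i + 1 = j)
    (hjl : j + 1 = l) (p n : ℕ) (h : (p : ℤ) - n = j) :
    tel hN hB M j p n h ≫ ((semiBar hN hB M).d j l ≫ relHomotopyF f c l j +
      relHomotopyF f c j i ≫ V.d i j) = tel hN hB M j p n h ≫ f.f j := by
  subst hjl
  have h₁ : ((p + 1 : ℕ) : ℤ) - n = j + 1 := by push_cast; omega
  have h2 := relHomotopy_comm f hc n p i j (j + 1) hij rfl h h₁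
  rcases n with _ | n
  · rw [Preadditive.comp_add, ← Category.assoc, tel_d_zero rfl, Category.assoc, tel_relHomotopyF,
      ← Category.assoc, tel_relHomotopyF]
    exact h2
  · rw [Preadditive.comp_add, ← Category.assoc, tel_d_succ rfl, Preadditive.add_comp,
      Category.assoc, Category.assoc, tel_relHomotopyF, tel_relHomotopyF,
      ← Category.assoc, tel_relHomotopyF, add_right_comm, h2, relDefect, sub_add_cancel]

theorem isRelKProj_semiBar : IsRelKProj N (semiBar hN hB M) := by
  rintro V - ⟨c⟩ f
  let c' : ∀ i j, (GrModR.restrict N).obj (V.X i) ⟶ (GrModR.restrict N).obj (V.X j) := c.hom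
  have hc : IsContraction N V c' := by
    intro i j l hij hjl v
    have h1 := c.comm j
    rw [dNext_eq c.hom (show (ComplexShape.up ℤ).Rel j l from hjl),
      prevD_eq c.hom (show (ComplexShape.up ℤ).Rel i j from hij)] at h1
    have h2 := LinearMap.congr_fun (congrArg GrModR.Hom.lin h1) v
    exact (add_zero _).symm.trans h2.symm
  exact ⟨homotopyZeroOf f (fun i j _ => relHomotopyF f c' i j) fun i j l hij hjl =>
    sum_hom_ext fun q => tel_relHomotopyF_comm f hc i j l hij hjl q.1.1 q.1.2 q.2⟩

end RelKProj

end RelativeKProjectives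

section Resolutions

section

variable {𝒜 : ℤ → Submodule k A}

theorem subsingleton_of_isZero {X : GrModR 𝒜} (hX : Limits.IsZero X) : Subsingleton X.carrier :=
  ⟨fun x y => by
    have h1 : ∀ x : X.carrier, x = 0 := fun x =>
      LinearMap.congr_fun (congrArg GrModR.Hom.lin (hX.eq_of_src (𝟙 X) 0)) x
    rw [h1 x, h1 y]⟩

theorem isCobound_zero (X : CochainComplex (GrModR 𝒜) ℤ) (n : ℤ) : IsCobound X n 0 :=
  ⟨0, map_zero _⟩

end

variable {𝒜 : ℤ → Submodule k A} [GradedAlgebra 𝒜] {N B : Subalgebra k A}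

/-! ### The complex hom_A(Bar(A,B,A),M) is a resolution of M. -/

section Coaugmentation

variable (hB : SetLike.IsHomogeneous 𝒜 B) (M : GrModR 𝒜)

/-- The linear map `m ↦ (a ⊗ b ↦ m · ab)`. -/
noncomputable def coaugLin : M.carrier →ₗ[k] (bar hB 0).carrier →ₗ[k] M.carrier :=
  LinearMap.lcomp k M.carrier (barAug hB) ∘ₗ M.act.flip

theorem coaugLin_apply (m : M.carrier) (y : (bar hB 0).carrier) :
    coaugLin hB M m y = M.act (barAug hB y) m :=
  rfl

theorem coaugLin_mem_homDeg {i : ℤ} {m : M.carrier} (hm : m ∈ M.deg i) :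
    coaugLin hB M m ∈ homDeg (bar hB 0) M i :=
  ⟨fun a y => by rw [coaugLin_apply, coaugLin_apply, barAug_ract, M.act_mul], fun d y hy => by
    rw [add_comm]
    exact M.act_mem i d m hm _ (barAug_deg hB d y hy)⟩

theorem coaugLin_mem_homSpace (m : M.carrier) : coaugLin hB M m ∈ homSpace (bar hB 0) M :=
  top_le_of_homog M.isInternal ((homSpace (bar hB 0) M).comap (coaugLin hB M))
    (fun i _ hm => homDeg_le _ M i (coaugLin_mem_homDeg hB M hm)) m

/-- The embedding of `M` into `hom_A(A ⊗_B A, M)`. -/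
noncomputable def coaug : M ⟶ homMod (bar hB 0) M where
  lin := (coaugLin hB M).codRestrict _ (coaugLin_mem_homSpace hB M)
  map_act a m := by
    refine Subtype.ext (LinearMap.ext fun y => ?_)
    change M.act (barAug hB y) (M.act a m) = M.act (barAug hB ((bar hB 0).lact a y)) m
    rw [barAug_lact, M.act_mul]
  map_deg _ _ hm := coaugLin_mem_homDeg hB M hm

theorem coaug_homD : coaug hB M ≫ homD hB M 0 = 0 := by
  have : coaug hB M ≫ homMap (barD hB 0) M = 0 := by
    refine GrModR.hom_ext (LinearMap.ext fun m => Subtype.ext (LinearMap.ext fun y => ?_))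
    change M.act (barAug hB ((barD hB 0).lin y)) m = 0
    rw [barAug_barD, map_zero, LinearMap.zero_apply]
  rw [homD, Preadditive.comp_zsmul, this, smul_zero]

/-- The value at `1 ⊗ 1`. -/
noncomputable def evalOne : (homMod (bar hB 0) M).carrier →ₗ[k] M.carrier :=
  LinearMap.applyₗ (bel hB 0 ![1, 1]) ∘ₗ (homSpace (bar hB 0) M).subtype

theorem evalOne_coaug (m : M.carrier) : evalOne hB M ((coaug hB M).lin m) = m := by
  change M.act (barAug hB (bel hB 0 ![1, 1])) m = m
  rw [barAug_bel]
  simp [M.act_one]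

theorem evalOne_deg {i : ℤ} {f : (homMod (bar hB 0) M).carrier}
    (hf : f ∈ (homMod (bar hB 0) M).deg i) : evalOne hB M f ∈ M.deg i := by
  have := hf.2 0 _ (unit_mem_deg hB)
  rwa [zero_add] at this

variable {hB M}

theorem homD_eq_zero_iff {p : ℕ} (f : (homMod (bar hB p) M).carrier) :
    (homD hB M p).lin f = 0 ↔ ∀ y, f.1 ((barD hB p).lin y) = 0 := by
  have h1 : (homD hB M p).lin f = (-1 : ℤ) ^ (p + 1) • (homMap (barD hB p) M).lin f := rfl
  have h2 : (homMap (barD hB p) M).lin f = 0 ↔ ∀ y, f.1 ((barD hB p).lin y) = 0 :=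
    ⟨fun h y => LinearMap.congr_fun (congrArg Subtype.val h) y,
      fun h => Subtype.ext (LinearMap.ext h)⟩
  rw [← h2, h1]
  rcases neg_one_pow_eq_or ℤ (p + 1) with h | h <;> simp [h]

/-- Evaluating the cocycle condition at 1 ⊗ a ⊗ b gives f(a ⊗ b) = f(1 ⊗ ab), which is f(1 ⊗ 1)·ab
by right A-linearity. -/
theorem coaug_evalOne {f : (homMod (bar hB 0) M).carrier} (hf : (homD hB M 0).lin f = 0) :
    (coaug hB M).lin (evalOne hB M f) = f := by
  refine Subtype.ext (bar_ext fun a => ?_)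
  change M.act (barAug hB (bel hB 0 a)) (f.1 (bel hB 0 ![1, 1])) = f.1 (bel hB 0 a)
  have h1 := (homD_eq_zero_iff f).1 hf (barCons hB 0 (bel hB 0 a))
  rw [barD_barCons_zero, map_sub, sub_eq_zero] at h1
  rw [h1, barAug_bel, ← homSpace_ract f.2, ract_bel]
  congr 2
  ext l; fin_cases l <;> simp

theorem comp_barCons_mem_homSpace {p : ℕ} (f : (homMod (bar hB (p + 1)) M).carrier) :
    f.1 ∘ₗ barCons hB p ∈ homSpace (bar hB p) M := by
  have h1 : homSpace (bar hB (p + 1)) M ≤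
      (homSpace (bar hB p) M).comap (LinearMap.lcomp k M.carrier (barCons hB p)) :=
    iSup_le fun i g hg => homDeg_le _ M i ⟨fun a y => by
      change g (barCons hB p _) = M.act a (g (barCons hB p y))
      rw [barCons_ract, hg.1], fun d y hy => hg.2 d _ (barCons_deg hB d y hy)⟩
  exact h1 f.2

/-- If f vanishes on boundaries, evaluating at d(1 ⊗ y) = y - 1 ⊗ dy gives f(y) = f(1 ⊗ dy). Hence f
comes from y ↦ f(1 ⊗ y) up to sign; this map is A-linear because prepending 1 commutes with the
right action. -/
theorem exists_homD_eq {p : ℕ} {f : (homMod (bar hB (p + 1)) M).carrier}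
    (hf : (homD hB M (p + 1)).lin f = 0) : ∃ g, (homD hB M p).lin g = f := by
  let g : (homMod (bar hB p) M).carrier := ⟨f.1 ∘ₗ barCons hB p, comp_barCons_mem_homSpace f⟩
  have hg : (homMap (barD hB p) M).lin g = f := by
    refine Subtype.ext (LinearMap.ext fun y => ?_)
    have h1 := (homD_eq_zero_iff f).1 hf (barCons hB (p + 1) y)
    rw [barD_barCons, map_sub, sub_eq_zero] at h1
    exact h1.symm
  refine ⟨(-1 : ℤ) ^ (p + 1) • g, ?_⟩
  have h1 : (homD hB M p).lin ((-1 : ℤ) ^ (p + 1) • g) =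
      (-1 : ℤ) ^ (p + 1) • (-1 : ℤ) ^ (p + 1) • (homMap (barD hB p) M).lin g := by
    rw [map_zsmul]
    rfl
  rw [h1, smul_smul, ← mul_pow, neg_one_mul, neg_neg, one_pow, one_smul, hg]

/-- The projection of the complex `hom_A(Bar(A, B, A), M)` to one of its terms. -/
noncomputable def coProj (m : ℤ) (p : ℕ) (h : (p : ℤ) = m) :
    (coBar hB M).X m ⟶ homMod (bar hB p) M :=
  sumProj (fun q : NatIdx m => homMod (bar hB q.1) M) ⟨p, h⟩

theorem coProj_cel (m : ℤ) (p : ℕ) (h : (p : ℤ) = m) (x : (homMod (bar hB p) M).carrier) :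
    (coProj m p h).lin ((cel hB M m p h).lin x) = x :=
  LinearMap.congr_fun (congrArg GrModR.Hom.lin
    (sumIncl_sumProj (fun q : NatIdx m => homMod (bar hB q.1) M) ⟨p, h⟩)) x

theorem cel_coProj (m : ℤ) (p : ℕ) (h : (p : ℤ) = m) (x : ((coBar hB M).X m).carrier) :
    (cel hB M m p h).lin ((coProj m p h).lin x) = x :=
  LinearMap.congr_fun (congrArg GrModR.Hom.lin
    (sumProj_sumIncl (fun q : NatIdx m => homMod (bar hB q.1) M) ⟨p, h⟩)) x

theorem homD_coProj {i j : ℤ} (hij : i + 1 = j) (p : ℕ) (h : (p : ℤ) = i)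
    (x : ((coBar hB M).X i).carrier) (hx : ((coBar hB M).d i j).lin x = 0) :
    (homD hB M p).lin ((coProj i p h).lin x) = 0 := by
  rw [← cel_coProj i p h x, coBar_d hij] at hx
  rw [← coProj_cel j (p + 1) (by push_cast; omega) ((homD hB M p).lin ((coProj i p h).lin x)), hx,
    map_zero]

theorem cohomologyVanishes_coBar {m : ℤ} (hm : m ≠ 0) : CohomologyVanishes (coBar hB M) m := by
  intro x hx
  rcases lt_or_gt_of_ne hm with h | h
  · have := subsingleton_coBar M (hB := hB) h
    exact ⟨0, Subsingleton.elim _ _⟩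
  · obtain ⟨p, hp⟩ : ∃ p : ℕ, ((p + 1 : ℕ) : ℤ) = m := ⟨(m - 1).toNat, by push_cast; omega⟩
    obtain ⟨g, hg⟩ := exists_homD_eq (homD_coProj rfl (p + 1) hp x hx)
    refine ⟨(cel hB M (m - 1) p (by push_cast at hp; omega)).lin g, ?_⟩
    rw [coBar_d (by omega), hg, cel_coProj]

theorem cocycle_coBar_zero {x : ((coBar hB M).X 0).carrier} (hx : IsCocycle (coBar hB M) 0 x) :
    (cel hB M 0 0 rfl).lin ((coaug hB M).lin (evalOne hB M ((coProj 0 0 rfl).lin x))) = x := by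
  have h1 : (homD hB M 0).lin ((coProj (0 : ℤ) 0 rfl).lin x) = 0 :=
    homD_coProj (i := 0) (j := 0 + 1) rfl 0 rfl x hx
  rw [coaug_evalOne h1, cel_coProj]

variable (hB M)

/-- The embedding of `M` into the complex `hom_A(Bar(A, B, A), M)`. -/
noncomputable def coaugComplex :
    (HomologicalComplex.single (GrModR 𝒜) (ComplexShape.up ℤ) 0).obj M ⟶ coBar hB M :=
  HomologicalComplex.mkHomFromSingle (coaug hB M ≫ cel hB M 0 0 rfl) <| by
    rintro j hj
    refine GrModR.hom_ext (LinearMap.ext fun m => ?_)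
    change ((coBar hB M).d 0 j).lin ((cel hB M 0 0 rfl).lin ((coaug hB M).lin m)) = 0
    rw [coBar_d hj]
    have h1 : (homD hB M 0).lin ((coaug hB M).lin m) = 0 :=
      LinearMap.congr_fun (congrArg GrModR.Hom.lin (coaug_homD hB M)) m
    rw [h1, map_zero]

end Coaugmentation

/-! ### Quasi-isomorphisms and the cohomology of S. -/

section Resolution

/-- In degree 0 the target has no nonzero coboundaries, since its term of degree -1 is zero.
Evaluation at 1 ⊗ 1 inverts the embedding of M on cocycles, and all other cohomology vanishes. -/
theorem isQuasiIso_coaugComplex (hB : SetLike.IsHomogeneous 𝒜 B) (M : GrModR 𝒜) :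
    IsQuasiIso (coaugComplex hB M) := by
  intro n
  by_cases hn : n = 0
  · subst hn
    let e := HomologicalComplex.singleObjXSelf (ComplexShape.up ℤ) 0 M
    have he : ∀ x, ((coaugComplex hB M).f 0).lin x =
        (cel hB M 0 0 rfl).lin ((coaug hB M).lin (e.hom.lin x)) := fun x =>
      LinearMap.congr_fun (congrArg GrModR.Hom.lin
        (HomologicalComplex.mkHomFromSingle_f (coaug hB M ≫ cel hB M 0 0 rfl) _)) x
    have he' : ∀ m, e.hom.lin (e.inv.lin m) = m := fun m =>
      LinearMap.congr_fun (congrArg GrModR.Hom.lin e.inv_hom_id) m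
    have he'' : ∀ x, e.inv.lin (e.hom.lin x) = x := fun x =>
      LinearMap.congr_fun (congrArg GrModR.Hom.lin e.hom_inv_id) x
    refine ⟨fun x _ hx => ?_, fun y hy => ?_⟩
    · obtain ⟨y, hy⟩ := hx
      have := subsingleton_coBar (M := M) (hB := hB) (m := 0 - 1) (by omega)
      rw [Subsingleton.elim y 0, map_zero, he] at hy
      have h1 := congrArg (fun z => evalOne hB M ((coProj 0 0 rfl).lin z)) hy
      simp only [coProj_cel, evalOne_coaug, map_zero] at h1
      rw [← he'' x, ← h1, map_zero]
      exact isCobound_zero _ _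
    · refine ⟨e.inv.lin (evalOne hB M ((coProj 0 0 rfl).lin y)), ?_, ?_⟩
      · rw [IsCocycle, HomologicalComplex.single_obj_d]
        rfl
      · rw [he, he', cocycle_coBar_zero hy, sub_self]
        exact isCobound_zero _ _
  · have h1 := subsingleton_of_isZero (HomologicalComplex.isZero_single_obj_X
      (ComplexShape.up ℤ) 0 M n hn)
    refine ⟨fun x _ _ => ?_, fun y hy => ⟨0, map_zero _, ?_⟩⟩
    · rw [Subsingleton.elim x 0]
      exact isCobound_zero _ _
    · rw [map_zero, sub_zero]
      exact cohomologyVanishes_coBar hn y hy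

variable (hN : SetLike.IsHomogeneous 𝒜 N) (hB : SetLike.IsHomogeneous 𝒜 B) (M : GrModR 𝒜)

/-- The homotopy inverse is only N-linear, but cocycles and coboundaries do not depend on the module
structure, so the A-linear augmentation is a quasi-isomorphism. -/
theorem isQuasiIso_aug : IsQuasiIso (aug hN hB M) := by
  refine fun n => ⟨fun x hx hx' => ?_, fun y hy => ?_⟩
  · obtain ⟨y, hy⟩ := hx'
    have h1 := snocF_homotopy (n - 1) n (n + 1) (by omega) rfl x
    have h2 := unitF_d (hN := hN) (n - 1) n (by omega) y
    rw [IsCocycle] at hx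
    rw [hx, map_zero, zero_add] at h1
    change _ = (augF hN hB M n).lin x at hy
    refine ⟨restrictLin (snocF hN hB M n (n - 1) (by omega)) x +
      restrictLin (unitF hN hB M (n - 1)) y, ?_⟩
    rw [map_add, h1, h2, hy, sub_add_cancel]
  · refine ⟨restrictLin (unitF hN hB M n) y, ?_, ?_⟩
    · rw [IsCocycle, unitF_d n (n + 1) rfl, hy, map_zero]
    · change IsCobound _ n (y - (augF hN hB M n).lin _)
      rw [augF_unitF, sub_self]
      exact isCobound_zero _ _

theorem isCocycle_augF {n : ℤ} {x : ((semiBar hN hB M).X n).carrier}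
    (hx : IsCocycle (semiBar hN hB M) n x) :
    IsCocycle (coBar hB M) n ((augF hN hB M n).lin x) := by
  rw [IsCocycle] at hx ⊢
  rw [augF_d n (n + 1) rfl, hx, map_zero]

theorem cohomologyVanishes_semiBar {n : ℤ} (hn : n ≠ 0) :
    CohomologyVanishes (semiBar hN hB M) n := fun x hx =>
  (isQuasiIso_aug hN hB M n).1 x hx (cohomologyVanishes_coBar hn _ (isCocycle_augF hN hB M hx))

/-- The isomorphism is the augmentation followed by evaluation at 1 ⊗ 1. On cocycles the
augmentation is the image of this value under the embedding of M, so A-linearity follows from that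
of the augmentation and the embedding. -/
theorem cohomologyIso_semiBar : CohomologyIso (semiBar hN hB M) 0 M := by
  let Φ : ((semiBar hN hB M).X 0).carrier →ₗ[k] M.carrier :=
    evalOne hB M ∘ₗ (coProj 0 0 rfl).lin ∘ₗ (augF hN hB M 0).lin
  have hΦ : ∀ x, IsCocycle (semiBar hN hB M) 0 x →
      (cel hB M 0 0 rfl).lin ((coaug hB M).lin (Φ x)) = (augF hN hB M 0).lin x :=
    fun x hx => cocycle_coBar_zero (isCocycle_augF hN hB M hx)
  -- Evaluation at 1 ⊗ 1 is a left inverse of the embedding of M, so Φ x is the only element whose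
  -- image can be the augmentation of x.
  have hΦ' : ∀ x m, (cel hB M 0 0 rfl).lin ((coaug hB M).lin m) = (augF hN hB M 0).lin x →
      Φ x = m := fun x m h => by
    simp only [Φ, LinearMap.comp_apply]
    rw [← h, coProj_cel, evalOne_coaug]
  refine ⟨Φ ∘ₗ (LinearMap.ker _).subtype, fun m => ?_, fun x => ⟨fun hx => ?_, fun hx => ?_⟩,
    fun a x y hy => ?_, fun i x hx => ?_⟩
  · refine ⟨⟨restrictLin (unitF hN hB M 0) ((cel hB M 0 0 rfl).lin ((coaug hB M).lin m)), ?_⟩, ?_⟩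
    · have h1 : (homD hB M 0).lin ((coaug hB M).lin m) = 0 :=
        LinearMap.congr_fun (congrArg GrModR.Hom.lin (coaug_homD hB M)) m
      rw [LinearMap.mem_ker, unitF_d 0 _ rfl, coBar_d rfl, h1, map_zero, map_zero]
    · exact hΦ' _ _ (augF_unitF _ _).symm
  · refine (isQuasiIso_aug hN hB M 0).1 x.1 x.2 ?_
    have h1 := hΦ x.1 x.2
    change Φ x.1 = 0 at hx
    rw [hx, map_zero, map_zero] at h1
    change IsCobound _ 0 ((augF hN hB M 0).lin x.1)
    rw [← h1]
    exact isCobound_zero _ _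
  · obtain ⟨y, hy⟩ := hx
    have := subsingleton_coBar (M := M) (hB := hB) (m := 0 - 1) (by omega)
    refine hΦ' _ _ ?_
    change _ = (augF hN hB M 0).lin x.1
    rw [← hy, ← augF_d _ _ (by omega), Subsingleton.elim ((augF hN hB M (0 - 1)).lin y) 0, map_zero,
      map_zero, map_zero]
  · refine hΦ' _ _ ?_
    change _ = (augF hN hB M 0).lin y.1
    rw [hy, (augF hN hB M 0).map_act, (coaug hB M).map_act, (cel hB M 0 0 rfl).map_act]
    exact congrArg (((coBar hB M).X 0).act a) (hΦ x.1 x.2)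
  · exact evalOne_deg hB M ((coProj 0 0 rfl).map_deg i _ ((augF hN hB M 0).map_deg i _ hx))

end Resolution

/-! ### The terms of both complexes are bounded above. -/

section Boundedness

variable (h : TriangularDecomposition 𝒜 N B) {M : GrModR 𝒜}

theorem termsBoundedAbove_coBar (hM : M.BoundedAbove) :
    TermsBoundedAbove (coBar h.homogeneous_B M) := fun m => by
  obtain ⟨K, hK⟩ := hM
  exact ⟨K, fun i hi => sumMod_deg_eq_bot (F := fun q : NatIdx m => homMod (bar h.homogeneous_B q.1) M)
    (fun q i hi => homMod_deg_eq_bot h hK q.1 i hi) i hi⟩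

theorem termsBoundedAbove_semiBar (hM : M.BoundedAbove) :
    TermsBoundedAbove (semiBar h.homogeneous_N h.homogeneous_B M) := fun m => by
  obtain ⟨K, hK⟩ := hM
  exact ⟨K, fun i hi => sumMod_deg_eq_bot
    (F := fun q : TotIdx m => term h.homogeneous_N h.homogeneous_B M q.1.1 q.1.2)
    (fun q i hi => tensorMod_deg_eq_bot h (fun i hi => homMod_deg_eq_bot h hK q.1.1 i hi) q.1.2 i hi)
    i hi⟩

end Boundedness

end Resolutions

end SemiInf

theorem proposition2p6p3 {k A : Type u} [Field k] [Ring A] [Algebra k A]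
    (𝒜 : ℤ → Submodule k A) [GradedAlgebra 𝒜] (N B : Subalgebra k A)
    (h : SemiInf.TriangularDecomposition 𝒜 N B)
    (M : SemiInf.GrModR 𝒜) (hM : M.BoundedAbove) :
    SemiInf.IsSemijectiveResolution N (SemiInf.semiBar h.homogeneous_N h.homogeneous_B M) M ∧
      SemiInf.CohomologyIso (SemiInf.semiBar h.homogeneous_N h.homogeneous_B M) 0 M ∧
      ∀ n ≠ 0, SemiInf.CohomologyVanishes
        (SemiInf.semiBar h.homogeneous_N h.homogeneous_B M) n :=
  ⟨⟨⟨SemiInf.termsBoundedAbove_semiBar h hM, SemiInf.isKInj_semiBar h M,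
      SemiInf.isRelKProj_semiBar⟩,
    -- The derived isomorphism is the pair of quasi-isomorphisms S → hom_A(Bar(A,B,A),M) ← M.
    SemiInf.coBar h.homogeneous_B M, SemiInf.aug _ _ M, SemiInf.coaugComplex _ M,
      SemiInf.termsBoundedAbove_coBar h hM, SemiInf.isQuasiIso_aug _ _ M,
      SemiInf.isQuasiIso_coaugComplex _ M⟩,
    SemiInf.cohomologyIso_semiBar _ _ M,
    fun _ hn => SemiInf.cohomologyVanishes_semiBar _ _ M hn⟩
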